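/- Let $\lambda\in(-1/4,\,3/4)$, let $f_1\in\mathbb R$, $f_1\neq 0$, and put $A=\tfrac34-\lambda\in(0,1)$, $\mathcal F=2^{-A}f_1$ and $\chi_{m,l}=Al+(1-A)m$ for $m,l\ge 0$. Consider the primary resonance equation $$ i\Psi'(t)+\bigl(|\Psi(t)|^2-t\bigr)\Psi(t)=f(t),\qquad f(t)=f_1t^{2\lambda}. $$ For each $n\in\{0,1\}$ there exist $t_0>0$ and a solution $\Psi$ of this equation on $(t_0,\infty)$ of the form $$ \Psi(t)=\sqrt t\,e^{-it^2/2}\,\bigl(1+\rho(\tau)\bigr)e^{i(\tau+\alpha(\tau))},\qquad \tau=t^2/2, $$ with real differentiable functions $\rho,\alpha$ on $(t_0^2/2,\infty)$ which, for some real coefficients $a_{m,l}$, $r_{m,l}$, have the asymptotic expansions $$ \alpha(\tau)\sim \pi n+\tau^{A-1}\sum_{m,l=0}^{\infty}a_{m,l}\,\tau^{-\chi_{m,l}},\qquad \rho(\tau)\sim\tau^{-A}\sum_{m,l=0}^{\infty}r_{m,l}\,\tau^{-\chi_{m,l}}\qquad(\tau\to\infty), $$ with leading coefficients $a_{0,0}=-\dfrac{(-1)^n}{4\mathcal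 F}$ and $r_{0,0}=\dfrac{(-1)^n\mathcal F}{2}$. Here $g(\tau)\sim\tau^{s}\sum_{m,l} c_{m,l}\tau^{-\chi_{m,l}}$ means that for every real $N$ one has $g(\tau)-\tau^s\sum_{\chi_{m,l}\le N}c_{m,l}\tau^{-\chi_{m,l}}=o(\tau^{s-N})$ as $\tau\to\infty$ (each such sum is finite). The solution is autoresonant: $|\Psi(t)|\sim\sqrt t$ as $t\to\infty$, whatever the values of $f_1$ and $\lambda$. In particular, for $-1/4<\lambda<0$ this happens although the forcing amplitude $f_1t^{2\lambda}$ tends to $0$. -/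

import Mathlib

open Filter Topology Asymptotics

/-- `Ψ` solves the primary resonance equation `i Ψ' + (|Ψ|² - t) Ψ = f` on the half-line
`t > t₀`. -/
def SolvesPrimaryResonance (f : ℝ → ℝ) (t₀ : ℝ) (Ψ : ℝ → ℂ) : Prop :=
  ∀ t : ℝ, t₀ < t → DifferentiableAt ℝ Ψ t ∧
    Complex.I * deriv Ψ t + ((‖Ψ t‖ ^ 2 - t : ℝ) : ℂ) * Ψ t = (f t : ℂ)

/-- The substitution `Ψ = √t e^{-i t²/2} ψ(τ)`, `ψ(τ) = (1 + ρ(τ)) e^{i (τ + α(τ))}`,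
`τ = t²/2`. -/
noncomputable def resonanceAnsatz (ρ α : ℝ → ℝ) (t : ℝ) : ℂ :=
  (√t : ℂ) * Complex.exp (-Complex.I * ((t ^ 2 / 2 : ℝ) : ℂ)) *
    (((1 + ρ (t ^ 2 / 2) : ℝ) : ℂ) *
      Complex.exp (Complex.I * ((t ^ 2 / 2 + α (t ^ 2 / 2) : ℝ) : ℂ)))

/-- The asymptotic expansion `g(τ) ∼ τ ^ s * ∑ i, c i * τ ^ (-χ i)` as `τ → ∞`, where the
exponents `χ i` tend to infinity: for every `N`, the difference of `g` and the finite sum of the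
terms with `χ i ≤ N` is `o(τ ^ (s - N))`. -/
def HasPowerExpansion {ι : Type*} (g : ℝ → ℝ) (s : ℝ) (χ c : ι → ℝ) : Prop :=
  ∃ hfin : ∀ N : ℝ, {i | χ i ≤ N}.Finite, ∀ N : ℝ,
    (fun τ : ℝ => g τ - τ ^ s * ∑ i ∈ (hfin N).toFinset, c i * τ ^ (-χ i))
      =o[atTop] fun τ : ℝ => τ ^ (s - N)

/-- The exponents `χ_{m,l} = A l + (1 - A) m`. -/
def resonanceExponent (A : ℝ) (p : ℕ × ℕ) : ℝ := A * p.2 + (1 - A) * p.1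

/-! Put `R = 1 + ρ`, `β = α - π n` and `G = (-1)^n 𝓕`. The fast phases in the ansatz cancel, and in
the time `τ` the equation becomes a system for `R` and `β` that depends on `n` only through `G`. In
the variables `S = R² - 1`, `v = R sin β` it reads `S' = -(1 + S)/(2τ) - 2Gτ^(-A) v`, `v' = -v/(4τ)
- Gτ^(-A) + S√(1 + S - v²)`, which is smooth near the origin (`SolvesPlanar`).

Formal solution. With `X = τ^(-(1-A))` and `Y = τ^(-A)` one has `XY = 1/τ`, and `τ d/dτ` acts on
polynomials in `X, Y` as a derivation. Writing `S = Y j`, `v = X b`, `√(1 + S - v²) = 1 + c` turns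
the system into a fixed-point problem that gains one order in the ideal `(X, Y)` per step
(`formalIterate_sub_mem`). The iterates therefore define formal power series, and the `k`-th one
satisfies the system up to `O(τ^(-k min(A, 1-A)))` (`residualS_isBigO`, `residualV_isBigO`).

True solution. Linearized along an approximation, the system is `p' ≈ -2Gτ^(-A) q`, `q' ≈ κ p` with
`κ → 1`. A weight `ς`, `q = ς Q`, balances it to `P' = ε ω Q`, `Q' = ω P`, where `ε = ±1` has the
sign of `-G` and `ω` is of order `τ^(-A/2)`, so `τ ω → ∞`. For `ε = -1` both modes rotate and are
integrated from infinity; for `ε = 1` the growing mode is integrated from infinity and the decaying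
one from a finite time. On functions `O(τ^(-1-M))` this inverts the system with gain `2τ/M`. All
remaining terms have Lipschitz constant at most `4/τ`, so a large fixed `M` (here 16) makes a
contraction and gives a solution within `τ^(-16)` of a sufficiently late approximation in the
weighted norm (`exists_decaying_solution`, `LinearFrame.exists_solution`).

Full expansion. That one solution is then compared with every later approximation. The difference
solves the same linear system with smaller forcing, and a decaying solution inherits the decay of
its forcing (`decay_of_decaying_solution`), so the solution follows the formal series to every
order; uniqueness is not needed. Taylor expansion of `√(1 + S) - 1` and `arcsin (v / R)` carries the
expansions over to `ρ` and `α`. -/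

/-! ### Polynomials in two negative powers of `τ` -/

/-- Evaluation of a polynomial in two variables at `(τ ^ (-(1 - A)), τ ^ (-A))`. -/
noncomputable def powerEval (A : ℝ) (p : MvPolynomial (Fin 2) ℝ) (τ : ℝ) : ℝ :=
  MvPolynomial.eval ![τ ^ (-(1 - A)), τ ^ (-A)] p

/-- The derivation of the polynomial ring which represents `τ d/dτ` under `powerEval`. -/
noncomputable def scaleDeriv (A : ℝ) :
    Derivation ℝ (MvPolynomial (Fin 2) ℝ) (MvPolynomial (Fin 2) ℝ) :=
  MvPolynomial.mkDerivation ℝ ![-(1 - A) • MvPolynomial.X 0, (-A) • MvPolynomial.X 1]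

@[simp] lemma powerEval_add (A : ℝ) (p q : MvPolynomial (Fin 2) ℝ) (τ : ℝ) :
    powerEval A (p + q) τ = powerEval A p τ + powerEval A q τ := by simp [powerEval]

@[simp] lemma powerEval_sub (A : ℝ) (p q : MvPolynomial (Fin 2) ℝ) (τ : ℝ) :
    powerEval A (p - q) τ = powerEval A p τ - powerEval A q τ := by simp [powerEval]

@[simp] lemma powerEval_mul (A : ℝ) (p q : MvPolynomial (Fin 2) ℝ) (τ : ℝ) :
    powerEval A (p * q) τ = powerEval A p τ * powerEval A q τ := by simp [powerEval]

@[simp] lemma powerEval_pow (A : ℝ) (p : MvPolynomial (Fin 2) ℝ) (k : ℕ) (τ : ℝ) :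
    powerEval A (p ^ k) τ = powerEval A p τ ^ k := by simp [powerEval]

@[simp] lemma powerEval_neg (A : ℝ) (p : MvPolynomial (Fin 2) ℝ) (τ : ℝ) :
    powerEval A (-p) τ = -powerEval A p τ := by simp [powerEval]

@[simp] lemma powerEval_C (A c τ : ℝ) : powerEval A (MvPolynomial.C c) τ = c := by
  simp [powerEval]

@[simp] lemma powerEval_zero (A τ : ℝ) : powerEval A 0 τ = 0 := by
  simp [powerEval]

@[simp] lemma powerEval_one (A τ : ℝ) : powerEval A 1 τ = 1 := by
  simp [powerEval]

@[simp] lemma powerEval_X_zero (A τ : ℝ) :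
    powerEval A (MvPolynomial.X 0) τ = τ ^ (-(1 - A)) := by
  simp [powerEval]

@[simp] lemma powerEval_X_one (A τ : ℝ) : powerEval A (MvPolynomial.X 1) τ = τ ^ (-A) := by
  simp [powerEval]

@[simp] lemma powerEval_smul (A c τ : ℝ) (p : MvPolynomial (Fin 2) ℝ) :
    powerEval A (c • p) τ = c * powerEval A p τ := by simp [powerEval]

/-- Both sides obey the Leibniz rule, so only the generators matter, and each power `τ^(-c)` is an
eigenvector of `τ d/dτ`. -/
lemma hasDerivAt_powerEval (A : ℝ) (p : MvPolynomial (Fin 2) ℝ) {τ : ℝ} (hτ : 0 < τ) :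
    HasDerivAt (powerEval A p) (powerEval A (scaleDeriv A p) τ / τ) τ := by
  induction p using MvPolynomial.induction_on with
  | C a =>
    have : powerEval A (MvPolynomial.C a) = fun _ => a := by ext; simp
    rw [this, MvPolynomial.C_eq_algebraMap, Derivation.map_algebraMap]
    simpa using hasDerivAt_const τ a
  | add p q hp hq =>
    have := hp.add hq
    simp only [map_add, powerEval_add, add_div]
    exact this.congr_of_eventuallyEq (Eventually.of_forall fun s => by simp)
  | mul_X p i hp =>
    have key : ∀ c : ℝ, HasDerivAt (fun s : ℝ => s ^ (-c)) ((-c) * τ ^ (-c) / τ) τ := by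
      intro c
      have := Real.hasDerivAt_rpow_const (x := τ) (p := -c) (Or.inl hτ.ne')
      rwa [Real.rpow_sub_one hτ.ne', ← mul_div_assoc] at this
    have hX : HasDerivAt (powerEval A (MvPolynomial.X i))
        (powerEval A (scaleDeriv A (MvPolynomial.X i)) τ / τ) τ := by
      rw [scaleDeriv, MvPolynomial.mkDerivation_X]
      fin_cases i
      · refine ((key (1 - A)).congr_of_eventuallyEq
          (Eventually.of_forall fun s => by simp)).congr_deriv ?_
        simp
      · refine ((key A).congr_of_eventuallyEq
          (Eventually.of_forall fun s => by simp)).congr_deriv ?_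
        simp
    refine ((hp.mul hX).congr_of_eventuallyEq
      (Eventually.of_forall fun s => by simp)).congr_deriv ?_
    simp only [Derivation.leibniz, smul_eq_mul, powerEval_add, powerEval_mul]
    ring

lemma powerEval_eq_sum (A : ℝ) (p : MvPolynomial (Fin 2) ℝ) {τ : ℝ} (hτ : 0 < τ) :
    powerEval A p τ =
      ∑ d ∈ p.support, p.coeff d * τ ^ (-resonanceExponent A (d 0, d 1)) := by
  rw [powerEval, MvPolynomial.eval_eq']
  refine Finset.sum_congr rfl fun d _ => ?_
  simp only [Fin.prod_univ_two, Matrix.cons_val_zero, Matrix.cons_val_one, resonanceExponent]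
  rw [← Real.rpow_natCast, ← Real.rpow_natCast, ← Real.rpow_mul hτ.le, ← Real.rpow_mul hτ.le,
    ← Real.rpow_add hτ]
  congr 2
  ring

/-! ### Orders of decay and powers of the ideal of the variables -/

lemma rpow_isBigO_rpow {a b : ℝ} (h : a ≤ b) :
    (fun τ : ℝ => τ ^ a) =O[atTop] fun τ : ℝ => τ ^ b := by
  refine IsBigO.of_bound 1 ?_
  filter_upwards [eventually_ge_atTop (1 : ℝ)] with τ hτ
  rw [Real.norm_of_nonneg (by positivity), Real.norm_of_nonneg (by positivity), one_mul]
  exact Real.rpow_le_rpow_of_exponent_le hτ h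

lemma rpow_isLittleO_rpow {a b : ℝ} (h : a < b) :
    (fun τ : ℝ => τ ^ a) =o[atTop] fun τ : ℝ => τ ^ b := by
  rw [isLittleO_iff_tendsto' (by
    filter_upwards [eventually_gt_atTop (0 : ℝ)] with τ hτ h0
    exact absurd h0 (Real.rpow_pos_of_pos hτ b).ne')]
  refine (tendsto_rpow_neg_atTop (sub_pos.2 h)).congr' ?_
  filter_upwards [eventually_gt_atTop (0 : ℝ)] with τ hτ
  rw [← Real.rpow_sub hτ]
  congr 1
  ring

lemma resonanceExponent_ge {A : ℝ} (p : ℕ × ℕ) :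
    (p.1 + p.2 : ℝ) * min A (1 - A) ≤ resonanceExponent A p := by
  have h1 : (p.2 : ℝ) * min A (1 - A) ≤ p.2 * A :=
    mul_le_mul_of_nonneg_left (min_le_left _ _) (Nat.cast_nonneg _)
  have h2 : (p.1 : ℝ) * min A (1 - A) ≤ p.1 * (1 - A) :=
    mul_le_mul_of_nonneg_left (min_le_right _ _) (Nat.cast_nonneg _)
  simp only [resonanceExponent]
  linarith

/-- The ideal of polynomials without constant term. -/
noncomputable abbrev varIdeal : Ideal (MvPolynomial (Fin 2) ℝ) := MvPolynomial.idealOfVars _ _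

lemma X_mem_varIdeal (i : Fin 2) : MvPolynomial.X i ∈ varIdeal := by
  exact Ideal.subset_span ⟨i, rfl⟩

/-- The bridge from algebra to asymptotics: every monomial present has total degree at least `k`,
and each variable contributes a decay of at least `τ^(-min A (1 - A))`. -/
lemma powerEval_isBigO {A : ℝ} (hA0 : 0 < A) (hA1 : A < 1) {k : ℕ}
    {p : MvPolynomial (Fin 2) ℝ} (hp : p ∈ varIdeal ^ k) :
    powerEval A p =O[atTop] fun τ : ℝ => τ ^ (-(k * min A (1 - A))) := by
  have h0 : 0 < min A (1 - A) := lt_min hA0 (by linarith)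
  have : powerEval A p =ᶠ[atTop] fun τ =>
      ∑ d ∈ p.support, p.coeff d * τ ^ (-resonanceExponent A (d 0, d 1)) := by
    filter_upwards [eventually_gt_atTop (0 : ℝ)] with τ hτ
    exact powerEval_eq_sum A p hτ
  refine this.trans_isBigO (IsBigO.fun_sum fun d hd => ?_)
  refine IsBigO.const_mul_left (rpow_isBigO_rpow ?_) _
  rw [neg_le_neg_iff]
  have hdeg := (MvPolynomial.mem_pow_idealOfVars_iff k p).1 hp d hd
  have : (k : ℝ) ≤ d 0 + d 1 := by
    rw [Finsupp.degree_eq_sum, Fin.sum_univ_two] at hdeg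
    exact_mod_cast hdeg
  exact le_trans (mul_le_mul_of_nonneg_right this h0.le) (resonanceExponent_ge (d 0, d 1))

/-- The generators are eigenvectors of the derivation, so by Leibniz `τ d/dτ` costs no order. This
is what makes the derivative terms harmless in the iteration. -/
lemma scaleDeriv_mem {A : ℝ} {k : ℕ} {p : MvPolynomial (Fin 2) ℝ} (hp : p ∈ varIdeal ^ k) :
    scaleDeriv A p ∈ varIdeal ^ k := by
  induction k generalizing p with
  | zero => simp
  | succ k ih =>
    rw [pow_succ] at hp
    induction hp using Submodule.mul_induction_on' with
    | mem_mul_mem a ha b hb =>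
      rw [Derivation.leibniz, smul_eq_mul, smul_eq_mul, pow_succ]
      refine add_mem (Ideal.mul_mem_mul ha ?_) (mul_comm b _ ▸ Ideal.mul_mem_mul (ih ha) hb)
      clear ha
      induction hb using Submodule.span_induction with
      | mem x hx =>
        obtain ⟨i, rfl⟩ := hx
        rw [scaleDeriv, MvPolynomial.mkDerivation_X]
        fin_cases i
        · exact Submodule.smul_of_tower_mem _ _ (X_mem_varIdeal 0)
        · exact Submodule.smul_of_tower_mem _ _ (X_mem_varIdeal 1)
      | zero => simp
      | add x y _ _ hx hy => rw [map_add]; exact add_mem hx hy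
      | smul r x hx hx' =>
        rw [smul_eq_mul, Derivation.leibniz, smul_eq_mul, smul_eq_mul]
        exact add_mem (Ideal.mul_mem_left _ _ hx') (Ideal.mul_mem_right _ _ hx)
    | add x _ y _ hx hy => rw [map_add]; exact add_mem hx hy

/-! ### Formal expansions and their calculus -/

/-- `g` has the formal expansion given by the formal power series in
`τ ^ (-(1 - A))`, `τ ^ (-A)` with truncations `p k`. -/
def IsFormalExpansion (A : ℝ) (p : ℕ → MvPolynomial (Fin 2) ℝ) (g : ℝ → ℝ) : Prop :=
  (∀ k, p (k + 1) - p k ∈ varIdeal ^ k) ∧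
    ∀ k : ℕ, (fun τ => g τ - powerEval A (p k) τ) =O[atTop]
      fun τ : ℝ => τ ^ (-(k * min A (1 - A)))

lemma sub_mem_varIdeal_pow {p : ℕ → MvPolynomial (Fin 2) ℝ}
    (hp : ∀ k, p (k + 1) - p k ∈ varIdeal ^ k) {k l : ℕ} (h : k ≤ l) :
    p l - p k ∈ varIdeal ^ k := by
  induction l, h using Nat.le_induction with
  | base => simp
  | succ l hl ih =>
    have := add_mem (Ideal.pow_le_pow_right hl (hp l)) ih
    rwa [sub_add_sub_cancel] at this

lemma mul_sub_mul_mem {R : Type*} [CommRing R] {J : Ideal R} {a a' b b' : R}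
    (ha : a - a' ∈ J) (hb : b - b' ∈ J) : a * b - a' * b' ∈ J := by
  have : a * b - a' * b' = (a - a') * b + a' * (b - b') := by ring
  rw [this]
  exact add_mem (Ideal.mul_mem_right _ _ ha) (Ideal.mul_mem_left _ _ hb)

lemma pow_sub_pow_mem {R : Type*} [CommRing R] {J : Ideal R} {a a' : R}
    (ha : a - a' ∈ J) (n : ℕ) : a ^ n - a' ^ n ∈ J :=
  Ideal.mem_of_dvd J (sub_dvd_pow_sub_pow a a' n) ha

section

variable {A : ℝ} {p q : ℕ → MvPolynomial (Fin 2) ℝ} {g h : ℝ → ℝ}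

lemma powerEval_isBigO_one (hA0 : 0 < A) (hA1 : A < 1) (p : MvPolynomial (Fin 2) ℝ) :
    powerEval A p =O[atTop] fun _ : ℝ => (1 : ℝ) := by
  simpa using powerEval_isBigO hA0 hA1 (k := 0) (p := p) (by simp)

lemma IsFormalExpansion.isBigO_one (hA0 : 0 < A) (hA1 : A < 1) (hg : IsFormalExpansion A p g) :
    g =O[atTop] fun _ : ℝ => (1 : ℝ) := by
  have h1 := hg.2 0
  simp only [Nat.cast_zero, zero_mul, neg_zero, Real.rpow_zero] at h1
  simpa using h1.add (powerEval_isBigO_one hA0 hA1 (p 0))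

/-- It suffices to approximate by arbitrarily late truncations, to any order. -/
lemma IsFormalExpansion.of_frequently (hA0 : 0 < A) (hA1 : A < 1)
    (hp : ∀ k, p (k + 1) - p k ∈ varIdeal ^ k)
    (hg : ∀ k : ℕ, ∃ l ≥ k, (fun τ => g τ - powerEval A (p l) τ) =O[atTop]
      fun τ : ℝ => τ ^ (-(k * min A (1 - A)))) : IsFormalExpansion A p g := by
  refine ⟨hp, fun k => ?_⟩
  obtain ⟨l, hl, h⟩ := hg k
  have := h.add (powerEval_isBigO hA0 hA1 (sub_mem_varIdeal_pow hp hl))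
  refine this.congr_left fun τ => ?_
  simp

lemma isFormalExpansion_powerEval (P : MvPolynomial (Fin 2) ℝ) :
    IsFormalExpansion A (fun _ => P) (powerEval A P) :=
  ⟨fun k => by simp, fun k => by simpa using isBigO_zero _ _⟩

lemma IsFormalExpansion.congr (hg : IsFormalExpansion A p g) (hgh : g =ᶠ[atTop] h) :
    IsFormalExpansion A p h := by
  refine ⟨hg.1, fun k => (hg.2 k).congr' ?_ EventuallyEq.rfl⟩
  filter_upwards [hgh] with τ hτ
  rw [hτ]

lemma IsFormalExpansion.mul (hA0 : 0 < A) (hA1 : A < 1) (hg : IsFormalExpansion A p g)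
    (hh : IsFormalExpansion A q h) :
    IsFormalExpansion A (fun k => p k * q k) (fun τ => g τ * h τ) := by
  refine ⟨fun k => mul_sub_mul_mem (hg.1 k) (hh.1 k), fun k => ?_⟩
  have h1 := (hg.2 k).mul (hh.isBigO_one hA0 hA1)
  have h2 := (powerEval_isBigO_one hA0 hA1 (p k)).mul (hh.2 k)
  simp only [mul_one, one_mul] at h1 h2
  refine (h1.add h2).congr_left fun τ => ?_
  simp only [powerEval_mul]
  ring

/-- Composition with a smooth function. -/
lemma IsFormalExpansion.comp_smooth (hA0 : 0 < A) (hA1 : A < 1)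
    (hg : IsFormalExpansion A p g) (hp0 : ∀ k, p k ∈ varIdeal)
    {f : ℝ → ℝ} {c : ℕ → ℝ}
    (hf : ∀ n : ℕ, (fun s => f s - ∑ i ∈ Finset.range n, c i * s ^ i) =O[𝓝 0] fun s => s ^ n) :
    IsFormalExpansion A
      (fun k => ∑ i ∈ Finset.range k, MvPolynomial.C (c i) * p k ^ i) (fun τ => f (g τ)) := by
  set d := min A (1 - A) with hd
  have hdpos : 0 < d := lt_min hA0 (by linarith)
  have hgd : g =O[atTop] fun τ : ℝ => τ ^ (-d) := by
    have h1 := (hg.2 1).add (powerEval_isBigO hA0 hA1 (k := 1) (p := p 1) (by simpa using hp0 1))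
    simpa using h1
  have hg0 : Tendsto g atTop (𝓝 0) :=
    hgd.trans_tendsto (tendsto_rpow_neg_atTop hdpos)
  constructor
  · intro k
    beta_reduce
    rw [Finset.sum_range_succ, add_sub_right_comm]
    refine add_mem ?_ (Ideal.mul_mem_left _ _ (Ideal.pow_mem_pow (hp0 _) _))
    rw [← Finset.sum_sub_distrib]
    refine sum_mem fun i _ => ?_
    rw [← mul_sub]
    exact Ideal.mul_mem_left _ _ (pow_sub_pow_mem (hg.1 k) i)
  · intro k
    have h1 : (fun τ => f (g τ) - ∑ i ∈ Finset.range k, c i * g τ ^ i) =O[atTop]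
        fun τ : ℝ => τ ^ (-(k * d)) := by
      refine ((hf k).comp_tendsto hg0).trans ?_
      refine (hgd.pow k).trans_eventuallyEq ?_
      filter_upwards [eventually_gt_atTop (0 : ℝ)] with τ hτ
      rw [← Real.rpow_natCast, ← Real.rpow_mul hτ.le]
      congr 1
      ring
    have h2 : (fun τ => ∑ i ∈ Finset.range k, (c i * g τ ^ i - c i * powerEval A (p k) τ ^ i))
        =O[atTop] fun τ : ℝ => τ ^ (-(k * d)) := by
      refine IsBigO.fun_sum fun i _ => ?_
      have h3 : (fun τ => ∑ j ∈ Finset.range i, g τ ^ j * powerEval A (p k) τ ^ (i - 1 - j))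
          =O[atTop] fun _ : ℝ => (1 : ℝ) := by
        refine IsBigO.fun_sum fun j _ => ?_
        have := ((hg.isBigO_one hA0 hA1).pow j).mul
          ((powerEval_isBigO_one hA0 hA1 (p k)).pow (i - 1 - j))
        simpa using this
      have h4 := (h3.mul (hg.2 k)).const_mul_left (c i)
      simp only [one_mul] at h4
      refine h4.congr_left fun τ => ?_
      rw [(Commute.all (g τ) (powerEval A (p k) τ)).geom_sum₂_mul]
      ring
    refine (h1.add h2).congr_left fun τ => ?_
    have : powerEval A (∑ i ∈ Finset.range k, MvPolynomial.C (c i) * p k ^ i) τ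
        = ∑ i ∈ Finset.range k, c i * powerEval A (p k) τ ^ i := by
      simp [powerEval]
    rw [this, Finset.sum_sub_distrib]
    ring

lemma IsFormalExpansion.tendsto (hA0 : 0 < A) (hA1 : A < 1) (hg : IsFormalExpansion A p g) :
    Tendsto g atTop (𝓝 ((p 1).coeff 0)) := by
  set d := min A (1 - A) with hd
  have hdpos : 0 < d := lt_min hA0 (by linarith)
  have h1 : p 1 - MvPolynomial.C ((p 1).coeff 0) ∈ varIdeal ^ 1 := by
    rw [MvPolynomial.mem_pow_idealOfVars_iff']
    intro x hx
    have : x = 0 := (Finsupp.degree_eq_zero_iff x).1 (by omega)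
    subst this
    simp
  have h2 := (hg.2 1).add (powerEval_isBigO hA0 hA1 h1)
  have h3 : Tendsto (fun τ => g τ - (p 1).coeff 0) atTop (𝓝 0) := by
    refine (h2.congr_left fun τ => ?_).trans_tendsto (tendsto_rpow_neg_atTop (y := (1 : ℕ) * d) (by simpa))
    simp
  simpa using h3.add_const ((p 1).coeff 0)

lemma resonanceExponent_finite (hA0 : 0 < A) (hA1 : A < 1) (N : ℝ) :
    {i | resonanceExponent A i ≤ N}.Finite := by
  have hdpos : 0 < min A (1 - A) := lt_min hA0 (by linarith)
  obtain ⟨K, hK⟩ := exists_nat_gt (N / min A (1 - A))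
  refine ((Set.finite_Iic K).prod (Set.finite_Iic K)).subset fun i hi => ?_
  have h1 := (resonanceExponent_ge (A := A) i).trans hi
  rw [div_lt_iff₀ hdpos] at hK
  have h2 : (i.1 + i.2 : ℝ) < K := lt_of_mul_lt_mul_right (h1.trans_lt hK) hdpos.le
  have h3 : i.1 + i.2 < K := by exact_mod_cast h2
  simp only [Set.mem_prod, Set.mem_Iic]
  omega

/-- The coefficients of the formal power series with truncations `p k`. -/
noncomputable def limitCoeff (p : ℕ → MvPolynomial (Fin 2) ℝ) (i : ℕ × ℕ) : ℝ :=
  (p (i.1 + i.2 + 1)).coeff (Finsupp.equivFunOnFinite.symm ![i.1, i.2])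

/-- Since `p k` is final modulo the `k`-th power of the ideal, coefficients of degree `d` are frozen
from index `d + 1` on. For `K > N / min A (1 - A)` every exponent up to `N` has degree below `K`, so
`p K` carries all required coefficients, and its other monomials have exponent beyond `N`. -/
lemma IsFormalExpansion.hasPowerExpansion (hA0 : 0 < A) (hA1 : A < 1)
    (hg : IsFormalExpansion A p g) :
    HasPowerExpansion g 0 (resonanceExponent A) (limitCoeff p) := by
  set d := min A (1 - A) with hd
  have hdpos : 0 < d := lt_min hA0 (by linarith)
  refine ⟨resonanceExponent_finite hA0 hA1, fun N => ?_⟩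
  obtain ⟨K, hK⟩ := exists_nat_gt (N / d)
  rw [div_lt_iff₀ hdpos] at hK
  set e : ℕ × ℕ → (Fin 2 →₀ ℕ) := fun i => Finsupp.equivFunOnFinite.symm ![i.1, i.2] with he
  have he0 : ∀ i, e i 0 = i.1 := fun i => by simp [he]
  have he1 : ∀ i, e i 1 = i.2 := fun i => by simp [he]
  have heinj : Function.Injective e := by
    intro i j hij
    ext
    · rw [← he0, hij, he0]
    · rw [← he1, hij, he1]
  set S := (resonanceExponent_finite hA0 hA1 N).toFinset with hS
  have hcoeff : ∀ i ∈ S, limitCoeff p i = (p K).coeff (e i) := by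
    intro i hi
    rw [hS, Set.Finite.mem_toFinset] at hi
    have h1 := (resonanceExponent_ge (A := A) i).trans hi
    have h2 : (i.1 + i.2 : ℝ) < K := lt_of_mul_lt_mul_right (h1.trans_lt hK) hdpos.le
    have h3 : i.1 + i.2 + 1 ≤ K := by exact_mod_cast h2
    have h4 := (MvPolynomial.mem_pow_idealOfVars_iff' _ _).1 (sub_mem_varIdeal_pow hg.1 h3) (e i)
      (by rw [Finsupp.degree_eq_sum, Fin.sum_univ_two, he0, he1]; omega)
    rw [MvPolynomial.coeff_sub, sub_eq_zero] at h4
    exact h4.symm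
  have hmain : (fun τ => g τ - τ ^ (0 : ℝ) * ∑ i ∈ S, limitCoeff p i * τ ^ (-resonanceExponent A i))
      =ᶠ[atTop] fun τ => (g τ - powerEval A (p K) τ) +
        ∑ x ∈ (p K).support \ S.image e,
          (p K).coeff x * τ ^ (-resonanceExponent A (x 0, x 1)) := by
    filter_upwards [eventually_gt_atTop (0 : ℝ)] with τ hτ
    have h1 : ∑ i ∈ S, limitCoeff p i * τ ^ (-resonanceExponent A i)
        = ∑ x ∈ S.image e, (p K).coeff x * τ ^ (-resonanceExponent A (x 0, x 1)) := by
      rw [Finset.sum_image heinj.injOn]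
      refine Finset.sum_congr rfl fun i hi => ?_
      rw [hcoeff i hi, he0, he1]
    have h2 : powerEval A (p K) τ = ∑ x ∈ (p K).support ∪ S.image e,
        (p K).coeff x * τ ^ (-resonanceExponent A (x 0, x 1)) := by
      rw [powerEval_eq_sum A _ hτ]
      refine Finset.sum_subset Finset.subset_union_left fun x _ hx => ?_
      rw [MvPolynomial.notMem_support_iff.1 hx, zero_mul]
    have h3 := Finset.sum_sdiff (f := fun x : Fin 2 →₀ ℕ =>
        (p K).coeff x * τ ^ (-resonanceExponent A (x 0, x 1)))
      (Finset.subset_union_right (s₁ := (p K).support) (s₂ := S.image e))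
    rw [Finset.union_sdiff_right] at h3
    rw [Real.rpow_zero, one_mul, h1, h2, ← h3]
    ring
  refine hmain.trans_isLittleO (IsLittleO.add ?_ (IsLittleO.fun_sum fun x hx => ?_))
  · refine (hg.2 K).trans_isLittleO (rpow_isLittleO_rpow ?_)
    linarith
  · refine IsLittleO.const_mul_left (rpow_isLittleO_rpow ?_) _
    by_contra! hcon
    refine (Finset.mem_sdiff.1 hx).2 (Finset.mem_image.2 ⟨(x 0, x 1), ?_, ?_⟩)
    · rw [hS, Set.Finite.mem_toFinset, Set.mem_ofPred_eq]
      linarith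
    · ext i
      fin_cases i
      · exact he0 _
      · exact he1 _

lemma limitCoeff_zero (p : ℕ → MvPolynomial (Fin 2) ℝ) :
    limitCoeff p (0, 0) = (p 1).coeff 0 := by
  rw [limitCoeff]
  congr 1
  ext i
  fin_cases i <;> simp

end

lemma HasPowerExpansion.mul_rpow {ι : Type*} {g G : ℝ → ℝ} {χ c : ι → ℝ} {s : ℝ}
    (hg : HasPowerExpansion g 0 χ c) (hG : G =ᶠ[atTop] fun τ => τ ^ s * g τ) :
    HasPowerExpansion G s χ c := by
  obtain ⟨hfin, h⟩ := hg
  refine ⟨hfin, fun N => ?_⟩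
  refine ((isBigO_refl (fun τ : ℝ => τ ^ s) atTop).mul_isLittleO (h N)).congr' ?_ ?_
  · filter_upwards [hG] with τ hτ
    rw [hτ, Real.rpow_zero]
    ring
  · filter_upwards [eventually_gt_atTop (0 : ℝ)] with τ hτ
    rw [← Real.rpow_add hτ]
    congr 1
    ring

/-! ### Taylor expansions of one-variable functions -/

/-- Taylor's theorem for a function which is smooth near `0`. -/
lemma exists_taylor_coeff {f : ℝ → ℝ} {r : ℝ} (hr : 0 < r)
    (hf : ContDiffOn ℝ (⊤ : ℕ∞) f (Set.Ioo (-r) r)) :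
    ∃ c : ℕ → ℝ, c 0 = f 0 ∧ c 1 = deriv f 0 ∧
      ∀ n : ℕ, (fun s => f s - ∑ i ∈ Finset.range n, c i * s ^ i) =O[𝓝 0] fun s => s ^ n := by
  have h0 : (0 : ℝ) ∈ Set.Ioo (-r) r := by simpa using hr
  refine ⟨fun k => (k.factorial : ℝ)⁻¹ * iteratedDerivWithin k f (Set.Ioo (-r) r) 0, by simp,
    by simp [iteratedDerivWithin_one, derivWithin_of_isOpen isOpen_Ioo h0], fun n => ?_⟩
  have h1 := taylor_isLittleO (n := n) (convex_Ioo (-r) r) h0 (hf.of_le (by exact_mod_cast le_top))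
  rw [isOpen_Ioo.nhdsWithin_eq h0] at h1
  simp only [sub_zero, taylor_within_apply, smul_eq_mul] at h1
  refine (h1.isBigO.add (isBigO_const_mul_self ((n.factorial : ℝ)⁻¹ *
    iteratedDerivWithin n f (Set.Ioo (-r) r) 0) (fun s : ℝ => s ^ n) (𝓝 0))).congr_left
      fun s => ?_
  rw [Finset.sum_range_succ]
  have : ∀ k, (k.factorial : ℝ)⁻¹ * s ^ k * iteratedDerivWithin k f (Set.Ioo (-r) r) 0 =
    (k.factorial : ℝ)⁻¹ * iteratedDerivWithin k f (Set.Ioo (-r) r) 0 * s ^ k := fun k => by ring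
  simp only [this]
  ring

/-- A function with a Taylor expansion vanishing at `0` is `s` times such a function. -/
lemma exists_slope_taylor {f : ℝ → ℝ} {c : ℕ → ℝ} (hc : c 0 = 0) (hf0 : f 0 = 0)
    (hf : ∀ n : ℕ, (fun s => f s - ∑ i ∈ Finset.range n, c i * s ^ i) =O[𝓝 0] fun s => s ^ n) :
    ∃ q : ℝ → ℝ, (∀ s, f s = s * q s) ∧ ∀ n : ℕ,
      (fun s => q s - ∑ i ∈ Finset.range n, c (i + 1) * s ^ i) =O[𝓝 0] fun s => s ^ n := by
  refine ⟨fun s => if s = 0 then c 1 else f s / s, fun s => ?_, fun n => ?_⟩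
  · beta_reduce
    split_ifs with h
    · rw [h, zero_mul, hf0]
    · field_simp
  · obtain ⟨K, hK⟩ := (hf (n + 1)).bound
    -- The second entry of the maximum covers the point `s = 0`, where the bound inherited from `f`
    -- says nothing about the quotient.
    refine IsBigO.of_bound (max K ‖c 1 - ∑ i ∈ Finset.range n, c (i + 1) * 0 ^ i‖) ?_
    filter_upwards [hK] with s hs
    split_ifs with h
    · subst h
      rcases Nat.eq_zero_or_pos n with rfl | hn
      · simp
      · rw [Finset.sum_range_eq_add_Ico _ hn]
        have : ∑ i ∈ Finset.Ico 1 n, c (i + 1) * (0 : ℝ) ^ i = 0 :=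
          Finset.sum_eq_zero fun i hi => by
            rw [zero_pow (by have := (Finset.mem_Ico.1 hi).1; omega), mul_zero]
        rw [this]
        simp
        positivity
    · rw [Finset.sum_range_succ'] at hs
      simp only [hc, zero_mul, add_zero] at hs
      have h1 : f s - ∑ k ∈ Finset.range n, c (k + 1) * s ^ (k + 1) =
          s * (f s / s - ∑ i ∈ Finset.range n, c (i + 1) * s ^ i) := by
        rw [mul_sub, mul_div_cancel₀ _ h, Finset.mul_sum]
        congr 1
        refine Finset.sum_congr rfl fun i _ => ?_
        ring
      rw [h1, norm_mul, pow_succ', norm_mul] at hs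
      have hs' : 0 < ‖s‖ := norm_pos_iff.2 h
      have h2 : ‖f s / s - ∑ i ∈ Finset.range n, c (i + 1) * s ^ i‖ ≤ K * ‖s ^ n‖ := by
        refine le_of_mul_le_mul_left ?_ hs'
        linarith
      exact h2.trans (mul_le_mul_of_nonneg_right (le_max_left _ _) (norm_nonneg _))

/-! ### The formal solution -/

/-- The nonlinearity `S √(1 + S - v²)` of the resonance equation in the variables
`S = R² - 1`, `v = R sin β`. -/
noncomputable def resonanceNonlin (z : ℝ × ℝ) : ℝ := z.1 * √(1 + z.1 - z.2 ^ 2)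

open MvPolynomial in
/-- Successive approximations `(j, b, c)` of the formal solution `S = Y j`, `v = X b`,
`√(1 + S - v²) = 1 + c`. -/
noncomputable def formalIterate (A G : ℝ) :
    ℕ → MvPolynomial (Fin 2) ℝ × MvPolynomial (Fin 2) ℝ × MvPolynomial (Fin 2) ℝ
  | 0 => (0, 0, 0)
  | k + 1 =>
    let j := (formalIterate A G k).1
    let b := (formalIterate A G k).2.1
    let c := (formalIterate A G k).2.2
    let c' := C (1 / 2) * (X 1 * j - X 0 ^ 2 * b ^ 2 - c ^ 2)
    (C G + X 0 * (scaleDeriv A (X 0 * b) + C (1 / 4) * (X 0 * b)) - c' * j,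
      C (-(1 / (2 * G))) * (scaleDeriv A (X 1 * j) + C (1 / 2) * (1 + X 1 * j)), c')

section

variable (A G : ℝ)

noncomputable abbrev formalS (k : ℕ) : MvPolynomial (Fin 2) ℝ := (formalIterate A G k).1
noncomputable abbrev formalV (k : ℕ) : MvPolynomial (Fin 2) ℝ := (formalIterate A G k).2.1
noncomputable abbrev formalC (k : ℕ) : MvPolynomial (Fin 2) ℝ := (formalIterate A G k).2.2

open MvPolynomial

/-- This is `(1 + c)² = 1 + S - v²` solved for the linear occurrence of `c`. -/
lemma formalC_succ (k : ℕ) : formalC A G (k + 1) = C (1 / 2) *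
    (X 1 * formalS A G k - X 0 ^ 2 * formalV A G k ^ 2 - formalC A G k ^ 2) := rfl

/-- The equation for `v` divided by `Y`, using `XY = 1/τ`. The new `c` multiplies the old `j`, which
makes the residual of that equation simple. -/
lemma formalS_succ (k : ℕ) : formalS A G (k + 1) = C G +
    X 0 * (scaleDeriv A (X 0 * formalV A G k) + C (1 / 4) * (X 0 * formalV A G k)) -
      formalC A G (k + 1) * formalS A G k := rfl

/-- The equation for `S` multiplied by `τ`. Its term in `v` becomes `2G b` because `XY = 1/τ`, so it
determines `b` algebraically when `G ≠ 0`. -/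
lemma formalV_succ (k : ℕ) : formalV A G (k + 1) = C (-(1 / (2 * G))) *
    (scaleDeriv A (X 1 * formalS A G k) + C (1 / 2) * (1 + X 1 * formalS A G k)) := rfl

/-- The terms `c²` and `c j` carry no explicit variable; they gain an order only because `c` itself
lies in the ideal. -/
lemma formalC_mem (k : ℕ) : formalC A G k ∈ varIdeal := by
  induction k with
  | zero => simp [formalC, formalIterate]
  | succ k ih =>
    rw [formalC_succ]
    refine Ideal.mul_mem_left _ _ (sub_mem (sub_mem ?_ ?_) ?_)
    · exact Ideal.mul_mem_right _ _ (X_mem_varIdeal 1)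
    · exact Ideal.mul_mem_right _ _ (Ideal.pow_mem_of_mem _ (X_mem_varIdeal 0) 2 (by norm_num))
    · exact Ideal.pow_mem_of_mem _ ih 2 (by norm_num)

/-- Every difference of old iterates enters the new difference with a factor from the ideal: an
explicit `X` or `Y`, or a `c`. The `c`-component is treated first because the new `j` uses the new
`c`. -/
lemma formalIterate_sub_mem (k : ℕ) :
    formalS A G (k + 1) - formalS A G k ∈ varIdeal ^ k ∧
    formalV A G (k + 1) - formalV A G k ∈ varIdeal ^ k ∧
    formalC A G (k + 1) - formalC A G k ∈ varIdeal ^ k := by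
  induction k with
  | zero => simp
  | succ k ih =>
    obtain ⟨hj, hb, hc⟩ := ih
    have hX : ∀ (i : Fin 2) {p}, p ∈ varIdeal ^ k → X i * p ∈ varIdeal ^ (k + 1) :=
      fun i p hp => by rw [pow_succ']; exact Ideal.mul_mem_mul (X_mem_varIdeal i) hp
    have hle : varIdeal ^ (k + 1) ≤ varIdeal ^ k := Ideal.pow_le_pow_right (Nat.le_succ k)
    have hc' : formalC A G (k + 1 + 1) - formalC A G (k + 1) ∈ varIdeal ^ (k + 1) := by
      have : formalC A G (k + 1 + 1) - formalC A G (k + 1) = C (1 / 2) *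
          (X 1 * (formalS A G (k + 1) - formalS A G k) -
            X 0 * (X 0 * (formalV A G (k + 1) + formalV A G k) *
              (formalV A G (k + 1) - formalV A G k)) -
            (formalC A G (k + 1) + formalC A G k) * (formalC A G (k + 1) - formalC A G k)) := by
        rw [formalC_succ A G (k + 1), formalC_succ A G k]
        ring
      rw [this]
      refine Ideal.mul_mem_left _ _ (sub_mem (sub_mem (hX 1 hj) ?_) ?_)
      · exact hX 0 (Ideal.mul_mem_left _ _ hb)
      · rw [pow_succ']
        exact Ideal.mul_mem_mul (add_mem (formalC_mem A G _) (formalC_mem A G _)) hc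
    refine ⟨?_, ?_, hc'⟩
    · have : formalS A G (k + 1 + 1) - formalS A G (k + 1) =
          X 0 * (scaleDeriv A (X 0 * (formalV A G (k + 1) - formalV A G k)) +
            C (1 / 4) * (X 0 * (formalV A G (k + 1) - formalV A G k))) -
          (formalC A G (k + 1 + 1) - formalC A G (k + 1)) * formalS A G (k + 1) -
          formalC A G (k + 1) * (formalS A G (k + 1) - formalS A G k) := by
        rw [formalS_succ A G (k + 1)]
        nth_rw 2 [formalS_succ A G k]
        rw [mul_sub (X 0), map_sub]
        ring
      rw [this]
      refine sub_mem (sub_mem (hX 0 (add_mem ?_ ?_)) (Ideal.mul_mem_right _ _ hc')) ?_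
      · exact hle (scaleDeriv_mem (hX 0 hb))
      · exact hle (Ideal.mul_mem_left _ _ (hX 0 hb))
      · rw [pow_succ']
        exact Ideal.mul_mem_mul (formalC_mem A G _) hj
    · have : formalV A G (k + 1 + 1) - formalV A G (k + 1) = C (-(1 / (2 * G))) *
          (scaleDeriv A (X 1 * (formalS A G (k + 1) - formalS A G k)) +
            C (1 / 2) * (X 1 * (formalS A G (k + 1) - formalS A G k))) := by
        rw [formalV_succ A G (k + 1), formalV_succ A G k, mul_sub (X 1), map_sub]
        ring
      rw [this]
      exact Ideal.mul_mem_left _ _ (add_mem (scaleDeriv_mem (hX 1 hj))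
        (Ideal.mul_mem_left _ _ (hX 1 hj)))

lemma formalS_one : formalS A G 1 = C G := by
  simp [formalS, formalIterate]

lemma formalV_one : formalV A G 1 = C (-(1 / (4 * G))) := by
  rw [formalV_succ]
  simp only [formalS, formalIterate, mul_zero, map_zero, zero_add, add_zero, mul_one]
  rw [← C_mul]
  congr 1
  ring

end

/-! ### Approximate solutions and their residuals -/

section

variable {A : ℝ} (G : ℝ)

/-- The relation `XY = 1/τ` under evaluation; it is what lets the `1/τ` terms of the system be
written with polynomials in the two variables. -/
lemma rpow_neg_mul_rpow_neg {τ : ℝ} (hτ : 0 < τ) : τ ^ (-(1 - A)) * τ ^ (-A) = 1 / τ := by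
  rw [← Real.rpow_add hτ]
  have : -(1 - A) + -A = -1 := by ring
  rw [this, Real.rpow_neg_one, one_div]

/-- The approximation of `S` by the `k`-th iterate. -/
noncomputable def approxS (A G : ℝ) (k : ℕ) : ℝ → ℝ :=
  powerEval A (MvPolynomial.X 1 * formalS A G k)

/-- The approximation of `v` by the `k`-th iterate. -/
noncomputable def approxV (A G : ℝ) (k : ℕ) : ℝ → ℝ :=
  powerEval A (MvPolynomial.X 0 * formalV A G k)

lemma approxS_isBigO (hA0 : 0 < A) (hA1 : A < 1) (k : ℕ) :
    approxS A G k =O[atTop] fun τ : ℝ => τ ^ (-min A (1 - A)) := by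
  simpa [approxS] using powerEval_isBigO hA0 hA1 (k := 1)
    (by rw [pow_one]; exact Ideal.mul_mem_right (formalS A G k) _ (X_mem_varIdeal 1))

lemma approxV_isBigO (hA0 : 0 < A) (hA1 : A < 1) (k : ℕ) :
    approxV A G k =O[atTop] fun τ : ℝ => τ ^ (-min A (1 - A)) := by
  simpa [approxV] using powerEval_isBigO hA0 hA1 (k := 1)
    (by rw [pow_one]; exact Ideal.mul_mem_right (formalV A G k) _ (X_mem_varIdeal 0))

lemma approxS_tendsto (hA0 : 0 < A) (hA1 : A < 1) (k : ℕ) :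
    Tendsto (approxS A G k) atTop (𝓝 0) :=
  (approxS_isBigO G hA0 hA1 k).trans_tendsto (tendsto_rpow_neg_atTop (lt_min hA0 (by linarith)))

lemma approxV_tendsto (hA0 : 0 < A) (hA1 : A < 1) (k : ℕ) :
    Tendsto (approxV A G k) atTop (𝓝 0) :=
  (approxV_isBigO G hA0 hA1 k).trans_tendsto (tendsto_rpow_neg_atTop (lt_min hA0 (by linarith)))

lemma approxS_sub_isBigO (hA0 : 0 < A) (hA1 : A < 1) {k l : ℕ} (h : k ≤ l) :
    (fun τ => approxS A G l τ - approxS A G k τ) =O[atTop]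
      fun τ : ℝ => τ ^ (-(k * min A (1 - A))) := by
  have := powerEval_isBigO hA0 hA1 (Ideal.mul_mem_left _ (MvPolynomial.X 1)
    (sub_mem_varIdeal_pow (fun k => (formalIterate_sub_mem A G k).1) h))
  refine this.congr_left fun τ => ?_
  simp only [approxS, powerEval_mul, powerEval_sub]
  ring

lemma approxV_sub_isBigO (hA0 : 0 < A) (hA1 : A < 1) {k l : ℕ} (h : k ≤ l) :
    (fun τ => approxV A G l τ - approxV A G k τ) =O[atTop]
      fun τ : ℝ => τ ^ (-(k * min A (1 - A))) := by
  have := powerEval_isBigO hA0 hA1 (Ideal.mul_mem_left _ (MvPolynomial.X 0)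
    (sub_mem_varIdeal_pow (fun k => (formalIterate_sub_mem A G k).2.1) h))
  refine this.congr_left fun τ => ?_
  simp only [approxV, powerEval_mul, powerEval_sub]
  ring

/-- The derivatives of the approximations are `O(1/τ)` relative to the approximations. -/
lemma deriv_approxS_isBigO (hA0 : 0 < A) (hA1 : A < 1) (k : ℕ) :
    deriv (approxS A G k) =O[atTop] fun τ : ℝ => τ ^ (-min A (1 - A)) / τ := by
  have h1 := powerEval_isBigO hA0 hA1 (k := 1) (scaleDeriv_mem (A := A)
    (p := MvPolynomial.X 1 * formalS A G k)
    (by rw [pow_one]; exact Ideal.mul_mem_right (formalS A G k) _ (X_mem_varIdeal 1)))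
  have h2 := h1.mul (isBigO_refl (fun τ : ℝ => τ⁻¹) atTop)
  simp only [Nat.cast_one, one_mul] at h2
  refine h2.congr' ?_ (Eventually.of_forall fun τ => (div_eq_mul_inv _ _).symm)
  filter_upwards [eventually_gt_atTop (0 : ℝ)] with τ hτ
  rw [← div_eq_mul_inv]
  exact (hasDerivAt_powerEval A _ hτ).deriv.symm

lemma deriv_approxV_isBigO (hA0 : 0 < A) (hA1 : A < 1) (k : ℕ) :
    deriv (approxV A G k) =O[atTop] fun τ : ℝ => τ ^ (-min A (1 - A)) / τ := by
  have h1 := powerEval_isBigO hA0 hA1 (k := 1) (scaleDeriv_mem (A := A)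
    (p := MvPolynomial.X 0 * formalV A G k)
    (by rw [pow_one]; exact Ideal.mul_mem_right (formalV A G k) _ (X_mem_varIdeal 0)))
  have h2 := h1.mul (isBigO_refl (fun τ : ℝ => τ⁻¹) atTop)
  simp only [Nat.cast_one, one_mul] at h2
  refine h2.congr' ?_ (Eventually.of_forall fun τ => (div_eq_mul_inv _ _).symm)
  filter_upwards [eventually_gt_atTop (0 : ℝ)] with τ hτ
  rw [← div_eq_mul_inv]
  exact (hasDerivAt_powerEval A _ hτ).deriv.symm

lemma differentiableAt_approxS (k : ℕ) {τ : ℝ} (hτ : 0 < τ) :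
    DifferentiableAt ℝ (approxS A G k) τ := (hasDerivAt_powerEval A _ hτ).differentiableAt

lemma differentiableAt_approxV (k : ℕ) {τ : ℝ} (hτ : 0 < τ) :
    DifferentiableAt ℝ (approxV A G k) τ := (hasDerivAt_powerEval A _ hτ).differentiableAt

/-- The residual of the approximation in the first equation. -/
noncomputable def residualS (A G : ℝ) (k : ℕ) (τ : ℝ) : ℝ :=
  deriv (approxS A G k) τ + (1 + approxS A G k τ) / (2 * τ) + 2 * G * τ ^ (-A) * approxV A G k τ

/-- The residual of the approximation in the second equation. -/
noncomputable def residualV (A G : ℝ) (k : ℕ) (τ : ℝ) : ℝ :=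
  deriv (approxV A G k) τ + approxV A G k τ / (4 * τ) + G * τ ^ (-A) -
    resonanceNonlin (approxS A G k τ, approxV A G k τ)

variable {G}

/-- As `b (k+1)` solves this equation exactly for the given `j k`, the residual is `-2G XY (b (k+1)
- b k)`. -/
lemma residualS_isBigO (hA0 : 0 < A) (hA1 : A < 1) (hG : G ≠ 0) (k : ℕ) :
    residualS A G k =O[atTop] fun τ : ℝ => τ ^ (-(k * min A (1 - A))) := by
  have h1 := powerEval_isBigO hA0 hA1 (Ideal.mul_mem_left _
    (MvPolynomial.C (-2 * G) * (MvPolynomial.X 0 * MvPolynomial.X 1))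
    (formalIterate_sub_mem A G k).2.1)
  refine h1.congr' ?_ EventuallyEq.rfl
  filter_upwards [eventually_gt_atTop (0 : ℝ)] with τ hτ
  rw [residualS, approxS, approxV, (hasDerivAt_powerEval A _ hτ).deriv, formalV_succ]
  simp only [powerEval_mul, powerEval_sub, powerEval_add, powerEval_C, powerEval_X_zero,
    powerEval_X_one, powerEval_one]
  have hxy := rpow_neg_mul_rpow_neg (A := A) hτ
  rw [hxy]
  have : 2 * G * τ ^ (-A) * (τ ^ (-(1 - A)) * powerEval A (formalV A G k) τ) =
    2 * G * (1 / τ) * powerEval A (formalV A G k) τ := by rw [← hxy]; ring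
  rw [this]
  field_simp
  ring

/-- By the choice of `j (k+1)` the residual equals `Y (j (k+1) - j k) + S (1 + c (k+1) - √(1 + S -
v²))`; the second bracket is small because `1 + c (k+1)` is an approximate square root. -/
lemma residualV_isBigO (hA0 : 0 < A) (hA1 : A < 1) (k : ℕ) :
    residualV A G k =O[atTop] fun τ : ℝ => τ ^ (-(k * min A (1 - A))) := by
  have h1 := powerEval_isBigO hA0 hA1 (Ideal.mul_mem_left _ (MvPolynomial.X 1)
    (formalIterate_sub_mem A G k).1)
  -- Substituting the recursion for `2 c (k+1)` leaves the difference of squares `c (k+1)² - c k²`.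
  have hcc : (1 + formalC A G (k + 1)) ^ 2 -
      (1 + MvPolynomial.X 1 * formalS A G k - MvPolynomial.X 0 ^ 2 * formalV A G k ^ 2)
      ∈ varIdeal ^ k := by
    have : (1 + formalC A G (k + 1)) ^ 2 -
      (1 + MvPolynomial.X 1 * formalS A G k - MvPolynomial.X 0 ^ 2 * formalV A G k ^ 2) =
      (formalC A G (k + 1) + formalC A G k) * (formalC A G (k + 1) - formalC A G k) := by
      have h2 : (2 : MvPolynomial (Fin 2) ℝ) * MvPolynomial.C (1 / 2) = 1 := by
        have : (2 : MvPolynomial (Fin 2) ℝ) = MvPolynomial.C 2 := (map_ofNat MvPolynomial.C 2).symm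
        rw [this, ← MvPolynomial.C_mul]
        norm_num
      have h3 : 2 * formalC A G (k + 1) = (MvPolynomial.X 1 * formalS A G k -
          MvPolynomial.X 0 ^ 2 * formalV A G k ^ 2 - formalC A G k ^ 2) := by
        rw [formalC_succ, ← mul_assoc, h2, one_mul]
      linear_combination h3
    rw [this]
    exact Ideal.mul_mem_left _ _ (formalIterate_sub_mem A G k).2.2
  have h2 := powerEval_isBigO hA0 hA1 hcc
  have hS0 := approxS_tendsto G hA0 hA1 k
  have hV0 := approxV_tendsto G hA0 hA1 k
  have hdpos : 0 < min A (1 - A) := lt_min hA0 (by linarith)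
  have hC0 : Tendsto (powerEval A (formalC A G (k + 1))) atTop (𝓝 0) := by
    have := powerEval_isBigO hA0 hA1 (k := 1) (p := formalC A G (k + 1))
      (by rw [pow_one]; exact formalC_mem A G _)
    simp only [Nat.cast_one, one_mul] at this
    exact this.trans_tendsto (tendsto_rpow_neg_atTop hdpos)
  have hE0 : Tendsto (fun τ => 1 + approxS A G k τ - approxV A G k τ ^ 2) atTop (𝓝 1) := by
    simpa using (hS0.const_add 1).sub (hV0.pow 2)
  have h3 : (fun τ => (1 + powerEval A (formalC A G (k + 1)) τ) -
      √(1 + approxS A G k τ - approxV A G k τ ^ 2)) =O[atTop]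
      fun τ : ℝ => τ ^ (-(k * min A (1 - A))) := by
    -- Dividing the difference of squares by the sum `(1 + c) + √…`, which is eventually at least
    -- `1/2`, costs the factor 2.
    refine IsBigO.trans (IsBigO.of_bound 2 ?_) h2
    filter_upwards [hE0.eventually (lt_mem_nhds one_half_lt_one),
      hC0.eventually (lt_mem_nhds (by norm_num : -(1 / 2 : ℝ) < 0))] with τ hE hC
    have hEq : powerEval A ((1 + formalC A G (k + 1)) ^ 2 - (1 + MvPolynomial.X 1 * formalS A G k -
        MvPolynomial.X 0 ^ 2 * formalV A G k ^ 2)) τ =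
        ((1 + powerEval A (formalC A G (k + 1)) τ) -
          √(1 + approxS A G k τ - approxV A G k τ ^ 2)) *
        ((1 + powerEval A (formalC A G (k + 1)) τ) +
          √(1 + approxS A G k τ - approxV A G k τ ^ 2)) := by
      have hs := Real.sq_sqrt (by linarith : 0 ≤ 1 + approxS A G k τ - approxV A G k τ ^ 2)
      have hl : powerEval A ((1 + formalC A G (k + 1)) ^ 2 -
          (1 + MvPolynomial.X 1 * formalS A G k - MvPolynomial.X 0 ^ 2 * formalV A G k ^ 2)) τ =
          (1 + powerEval A (formalC A G (k + 1)) τ) ^ 2 -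
            (1 + approxS A G k τ - approxV A G k τ ^ 2) := by
        simp only [approxS, approxV, powerEval_sub, powerEval_add, powerEval_mul, powerEval_pow,
          powerEval_one]
        ring
      rw [hl]
      linear_combination hs
    rw [hEq, norm_mul]
    have hge : 1 / 2 ≤ ‖(1 + powerEval A (formalC A G (k + 1)) τ) +
          √(1 + approxS A G k τ - approxV A G k τ ^ 2)‖ := by
      refine le_trans ?_ (le_abs_self _)
      have := Real.sqrt_nonneg (1 + approxS A G k τ - approxV A G k τ ^ 2)
      linarith
    nlinarith [norm_nonneg ((1 + powerEval A (formalC A G (k + 1)) τ) -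
          √(1 + approxS A G k τ - approxV A G k τ ^ 2))]
  have h4 := ((hS0.isBigO_one ℝ).mul h3)
  simp only [one_mul] at h4
  refine (h1.add h4).congr' ?_ EventuallyEq.rfl
  filter_upwards [eventually_gt_atTop (0 : ℝ)] with τ hτ
  have hxy := rpow_neg_mul_rpow_neg (A := A) hτ
  rw [residualV, resonanceNonlin, formalS_succ]
  simp only
  have hd : deriv (approxV A G k) τ = powerEval A
    (scaleDeriv A (MvPolynomial.X 0 * formalV A G k)) τ * (τ ^ (-(1 - A)) * τ ^ (-A)) := by
    rw [approxV, (hasDerivAt_powerEval A _ hτ).deriv, hxy]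
    ring
  have hq : approxV A G k τ / (4 * τ) = 1 / 4 * (τ ^ (-(1 - A)) * powerEval A (formalV A G k) τ) *
      (τ ^ (-(1 - A)) * τ ^ (-A)) := by
    rw [hxy, approxV]
    simp only [powerEval_mul, powerEval_X_zero]
    field_simp
  rw [hd, hq]
  simp only [approxS, powerEval_mul, powerEval_sub, powerEval_add, powerEval_C, powerEval_X_zero,
    powerEval_X_one]
  ring

end

/-! ### Scalar linear equations with power-like forcing -/

section

open MeasureTheory Set

lemma hasDerivAt_rpow_neg_div {N τ : ℝ} (hN : N ≠ 0) (hτ : 0 < τ) :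
    HasDerivAt (fun s : ℝ => -(s ^ (-N) / N)) (τ ^ (-1 - N)) τ := by
  have h := ((Real.hasDerivAt_rpow_const (x := τ) (p := -N) (Or.inl hτ.ne')).div_const N).neg
  refine h.congr_deriv ?_
  have : -N - 1 = -1 - N := by ring
  rw [this]
  field_simp

/-- A primitive of a function which is continuous on a half-line. -/
lemma exists_primitive_of_continuousOn {E : Type*} [NormedAddCommGroup E] [NormedSpace ℝ E]
    [CompleteSpace E] {T : ℝ} {μ : ℝ → E} (hμ : ContinuousOn μ (Ioi T)) :
    ∃ Θ : ℝ → E, ∀ τ > T, HasDerivAt Θ (μ τ) τ := by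
  refine ⟨fun τ => ∫ s in (T + 1)..τ, μ s, fun τ hτ => ?_⟩
  have hsub : uIcc (T + 1) τ ⊆ Ioi T := fun s hs =>
    lt_of_lt_of_le (lt_min (by linarith) hτ) hs.1
  refine intervalIntegral.integral_hasDerivAt_right ((hμ.mono hsub).intervalIntegrable) ?_
    (hμ.continuousAt (Ioi_mem_nhds hτ))
  exact hμ.stronglyMeasurableAtFilter isOpen_Ioi τ hτ

lemma norm_le_of_norm_deriv_le {E : Type*} [NormedAddCommGroup E] [NormedSpace ℝ E]
    {a b : ℝ} (hab : a ≤ b) {f f' : ℝ → E} {B B' : ℝ → ℝ}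
    (hf : ∀ x ∈ Icc a b, HasDerivAt f (f' x) x) (hB : ∀ x ∈ Icc a b, HasDerivAt B (B' x) x)
    (ha : ‖f a‖ ≤ B a) (hle : ∀ x ∈ Icc a b, ‖f' x‖ ≤ B' x) : ‖f b‖ ≤ B b :=
  image_norm_le_of_norm_deriv_right_le_deriv_boundary'
    (fun x hx => (hf x hx).continuousAt.continuousWithinAt)
    (fun x hx => (hf x (Ico_subset_Icc_self hx)).hasDerivWithinAt) ha
    (fun x hx => (hB x hx).continuousAt.continuousWithinAt)
    (fun x hx => (hB x (Ico_subset_Icc_self hx)).hasDerivWithinAt)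
    (fun x hx => hle x (Ico_subset_Icc_self hx)) (right_mem_Icc.2 hab)

/-- Decaying solutions of `w' = μ w + h`, `0 ≤ Re μ`, inherit the decay of `h`. -/
lemma norm_le_of_hasDerivAt_of_re_nonneg {T M N H₁ H₂ : ℝ} (hT : 0 ≤ T) (hM : 0 < M) (hN : 0 < N)
    (hH₁ : 0 ≤ H₁) (hH₂ : 0 ≤ H₂) {μ w h : ℝ → ℂ} (hμ : ContinuousOn μ (Ioi T))
    (hre : ∀ τ > T, 0 ≤ (μ τ).re)
    (hw : ∀ τ > T, HasDerivAt w (μ τ * w τ + h τ) τ)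
    (hh : ∀ τ > T, ‖h τ‖ ≤ H₁ * τ ^ (-1 - N) + H₂ * τ ^ (-1 - M))
    (hlim : Tendsto w atTop (𝓝 0)) {τ : ℝ} (hτ : T < τ) :
    ‖w τ‖ ≤ H₁ / N * τ ^ (-N) + H₂ / M * τ ^ (-M) := by
  obtain ⟨Θ, hΘ⟩ := exists_primitive_of_continuousOn hμ
  have hmono : ∀ s ≥ τ, (Θ τ).re ≤ (Θ s).re := by
    have hd : ∀ s > T, HasDerivAt (fun s => (Θ s).re) (μ s).re s := fun s hs =>
      (Complex.reCLM.hasFDerivAt.comp_hasDerivAt s (hΘ s hs))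
    have : MonotoneOn (fun s => (Θ s).re) (Ici τ) := by
      refine monotoneOn_of_deriv_nonneg (convex_Ici τ) ?_ ?_ ?_
      · exact fun s hs => (hd s (hτ.trans_le hs)).continuousAt.continuousWithinAt
      · rw [interior_Ici]
        exact fun s hs => (hd s (hτ.trans hs)).differentiableAt.differentiableWithinAt
      · rw [interior_Ici]
        intro s hs
        rw [(hd s (hτ.trans hs)).deriv]
        exact hre s (hτ.trans hs)
    exact fun s hs => this self_mem_Ici hs hs
  -- The integrating factor is normalized at `τ`, so it has modulus at most 1 for `s ≥ τ` and the
  -- estimate can run backwards from infinity.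
  set u : ℝ → ℂ := fun s => Complex.exp (Θ τ - Θ s) * w s with hu
  have hexp : ∀ s ≥ τ, ‖Complex.exp (Θ τ - Θ s)‖ ≤ 1 := fun s hs => by
    rw [Complex.norm_exp, Complex.sub_re, Real.exp_le_one_iff]
    linarith [hmono s hs]
  have hud : ∀ s > T, HasDerivAt u (Complex.exp (Θ τ - Θ s) * h s) s := fun s hs => by
    refine ((((hΘ s hs).const_sub (Θ τ)).cexp).mul (hw s hs)).congr_deriv ?_
    ring
  -- The primitive of the forcing bound that vanishes at infinity; as `B ≤ 0`, it can be dropped at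
  -- the far end `s`.
  set B : ℝ → ℝ := fun s => H₁ * -(s ^ (-N) / N) + H₂ * -(s ^ (-M) / M) with hB
  have hBd : ∀ s > T, HasDerivAt B (H₁ * s ^ (-1 - N) + H₂ * s ^ (-1 - M)) s := fun s hs =>
    ((hasDerivAt_rpow_neg_div hN.ne' (hT.trans_lt hs)).const_mul H₁).add
      ((hasDerivAt_rpow_neg_div hM.ne' (hT.trans_lt hs)).const_mul H₂)
  have hB0 : ∀ s > T, B s ≤ 0 := fun s hs => by
    have hs0 := hT.trans_lt hs
    have h1 : 0 ≤ H₁ * (s ^ (-N) / N) := by positivity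
    have h2 : 0 ≤ H₂ * (s ^ (-M) / M) := by positivity
    simp only [hB]
    linarith
  have key : ∀ s ≥ τ, ‖w τ‖ ≤ ‖w s‖ - B τ := by
    intro s hs
    have h1 : ‖u s - u τ‖ ≤ B s - B τ := by
      refine norm_le_of_norm_deriv_le (f := fun x => u x - u τ) (B := fun x => B x - B τ) hs
        (fun x hx => (hud x (hτ.trans_le hx.1)).sub_const _)
        (fun x hx => (hBd x (hτ.trans_le hx.1)).sub_const _) (by simp) fun x hx => ?_
      rw [norm_mul]
      exact (mul_le_of_le_one_left (norm_nonneg _) (hexp x hx.1)).trans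
        (hh x (hτ.trans_le hx.1))
    have h2 : ‖u s‖ ≤ ‖w s‖ := by
      rw [hu, norm_mul]
      exact mul_le_of_le_one_left (norm_nonneg _) (hexp s hs)
    have h3 : u τ = w τ := by simp [hu]
    have h4 := norm_sub_norm_le (u τ) (u s)
    rw [norm_sub_rev, h3] at h4
    rw [h3] at h1
    linarith [hB0 s (hτ.trans_le hs)]
  have hlim' : Tendsto (fun s => ‖w s‖ - B τ) atTop (𝓝 (0 - B τ)) := by
    simpa using hlim.norm.sub_const (B τ)
  have h5 := ge_of_tendsto hlim' (eventually_atTop.2 ⟨τ, key⟩)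
  simp only [hB] at h5
  refine h5.trans (le_of_eq ?_)
  ring

/-- Solutions of `w' = -ω w + h` with `ω` large compared to `1/τ` inherit the decay of `h`. -/
lemma norm_le_of_hasDerivAt_neg {T M N H₁ H₂ : ℝ} (hT : 0 < T) (hM : 0 < M) (hN : 0 < N)
    (hH₁ : 0 ≤ H₁) (hH₂ : 0 ≤ H₂) {ω : ℝ → ℝ} {w h : ℝ → ℂ} {θ : ℝ → ℝ}
    (hθ : ∀ τ ≥ T, HasDerivAt θ (ω τ) τ)
    (hωM : ∀ τ ≥ T, 2 * M ≤ τ * ω τ) (hωN : ∀ τ ≥ T, 2 * N ≤ τ * ω τ)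
    (hw : ∀ τ ≥ T, HasDerivAt w (-(ω τ : ℂ) * w τ + h τ) τ)
    (hh : ∀ τ ≥ T, ‖h τ‖ ≤ H₁ * τ ^ (-1 - N) + H₂ * τ ^ (-1 - M)) {τ : ℝ} (hτ : T ≤ τ) :
    ‖w τ‖ ≤ (‖w T‖ * T ^ N + H₁ / N) * τ ^ (-N) + H₂ / M * τ ^ (-M) := by
  set u : ℝ → ℂ := fun s => Complex.exp (θ s : ℂ) * w s with hu
  have hud : ∀ s ≥ T, HasDerivAt u (Complex.exp (θ s : ℂ) * h s) s := fun s hs => by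
    refine (((hθ s hs).ofReal_comp.cexp).mul (hw s hs)).congr_deriv ?_
    ring
  have hpow : ∀ K : ℝ, 0 < K → ∀ s ≥ T,
      HasDerivAt (fun s : ℝ => s ^ (-K)) (-K * s ^ (-1 - K)) s := fun K hK s hs => by
    have := Real.hasDerivAt_rpow_const (x := s) (p := -K) (Or.inl (hT.trans_le hs).ne')
    rwa [show -K - 1 = -1 - K by ring] at this
  -- A barrier: the claimed bound times the integrating factor, with the initial value absorbed in
  -- the `τ^(-N)` coefficient.
  set B : ℝ → ℝ := fun s => Real.exp (θ s) *
    ((‖w T‖ * T ^ N + H₁ / N) * s ^ (-N) + H₂ / M * s ^ (-M)) with hB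
  have hBd : ∀ s ≥ T, HasDerivAt B (Real.exp (θ s) * ω s *
      ((‖w T‖ * T ^ N + H₁ / N) * s ^ (-N) + H₂ / M * s ^ (-M)) + Real.exp (θ s) *
      ((‖w T‖ * T ^ N + H₁ / N) * (-N * s ^ (-1 - N)) + H₂ / M * (-M * s ^ (-1 - M)))) s :=
    fun s hs => (hθ s hs).exp.mul
      (((hpow N hN s hs).const_mul _).add ((hpow M hM s hs).const_mul _))
  have key : ‖u τ‖ ≤ B τ := by
    refine norm_le_of_norm_deriv_le hτ (fun x hx => hud x hx.1) (fun x hx => hBd x hx.1) ?_ ?_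
    · rw [hu, hB, norm_mul, Complex.norm_exp, Complex.ofReal_re]
      refine mul_le_mul_of_nonneg_left ?_ (Real.exp_pos _).le
      have h1 : T ^ N * T ^ (-N) = 1 := by rw [← Real.rpow_add hT]; simp
      have h2 : 0 ≤ H₁ / N * T ^ (-N) := by positivity
      have h3 : 0 ≤ H₂ / M * T ^ (-M) := by positivity
      have h4 : ‖w T‖ * T ^ N * T ^ (-N) = ‖w T‖ := by rw [mul_assoc, h1, mul_one]
      linarith
    · intro x hx
      have hx0 : 0 < x := hT.trans_le hx.1
      rw [norm_mul, Complex.norm_exp, Complex.ofReal_re]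
      -- Differentiating `x^(-K)` loses `K x^(-1-K)`. The condition `2K ≤ x ω` pays this twice: once
      -- for the loss, once for the forcing.
      have hpx : ∀ K : ℝ, 0 < K → 2 * K ≤ x * ω x → 2 * K * x ^ (-1 - K) ≤ ω x * x ^ (-K) := by
        intro K hK hKx
        have : x ^ (-K) = x * x ^ (-1 - K) := by
          rw [← Real.rpow_one_add' hx0.le (by linarith)]
          congr 1
          ring
        rw [this]
        have := mul_le_mul_of_nonneg_right hKx (Real.rpow_nonneg hx0.le (-1 - K))
        linarith
      have e1 := mul_le_mul_of_nonneg_left (hpx N hN (hωN x hx.1))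
        (by positivity : 0 ≤ ‖w T‖ * T ^ N + H₁ / N)
      have e2 := mul_le_mul_of_nonneg_left (hpx M hM (hωM x hx.1))
        (by positivity : 0 ≤ H₂ / M)
      have e3 : H₁ / N * (N * x ^ (-1 - N)) = H₁ * x ^ (-1 - N) := by field_simp
      have e4 : H₂ / M * (M * x ^ (-1 - M)) = H₂ * x ^ (-1 - M) := by field_simp
      have e5 : 0 ≤ ‖w T‖ * T ^ N * (N * x ^ (-1 - N)) := by positivity
      have e6 := hh x hx.1
      have e7 : ‖h x‖ ≤ ω x * ((‖w T‖ * T ^ N + H₁ / N) * x ^ (-N) + H₂ / M * x ^ (-M)) +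
          ((‖w T‖ * T ^ N + H₁ / N) * (-N * x ^ (-1 - N)) + H₂ / M * (-M * x ^ (-1 - M))) := by
        linarith
      have := mul_le_mul_of_nonneg_left e7 (Real.exp_pos (θ x)).le
      linarith
  rw [hu, hB, norm_mul, Complex.norm_exp, Complex.ofReal_re] at key
  exact le_of_mul_le_mul_left key (Real.exp_pos _)

/-- There is a linear solution operator of `w' = μ w + h` which gains a factor `τ / M` on
`O(τ ^ (-1 - M))`. -/
def HasSolutionOperator (μ : ℝ → ℂ) (T M : ℝ) : Prop :=
  ∃ L : (ℝ → ℂ) → ℝ → ℂ,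
    (∀ h H, Continuous h → (∀ s ≥ T, ‖h s‖ ≤ H * s ^ (-1 - M)) →
      (∀ τ, HasDerivAt (L h) (μ τ * L h τ + h τ) τ) ∧ ∀ τ ≥ T, ‖L h τ‖ ≤ H / M * τ ^ (-M)) ∧
    ∀ h h' H H', Continuous h → (∀ s ≥ T, ‖h s‖ ≤ H * s ^ (-1 - M)) →
      Continuous h' → (∀ s ≥ T, ‖h' s‖ ≤ H' * s ^ (-1 - M)) →
      ∀ τ, L h τ - L h' τ = L (fun s => h s - h' s) τ

/-- A mode that does not decay must be integrated from infinity: the solution is `-∫ s > τ, exp (Θ τ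
- Θ s) h s`, whose kernel has modulus at most 1. -/
lemma hasSolutionOperator_of_re_nonneg {μ : ℝ → ℂ} (hμ : Continuous μ) (hre : ∀ τ, 0 ≤ (μ τ).re)
    {T M : ℝ} (hT : 0 < T) (hM : 0 < M) : HasSolutionOperator μ T M := by
  set Θ : ℝ → ℂ := fun τ => ∫ s in (0 : ℝ)..τ, μ s with hΘdef
  have hΘ : ∀ τ, HasDerivAt Θ (μ τ) τ := fun τ => hμ.integral_hasStrictDerivAt 0 τ |>.hasDerivAt
  have hΘc : Continuous Θ := continuous_iff_continuousAt.2 fun τ => (hΘ τ).continuousAt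
  have hmono : Monotone fun s => (Θ s).re := by
    have hd : ∀ s, HasDerivAt (fun s => (Θ s).re) (μ s).re s := fun s =>
      (Complex.reCLM.hasFDerivAt.comp_hasDerivAt s (hΘ s))
    refine monotone_of_deriv_nonneg (fun s => (hd s).differentiableAt) fun s => ?_
    rw [(hd s).deriv]
    exact hre s
  have hexp : ∀ {τ s}, τ ≤ s → ‖Complex.exp (Θ τ) * Complex.exp (-Θ s)‖ ≤ 1 := fun {τ s} hs => by
    rw [← Complex.exp_add, Complex.norm_exp, Real.exp_le_one_iff]
    have := hmono hs
    simp only at this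
    simp only [Complex.add_re, Complex.neg_re]
    linarith
  have hint : ∀ (h : ℝ → ℂ) (H : ℝ), Continuous h → (∀ s ≥ T, ‖h s‖ ≤ H * s ^ (-1 - M)) →
      ∀ τ ≥ T, IntegrableOn (fun s => Complex.exp (-Θ s) * h s) (Ioi τ) := by
    intro h H hc hh τ hτ
    have hi : IntegrableOn (fun s : ℝ => ‖Complex.exp (-Θ τ)‖ * (H * s ^ (-1 - M))) (Ioi τ) :=
      ((integrableOn_Ioi_rpow_of_lt (by linarith) (hT.trans_le hτ)).const_mul H).const_mul _
    refine Integrable.mono' hi ?_ ?_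
    · exact ((hΘc.neg.cexp).mul hc).aestronglyMeasurable
    · refine (ae_restrict_iff' measurableSet_Ioi).2 (Eventually.of_forall fun s hs => ?_)
      have h1 := hexp (le_of_lt hs : τ ≤ s)
      rw [norm_mul]
      refine mul_le_mul ?_ (hh s (hτ.trans (le_of_lt hs))) (norm_nonneg _) (norm_nonneg _)
      rw [Complex.norm_exp, Complex.norm_exp, Real.exp_le_exp]
      have := hmono (le_of_lt hs : τ ≤ s)
      simp only at this
      simp only [Complex.neg_re]
      linarith
  -- The tail integral is split at `T` so that the formula is defined and differentiable for every
  -- real `τ`, although decay of `h` is assumed only from `T` on.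
  refine ⟨fun h τ => Complex.exp (Θ τ) * ((∫ s in T..τ, Complex.exp (-Θ s) * h s) -
    ∫ s in Ioi T, Complex.exp (-Θ s) * h s), ?_, ?_⟩
  · intro h H hc hh
    have hcc : Continuous fun s => Complex.exp (-Θ s) * h s := (hΘc.neg.cexp).mul hc
    refine ⟨fun τ => ?_, fun τ hτ => ?_⟩
    · have h1 := (hcc.integral_hasStrictDerivAt T τ).hasDerivAt
      refine ((hΘ τ).cexp.mul (h1.sub_const _)).congr_deriv ?_
      have : Complex.exp (Θ τ) * (Complex.exp (-Θ τ) * h τ) = h τ := by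
        rw [← mul_assoc, ← Complex.exp_add]
        simp
      rw [this]
      ring
    · have h1 : (∫ s in Ioi T, Complex.exp (-Θ s) * h s) =
          (∫ s in T..τ, Complex.exp (-Θ s) * h s) + ∫ s in Ioi τ, Complex.exp (-Θ s) * h s :=
        (intervalIntegral.integral_interval_add_Ioi (hint h H hc hh T le_rfl)
          (hint h H hc hh τ hτ)).symm
      have h2 : Complex.exp (Θ τ) * ((∫ s in T..τ, Complex.exp (-Θ s) * h s) -
          ∫ s in Ioi T, Complex.exp (-Θ s) * h s) =
          -∫ s in Ioi τ, Complex.exp (Θ τ) * (Complex.exp (-Θ s) * h s) := by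
        rw [h1, integral_const_mul]
        ring
      beta_reduce
      rw [h2, norm_neg]
      have h3 : ∫ s in Ioi τ, H * s ^ (-1 - M) = H / M * τ ^ (-M) := by
        rw [integral_const_mul, integral_Ioi_rpow_of_lt (by linarith) (hT.trans_le hτ)]
        rw [show -1 - M + 1 = -M by ring]
        field_simp
      rw [← h3]
      refine norm_integral_le_of_norm_le
        ((integrableOn_Ioi_rpow_of_lt (by linarith) (hT.trans_le hτ)).const_mul H) ?_
      refine (ae_restrict_iff' measurableSet_Ioi).2 (Eventually.of_forall fun s hs => ?_)
      rw [← mul_assoc, norm_mul]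
      exact (mul_le_of_le_one_left (norm_nonneg _) (hexp (le_of_lt hs))).trans
        (hh s (hτ.trans (le_of_lt hs)))
  · intro h h' H H' hc hh hc' hh' τ
    have hcc : Continuous fun s => Complex.exp (-Θ s) * h s := (hΘc.neg.cexp).mul hc
    have hcc' : Continuous fun s => Complex.exp (-Θ s) * h' s := (hΘc.neg.cexp).mul hc'
    simp only [mul_sub (Complex.exp (-Θ _))]
    rw [integral_sub (hint h H hc hh T le_rfl) (hint h' H' hc' hh' T le_rfl),
      intervalIntegral.integral_sub (hcc.intervalIntegrable _ _) (hcc'.intervalIntegrable _ _)]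
    ring

/-- A damped mode is integrated forward from `T` with zero initial value, so only the forcing
contributes to the bound. -/
lemma hasSolutionOperator_neg {ω : ℝ → ℝ} (hω : Continuous ω) {T M : ℝ} (hT : 0 < T) (hM : 0 < M)
    (hωM : ∀ τ ≥ T, 2 * M ≤ τ * ω τ) : HasSolutionOperator (fun τ => -(ω τ : ℂ)) T M := by
  set θ : ℝ → ℝ := fun τ => ∫ s in (0 : ℝ)..τ, ω s with hθdef
  have hθ : ∀ τ, HasDerivAt θ (ω τ) τ := fun τ => hω.integral_hasStrictDerivAt 0 τ |>.hasDerivAt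
  have hθc : Continuous θ := continuous_iff_continuousAt.2 fun τ => (hθ τ).continuousAt
  refine ⟨fun h τ => Complex.exp (-(θ τ : ℂ)) * ∫ s in T..τ, Complex.exp (θ s : ℂ) * h s, ?_, ?_⟩
  · intro h H hc hh
    have hcc : Continuous fun s => Complex.exp (θ s : ℂ) * h s :=
      ((Complex.continuous_ofReal.comp hθc).cexp).mul hc
    have hd : ∀ τ, HasDerivAt
        (fun τ => Complex.exp (-(θ τ : ℂ)) * ∫ s in T..τ, Complex.exp (θ s : ℂ) * h s)
        (-(ω τ : ℂ) * (Complex.exp (-(θ τ : ℂ)) * ∫ s in T..τ, Complex.exp (θ s : ℂ) * h s) +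
          h τ) τ := by
      intro τ
      have h1 := (hcc.integral_hasStrictDerivAt T τ).hasDerivAt
      refine (((hθ τ).ofReal_comp.neg).cexp.mul h1).congr_deriv ?_
      simp only [Pi.neg_apply]
      have : Complex.exp (-(θ τ : ℂ)) * (Complex.exp (θ τ : ℂ) * h τ) = h τ := by
        rw [← mul_assoc, ← Complex.exp_add]
        simp
      rw [this]
      ring
    refine ⟨hd, fun τ hτ => ?_⟩
    have hH : 0 ≤ H := by
      have := (norm_nonneg _).trans (hh T le_rfl)
      exact nonneg_of_mul_nonneg_left this (Real.rpow_pos_of_pos hT _)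
    have := norm_le_of_hasDerivAt_neg (H₁ := 0) (H₂ := H) (w := fun τ => Complex.exp (-(θ τ : ℂ)) *
      ∫ s in T..τ, Complex.exp (θ s : ℂ) * h s) hT hM hM le_rfl hH (fun s _ => hθ s) hωM hωM
      (fun s _ => hd s) (fun s hs => by simpa using hh s hs) hτ
    simpa using this
  · intro h h' H H' hc hh hc' hh' τ
    have hcc : Continuous fun s => Complex.exp (θ s : ℂ) * h s :=
      ((Complex.continuous_ofReal.comp hθc).cexp).mul hc
    have hcc' : Continuous fun s => Complex.exp (θ s : ℂ) * h' s :=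
      ((Complex.continuous_ofReal.comp hθc).cexp).mul hc'
    simp only [mul_sub (Complex.exp (θ _ : ℂ))]
    rw [intervalIntegral.integral_sub (hcc.intervalIntegrable _ _) (hcc'.intervalIntegrable _ _)]
    ring

end

/-! ### Inverting the balanced planar system -/

section

open Set

/-- There is a linear solution operator of `P' = ε ω Q + h₁`, `Q' = ω P + h₂` which gains a factor
`2 τ / M` on `O(τ ^ (-1 - M))`. -/
def HasPlanarSolutionOperator (ω : ℝ → ℝ) (ε T M : ℝ) : Prop :=
  ∃ L : (ℝ → ℝ × ℝ) → ℝ → ℝ × ℝ,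
    (∀ h H, Continuous h → (∀ s ≥ T, ‖h s‖ ≤ H * s ^ (-1 - M)) →
      (∀ τ, HasDerivAt (fun τ => (L h τ).1) (ε * ω τ * (L h τ).2 + (h τ).1) τ ∧
        HasDerivAt (fun τ => (L h τ).2) (ω τ * (L h τ).1 + (h τ).2) τ) ∧
      ∀ τ ≥ T, ‖L h τ‖ ≤ 2 * H / M * τ ^ (-M)) ∧
    ∀ h h' H H', Continuous h → (∀ s ≥ T, ‖h s‖ ≤ H * s ^ (-1 - M)) →
      Continuous h' → (∀ s ≥ T, ‖h' s‖ ≤ H' * s ^ (-1 - M)) →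
      ∀ τ, L h τ - L h' τ = L (fun s => h s - h' s) τ

lemma norm_add_mul_le_two {ν : ℂ} (hν : ‖ν‖ = 1) (z : ℝ × ℝ) :
    ‖(z.1 : ℂ) + ν * (z.2 : ℂ)‖ ≤ 2 * ‖z‖ := by
  refine (norm_add_le _ _).trans ?_
  rw [norm_mul, hν, one_mul, Complex.norm_real, Complex.norm_real]
  linarith [norm_fst_le z, norm_snd_le z]

/-- The combinations `P ± ν Q` with `ν² = ε` diagonalize the system, with rates `±ν ω`. Since `1/ν =
ε ν`, the inverse change of variables is explicit. Real parts are taken at the end, which is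
legitimate because the system has real coefficients. -/
lemma hasPlanarSolutionOperator_of_scalar {ω : ℝ → ℝ} {ε T M : ℝ}
    {ν : ℂ} (hν : ν ^ 2 = (ε : ℂ)) (hε : ε ^ 2 = 1) (hν1 : ‖ν‖ = 1)
    (h₁ : HasSolutionOperator (fun τ => ν * (ω τ : ℂ)) T M)
    (h₂ : HasSolutionOperator (fun τ => -ν * (ω τ : ℂ)) T M) :
    HasPlanarSolutionOperator ω ε T M := by
  obtain ⟨L₁, hL₁, hd₁⟩ := h₁
  obtain ⟨L₂, hL₂, hd₂⟩ := h₂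
  have hεC : (ε : ℂ) ^ 2 = 1 := by exact_mod_cast hε
  have hενn : ‖(ε : ℂ) * ν‖ = 1 := by
    rw [norm_mul, hν1, mul_one]
    have : ‖(ε : ℂ)‖ ^ 2 = 1 := by rw [← norm_pow, hεC, norm_one]
    exact (pow_eq_one_iff_of_nonneg (norm_nonneg _) two_ne_zero).1 this
  set a : (ℝ → ℝ × ℝ) → ℝ → ℂ := fun h s => ((h s).1 : ℂ) + ν * ((h s).2 : ℂ) with ha
  set b : (ℝ → ℝ × ℝ) → ℝ → ℂ := fun h s => ((h s).1 : ℂ) + -ν * ((h s).2 : ℂ) with hb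
  have hac : ∀ {h}, Continuous h → Continuous (a h) := fun {h} hc =>
    (Complex.continuous_ofReal.comp (continuous_fst.comp hc)).add
      (continuous_const.mul (Complex.continuous_ofReal.comp (continuous_snd.comp hc)))
  have hbc : ∀ {h}, Continuous h → Continuous (b h) := fun {h} hc =>
    (Complex.continuous_ofReal.comp (continuous_fst.comp hc)).add
      (continuous_const.mul (Complex.continuous_ofReal.comp (continuous_snd.comp hc)))
  have han : ∀ {h H}, (∀ s ≥ T, ‖h s‖ ≤ H * s ^ (-1 - M)) →
      ∀ s ≥ T, ‖a h s‖ ≤ (2 * H) * s ^ (-1 - M) := fun {h H} hh s hs => by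
    have := norm_add_mul_le_two hν1 (h s)
    have := hh s hs
    simp only [ha]
    linarith
  have hbn : ∀ {h H}, (∀ s ≥ T, ‖h s‖ ≤ H * s ^ (-1 - M)) →
      ∀ s ≥ T, ‖b h s‖ ≤ (2 * H) * s ^ (-1 - M) := fun {h H} hh s hs => by
    have := norm_add_mul_le_two (ν := -ν) (by rwa [norm_neg]) (h s)
    have := hh s hs
    simp only [hb]
    linarith
  refine ⟨fun h τ => (((L₁ (a h) τ + L₂ (b h) τ) / 2).re,
    ((ε * ν) * (L₁ (a h) τ - L₂ (b h) τ) / 2).re), fun h H hc hh => ?_, ?_⟩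
  · obtain ⟨hw₁, hn₁⟩ := hL₁ (a h) (2 * H) (hac hc) (han hh)
    obtain ⟨hw₂, hn₂⟩ := hL₂ (b h) (2 * H) (hbc hc) (hbn hh)
    refine ⟨fun τ => ⟨?_, ?_⟩, fun τ hτ => ?_⟩
    · have := Complex.reCLM.hasFDerivAt.comp_hasDerivAt τ (((hw₁ τ).add (hw₂ τ)).div_const 2)
      refine this.congr_deriv ?_
      have h1 : ε * ω τ * ((ε * ν) * (L₁ (a h) τ - L₂ (b h) τ) / 2).re + (h τ).1 =
          (((ε * ω τ : ℝ) : ℂ) * ((ε * ν) * (L₁ (a h) τ - L₂ (b h) τ) / 2) + ((h τ).1 : ℂ)).re := by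
        rw [Complex.add_re, Complex.re_ofReal_mul, Complex.ofReal_re]
      rw [Complex.reCLM_apply, h1]
      congr 1
      simp only [ha, hb, Complex.ofReal_mul]
      linear_combination -(ω τ : ℂ) * ν * (L₁ (a h) τ - L₂ (b h) τ) / 2 * hεC
    · have := Complex.reCLM.hasFDerivAt.comp_hasDerivAt τ
        ((((hw₁ τ).sub (hw₂ τ)).const_mul (ε * ν)).div_const 2)
      refine this.congr_deriv ?_
      have h1 : ω τ * ((L₁ (a h) τ + L₂ (b h) τ) / 2).re + (h τ).2 =
          ((ω τ : ℂ) * ((L₁ (a h) τ + L₂ (b h) τ) / 2) + ((h τ).2 : ℂ)).re := by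
        rw [Complex.add_re, Complex.re_ofReal_mul, Complex.ofReal_re]
      rw [Complex.reCLM_apply, h1]
      congr 1
      have h2 : (ε : ℂ) * ν ^ 2 = 1 := by rw [hν, ← sq, hεC]
      simp only [ha, hb]
      linear_combination ((ω τ : ℂ) * (L₁ (a h) τ + L₂ (b h) τ) / 2 + ((h τ).2 : ℂ)) * h2
    · have e : 2 * H / M * τ ^ (-M) = (2 * H / M * τ ^ (-M) + 2 * H / M * τ ^ (-M)) / 2 := by ring
      have e1 := hn₁ τ hτ
      have e2 := hn₂ τ hτ
      rw [norm_prod_le_iff]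
      constructor
      · refine (Complex.abs_re_le_norm _).trans ?_
        rw [norm_div, Complex.norm_two, e]
        have := norm_add_le (L₁ (a h) τ) (L₂ (b h) τ)
        gcongr
        linarith
      · refine (Complex.abs_re_le_norm _).trans ?_
        rw [norm_div, norm_mul, hενn, one_mul, Complex.norm_two, e]
        have := norm_sub_le (L₁ (a h) τ) (L₂ (b h) τ)
        gcongr
        linarith
  · intro h h' H H' hc hh hc' hh' τ
    have e1 := hd₁ _ _ _ _ (hac hc) (han hh) (hac hc') (han hh') τ
    have e2 := hd₂ _ _ _ _ (hbc hc) (hbn hh) (hbc hc') (hbn hh') τ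
    have e3 : (fun s => a h s - a h' s) = a (fun s => h s - h' s) := by
      ext s
      simp only [ha, Prod.fst_sub, Prod.snd_sub, Complex.ofReal_sub]
      ring
    have e4 : (fun s => b h s - b h' s) = b (fun s => h s - h' s) := by
      ext s
      simp only [hb, Prod.fst_sub, Prod.snd_sub, Complex.ofReal_sub]
      ring
    rw [e3] at e1
    rw [e4] at e2
    beta_reduce
    rw [← e1, ← e2, Prod.mk_sub_mk, ← Complex.sub_re, ← Complex.sub_re]
    congr 2 <;> ring

/-- For `ε = 1` the rates are `±ω`, one mode solved from infinity and one from `T`. For `ε = -1`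
they are `±i ω`, with zero real part, so both are solved from infinity. -/
lemma hasPlanarSolutionOperator {ω : ℝ → ℝ} (hω : Continuous ω) {ε T M : ℝ} (hε : ε = 1 ∨ ε = -1)
    (hT : 0 < T) (hM : 0 < M) (hω0 : ∀ τ, 0 ≤ ω τ) (hωM : ∀ τ ≥ T, 2 * M ≤ τ * ω τ) :
    HasPlanarSolutionOperator ω ε T M := by
  have hωc : Continuous fun τ => (ω τ : ℂ) := Complex.continuous_ofReal.comp hω
  rcases hε with rfl | rfl
  · refine hasPlanarSolutionOperator_of_scalar (ν := 1) (by simp) (by norm_num) (by simp)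
      (hasSolutionOperator_of_re_nonneg (continuous_const.mul hωc) (fun τ => ?_) hT hM) ?_
    · simpa using hω0 τ
    · simpa using hasSolutionOperator_neg hω hT hM hωM
  · refine hasPlanarSolutionOperator_of_scalar (ν := Complex.I) (by simp) (by norm_num)
      (by simp)
      (hasSolutionOperator_of_re_nonneg (continuous_const.mul hωc) (fun τ => ?_) hT hM)
      (hasSolutionOperator_of_re_nonneg (continuous_const.mul hωc) (fun τ => ?_) hT hM) <;> simp

end

/-! ### Nonlinear existence and propagation of decay -/

section

open Set BoundedContinuousFunction

/-- Existence of decaying solutions of the planar system `P' = ε ω Q + F₁(τ, P, Q)`,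
`Q' = ω P + F₂(τ, P, Q)` by a contraction argument. -/
theorem exists_decaying_solution {T M ℓ ε : ℝ} (hT : 0 < T) (hM : 4 ≤ M) (hℓ0 : 0 ≤ ℓ)
    (hℓ : 4 * ℓ ≤ M)
    {ω : ℝ → ℝ} (hω : ContinuousOn ω (Ici T)) (hω0 : ∀ τ ≥ T, 0 ≤ ω τ)
    (hωM : ∀ τ ≥ T, 2 * M ≤ τ * ω τ) (hε : ε = 1 ∨ ε = -1)
    {F : ℝ → ℝ × ℝ → ℝ × ℝ} (hFc : ContinuousOn (fun p : ℝ × (ℝ × ℝ) => F p.1 p.2) (Ici T ×ˢ univ))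
    (hF0 : ∀ τ ≥ T, ‖F τ 0‖ ≤ τ ^ (-1 - M))
    (hF : ∀ τ ≥ T, ∀ w w', ‖w‖ ≤ τ ^ (-M) → ‖w'‖ ≤ τ ^ (-M) →
      ‖F τ w - F τ w'‖ ≤ ℓ / τ * ‖w - w'‖) :
    ∃ P Q : ℝ → ℝ, ∀ τ > T, HasDerivAt P (ε * ω τ * Q τ + (F τ (P τ, Q τ)).1) τ ∧
      HasDerivAt Q (ω τ * P τ + (F τ (P τ, Q τ)).2) τ ∧ ‖(P τ, Q τ)‖ ≤ τ ^ (-M) := by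
  have hM0 : 0 < M := by linarith
  -- Composing with `max · T` extends the data from the half-line to continuous functions on the
  -- whole line.
  have hmax : ∀ s, T ≤ max s T := fun s => le_max_right _ _
  have hmaxc : Continuous fun s : ℝ => max s T := continuous_id.max continuous_const
  have hmax0 : ∀ s, 0 < max s T := fun s => hT.trans_le (hmax s)
  have hωc : Continuous fun τ => ω (max τ T) := hω.comp_continuous hmaxc hmax
  obtain ⟨L, hL, hLd⟩ := hasPlanarSolutionOperator hωc (ε := ε) hε hT hM0
    (fun τ => hω0 _ (hmax τ)) (fun τ hτ => by rw [max_eq_left hτ]; exact hωM τ hτ)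
  have hpowc : ∀ a : ℝ, Continuous fun s : ℝ => (max s T) ^ a := fun a =>
    hmaxc.rpow_const fun s => Or.inl (hmax0 s).ne'
  -- the forcing term determined by a rescaled candidate solution
  set Φ : (ℝ →ᵇ ℝ × ℝ) → ℝ → ℝ × ℝ :=
    fun g s => F (max s T) ((max s T) ^ (-M) • g s) with hΦ
  have hΦc : ∀ g, Continuous (Φ g) := fun g => by
    refine hFc.comp_continuous (f := fun s => (max s T, (max s T) ^ (-M) • g s)) ?_
      fun s => ⟨hmax s, mem_univ _⟩
    exact hmaxc.prodMk ((hpowc _).smul g.continuous)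
  have hsm : ∀ (g : ℝ →ᵇ ℝ × ℝ), ‖g‖ ≤ 1 → ∀ s, ‖(max s T) ^ (-M) • g s‖ ≤ (max s T) ^ (-M) := by
    intro g hg s
    rw [norm_smul, Real.norm_of_nonneg (Real.rpow_nonneg (hmax0 s).le _)]
    exact mul_le_of_le_one_right (Real.rpow_nonneg (hmax0 s).le _)
      ((g.norm_coe_le_norm s).trans hg)
  have hsplit : ∀ s : ℝ, 0 < s → ∀ c d : ℝ, c / s * (s ^ (-M) * d) = c * d * s ^ (-1 - M) := by
    intro s hs c d
    rw [show -1 - M = -M - 1 by ring, Real.rpow_sub_one hs.ne']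
    field_simp
  have hΦd : ∀ g g' : ℝ →ᵇ ℝ × ℝ, ‖g‖ ≤ 1 → ‖g'‖ ≤ 1 → ∀ s ≥ T,
      ‖Φ g s - Φ g' s‖ ≤ (ℓ * ‖g - g'‖) * s ^ (-1 - M) := by
    intro g g' hg hg' s hs
    refine (hF _ (hmax s) _ _ (hsm g hg s) (hsm g' hg' s)).trans ?_
    rw [← smul_sub, norm_smul, Real.norm_of_nonneg (Real.rpow_nonneg (hmax0 s).le _),
      max_eq_left hs, hsplit s (hT.trans_le hs)]
    have := (g - g').norm_coe_le_norm s
    have hs0 : 0 ≤ s ^ (-1 - M) := Real.rpow_nonneg (hT.trans_le hs).le _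
    simp only [coe_sub, Pi.sub_apply] at this
    gcongr
  have hΦn : ∀ g : ℝ →ᵇ ℝ × ℝ, ‖g‖ ≤ 1 → ∀ s ≥ T, ‖Φ g s‖ ≤ (1 + ℓ) * s ^ (-1 - M) := by
    intro g hg s hs
    have h1 := hΦd g 0 hg (by simp) s hs
    have h2 : ‖Φ 0 s‖ ≤ s ^ (-1 - M) := by
      simp only [hΦ, coe_zero, Pi.zero_apply, smul_zero, max_eq_left hs]
      exact hF0 s hs
    have h3 : (ℓ * ‖g - 0‖) * s ^ (-1 - M) ≤ ℓ * s ^ (-1 - M) := by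
      have hs0 : 0 ≤ s ^ (-1 - M) := Real.rpow_nonneg (hT.trans_le hs).le _
      rw [sub_zero]
      gcongr
      exact mul_le_of_le_one_right hℓ0 hg
    have h4 := norm_add_le (Φ g s - Φ 0 s) (Φ 0 s)
    rw [sub_add_cancel] at h4
    linarith
  set X : Set (ℝ →ᵇ ℝ × ℝ) := Metric.closedBall 0 1 with hX
  have hXn : ∀ {g}, g ∈ X ↔ ‖g‖ ≤ 1 := fun {g} => by rw [hX, mem_closedBall_zero_iff]
  have hLc : ∀ g, ‖g‖ ≤ 1 → Continuous (L (Φ g)) := fun g hg => by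
    have h1 := (hL (Φ g) (1 + ℓ) (hΦc g) (hΦn g hg)).1
    have h2 : Continuous fun τ => (L (Φ g) τ).1 :=
      continuous_iff_continuousAt.2 fun τ => (h1 τ).1.continuousAt
    have h3 : Continuous fun τ => (L (Φ g) τ).2 :=
      continuous_iff_continuousAt.2 fun τ => (h1 τ).2.continuousAt
    exact h2.prodMk h3
  -- Used with `c = 1 + ℓ`: the hypotheses `4 ≤ M` and `4 ℓ ≤ M` are made for `1 + ℓ ≤ M / 2`.
  have hM2 : ∀ c, 0 ≤ c → c ≤ M / 2 → 2 * c / M ≤ 1 := fun c _ h => by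
    rw [div_le_one hM0]
    linarith
  have hNbd : ∀ g, ‖g‖ ≤ 1 → ∀ s, ‖(max s T) ^ M • L (Φ g) (max s T)‖ ≤ 1 := by
    intro g hg s
    have h1 := (hL (Φ g) (1 + ℓ) (hΦc g) (hΦn g hg)).2 _ (hmax s)
    rw [norm_smul, Real.norm_of_nonneg (Real.rpow_nonneg (hmax0 s).le _)]
    have h2 : (max s T) ^ M * (max s T) ^ (-M) = 1 := by rw [← Real.rpow_add (hmax0 s)]; simp
    calc (max s T) ^ M * ‖L (Φ g) (max s T)‖
        ≤ (max s T) ^ M * (2 * (1 + ℓ) / M * (max s T) ^ (-M)) := by gcongr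
      _ = 2 * (1 + ℓ) / M * ((max s T) ^ M * (max s T) ^ (-M)) := by ring
      _ ≤ 1 := by
        rw [h2, mul_one]
        exact hM2 _ (by linarith) (by linarith)
  -- The unknown is rescaled by `τ^M`, so the weighted decay space becomes the unit ball of bounded
  -- continuous functions. The gain `2/M` gives the Lipschitz constant `2ℓ/M ≤ 1/2`.
  set 𝒩 : X → X := fun g => ⟨ofNormedAddCommGroup
    (fun s => (max s T) ^ M • L (Φ g.1) (max s T))
    ((hpowc M).smul ((hLc g.1 (hXn.1 g.2)).comp hmaxc)) 1 (hNbd g.1 (hXn.1 g.2)),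
    hXn.2 (norm_ofNormedAddCommGroup_le _ zero_le_one _)⟩ with h𝒩
  have hcontr : ContractingWith (1 / 2) 𝒩 := by
    refine ⟨by rw [← NNReal.coe_lt_coe]; norm_num, LipschitzWith.of_dist_le_mul fun g g' => ?_⟩
    rw [Subtype.dist_eq, Subtype.dist_eq]
    refine (dist_le (by positivity)).2 fun s => ?_
    have hg := hXn.1 g.2
    have hg' := hXn.1 g'.2
    have h1 := hLd _ _ _ _ (hΦc g.1) (hΦn g.1 hg) (hΦc g'.1) (hΦn g'.1 hg') (max s T)
    have h2 := (hL (fun s => Φ g.1 s - Φ g'.1 s) _ ((hΦc _).sub (hΦc _))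
      (hΦd g.1 g'.1 hg hg')).2 _ (hmax s)
    have h3 : (max s T) ^ M * (max s T) ^ (-M) = 1 := by rw [← Real.rpow_add (hmax0 s)]; simp
    simp only [h𝒩, coe_ofNormedAddCommGroup]
    rw [dist_eq_norm, ← smul_sub, h1, norm_smul,
      Real.norm_of_nonneg (Real.rpow_nonneg (hmax0 s).le _), dist_eq_norm]
    calc (max s T) ^ M * ‖L (fun s => Φ g.1 s - Φ g'.1 s) (max s T)‖
        ≤ (max s T) ^ M * (2 * (ℓ * ‖g.1 - g'.1‖) / M * (max s T) ^ (-M)) := by gcongr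
      _ = 2 * ℓ / M * ‖g.1 - g'.1‖ * ((max s T) ^ M * (max s T) ^ (-M)) := by ring
      _ ≤ 1 / 2 * ‖g.1 - g'.1‖ := by
        rw [h3, mul_one]
        refine mul_le_mul_of_nonneg_right ?_ (norm_nonneg _)
        rw [div_le_div_iff₀ hM0 two_pos]
        linarith
      _ = _ := by norm_num
  have : Nonempty X := ⟨⟨0, hXn.2 (by simp)⟩⟩
  have : CompleteSpace X := Metric.isClosed_closedBall.completeSpace_coe
  obtain ⟨g, hg⟩ : ∃ g, 𝒩 g = g := ⟨_, hcontr.fixedPoint_isFixedPt⟩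
  have hgn := hXn.1 g.2
  have hfix : ∀ s ≥ T, s ^ (-M) • g.1 s = L (Φ g.1) s := by
    intro s hs
    have h1 : (𝒩 g).1 s = g.1 s := by rw [hg]
    simp only [h𝒩, coe_ofNormedAddCommGroup, max_eq_left hs] at h1
    rw [← h1, smul_smul, ← Real.rpow_add (hT.trans_le hs)]
    simp
  have hsol := (hL (Φ g.1) (1 + ℓ) (hΦc g.1) (hΦn g.1 hgn)).1
  refine ⟨fun τ => (L (Φ g.1) τ).1, fun τ => (L (Φ g.1) τ).2, fun τ hτ => ?_⟩
  have hτ' : T ≤ τ := le_of_lt hτ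
  have h1 := hsol τ
  have h2 : Φ g.1 τ = F τ (L (Φ g.1) τ) := by
    rw [← hfix τ hτ']
    simp only [hΦ, max_eq_left hτ']
  simp only [max_eq_left hτ', h2] at h1
  refine ⟨h1.1, h1.2, ?_⟩
  have h3 := hsm g.1 hgn τ
  rw [max_eq_left hτ', hfix τ hτ'] at h3
  exact h3

/-- A decaying solution of a perturbed planar system inherits the decay of the forcing term. -/
theorem decay_of_decaying_solution {T M N K C C₀ ε : ℝ} (hT : 0 < T) (hM : 0 < M) (hMN : M ≤ N)
    (hK : 0 ≤ K) (hKM : 4 * K ≤ M) (hC : 0 ≤ C)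
    {ω : ℝ → ℝ} (hω : ContinuousOn ω (Ioi T)) (hω0 : ∀ τ > T, 0 ≤ ω τ)
    (hωN : ∀ τ > T, 2 * N ≤ τ * ω τ) (hε : ε = 1 ∨ ε = -1)
    {P Q f g : ℝ → ℝ} (hP : ∀ τ > T, HasDerivAt P (ε * ω τ * Q τ + f τ) τ)
    (hQ : ∀ τ > T, HasDerivAt Q (ω τ * P τ + g τ) τ)
    (hfg : ∀ τ > T, ‖(f τ, g τ)‖ ≤ K / τ * ‖(P τ, Q τ)‖ + C * τ ^ (-1 - N))
    (h0 : ∀ τ > T, ‖(P τ, Q τ)‖ ≤ C₀ * τ ^ (-M)) :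
    ∃ C₁, ∀ τ > T + 1, ‖(P τ, Q τ)‖ ≤ C₁ * τ ^ (-N) := by
  have hN : 0 < N := hM.trans_le hMN
  obtain ⟨ν, hν, hν1, hνre⟩ : ∃ ν : ℂ, ν ^ 2 = (ε : ℂ) ∧ ‖ν‖ = 1 ∧ (ν = 1 ∨ ν = Complex.I) := by
    rcases hε with rfl | rfl
    · exact ⟨1, by simp, by simp, Or.inl rfl⟩
    · exact ⟨Complex.I, by simp, by simp, Or.inr rfl⟩
  have hC₀ : 0 ≤ C₀ := by
    have := (norm_nonneg _).trans (h0 (T + 1) (by linarith))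
    exact nonneg_of_mul_nonneg_left this (Real.rpow_pos_of_pos (by linarith) _)
  set w₁ : ℝ → ℂ := fun τ => (P τ : ℂ) + ν * (Q τ : ℂ) with hw₁
  set w₂ : ℝ → ℂ := fun τ => (P τ : ℂ) + -ν * (Q τ : ℂ) with hw₂
  set h₁ : ℝ → ℂ := fun τ => (f τ : ℂ) + ν * (g τ : ℂ) with hh₁
  set h₂ : ℝ → ℂ := fun τ => (f τ : ℂ) + -ν * (g τ : ℂ) with hh₂
  have hd₁ : ∀ τ > T, HasDerivAt w₁ (ν * (ω τ : ℂ) * w₁ τ + h₁ τ) τ := fun τ hτ => by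
    refine ((hP τ hτ).ofReal_comp.add ((hQ τ hτ).ofReal_comp.const_mul ν)).congr_deriv ?_
    simp only [hw₁, hh₁, Complex.ofReal_add, Complex.ofReal_mul]
    linear_combination -(ω τ : ℂ) * (Q τ : ℂ) * hν
  have hd₂ : ∀ τ > T, HasDerivAt w₂ (-ν * (ω τ : ℂ) * w₂ τ + h₂ τ) τ := fun τ hτ => by
    refine ((hP τ hτ).ofReal_comp.add ((hQ τ hτ).ofReal_comp.const_mul (-ν))).congr_deriv ?_
    simp only [hw₂, hh₂, Complex.ofReal_add, Complex.ofReal_mul]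
    linear_combination -(ω τ : ℂ) * (Q τ : ℂ) * hν
  have hν1' : ‖-ν‖ = 1 := by rwa [norm_neg]
  have hwn₁ : ∀ τ, ‖w₁ τ‖ ≤ 2 * ‖(P τ, Q τ)‖ := fun τ => norm_add_mul_le_two hν1 (P τ, Q τ)
  have hwn₂ : ∀ τ, ‖w₂ τ‖ ≤ 2 * ‖(P τ, Q τ)‖ := fun τ => norm_add_mul_le_two hν1' (P τ, Q τ)
  have hPQ0 : Tendsto (fun τ => 2 * ‖(P τ, Q τ)‖) atTop (𝓝 0) := by
    have h1 : Tendsto (fun τ : ℝ => C₀ * τ ^ (-M)) atTop (𝓝 0) := by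
      simpa using (tendsto_rpow_neg_atTop hM).const_mul C₀
    have h2 : Tendsto (fun τ => ‖(P τ, Q τ)‖) atTop (𝓝 0) :=
      squeeze_zero' (Eventually.of_forall fun τ => norm_nonneg _)
        ((eventually_gt_atTop T).mono h0) h1
    simpa using h2.const_mul 2
  have hl₁ : Tendsto w₁ atTop (𝓝 0) := squeeze_zero_norm hwn₁ hPQ0
  have hl₂ : Tendsto w₂ atTop (𝓝 0) := squeeze_zero_norm hwn₂ hPQ0
  have hωC : ContinuousOn (fun τ => (ω τ : ℂ)) (Ioi T) :=
    Complex.continuous_ofReal.comp_continuousOn hω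
  have hT1 : 0 < T + 1 := by linarith
  set D : ℝ := (‖w₁ (T + 1)‖ + ‖w₂ (T + 1)‖) * (T + 1) ^ N with hD
  have hD0 : 0 ≤ D := by positivity
  have hlt : ∀ s ≥ T + 1, T < s := fun s hs => by linarith [show T + 1 ≤ s from hs]
  -- The constant `D`, needed for a damped mode started at `T + 1`, is included here too: both modes
  -- then have bounds of one form, and the endpoint `τ = T + 1` is covered.
  have back : ∀ (μ h w : ℝ → ℂ), ContinuousOn μ (Ioi T) → (∀ τ > T, 0 ≤ (μ τ).re) →
      (∀ τ > T, HasDerivAt w (μ τ * w τ + h τ) τ) → Tendsto w atTop (𝓝 0) →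
      ‖w (T + 1)‖ * (T + 1) ^ N ≤ D → ∀ H₁ H₂, 0 ≤ H₁ → 0 ≤ H₂ →
      (∀ τ ≥ T + 1, ‖h τ‖ ≤ H₁ * τ ^ (-1 - N) + H₂ * τ ^ (-1 - M)) →
      ∀ τ ≥ T + 1, ‖w τ‖ ≤ (D + H₁ / N) * τ ^ (-N) + H₂ / M * τ ^ (-M) := by
    intro μ h w hμ hre hw hl hwD H₁ H₂ hH₁ hH₂ hh τ hτ
    have hτ0 : 0 < τ := hT1.trans_le hτ
    have e1 : 0 ≤ D * τ ^ (-N) := by positivity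
    rcases (show T + 1 ≤ τ from hτ).eq_or_lt with rfl | hlt'
    · have e2 : ‖w (T + 1)‖ = ‖w (T + 1)‖ * (T + 1) ^ N * (T + 1) ^ (-N) := by
        rw [mul_assoc, ← Real.rpow_add hT1]
        simp
      have e3 : ‖w (T + 1)‖ * (T + 1) ^ N * (T + 1) ^ (-N) ≤ D * (T + 1) ^ (-N) := by gcongr
      have e4 : 0 ≤ H₁ / N * (T + 1) ^ (-N) := by positivity
      have e5 : 0 ≤ H₂ / M * (T + 1) ^ (-M) := by positivity
      linarith
    · have h1 := norm_le_of_hasDerivAt_of_re_nonneg hT1.le hM hN hH₁ hH₂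
        (hμ.mono (Ioi_subset_Ioi (by linarith))) (fun s hs => hre s (hlt s (le_of_lt hs)))
        (fun s hs => hw s (hlt s (le_of_lt hs))) (fun s hs => hh s (le_of_lt hs)) hl hlt'
      linarith
  have hDsplit : D = ‖w₁ (T + 1)‖ * (T + 1) ^ N + ‖w₂ (T + 1)‖ * (T + 1) ^ N := by
    rw [hD]
    ring
  have hDw₁ : ‖w₁ (T + 1)‖ * (T + 1) ^ N ≤ D := by
    rw [hDsplit]
    exact le_add_of_nonneg_right (by positivity)
  have hDw₂ : ‖w₂ (T + 1)‖ * (T + 1) ^ N ≤ D := by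
    rw [hDsplit]
    exact le_add_of_nonneg_left (by positivity)
  have est₁ := back (fun τ => ν * (ω τ : ℂ)) h₁ w₁ (continuousOn_const.mul hωC)
    (fun s hs => by rcases hνre with rfl | rfl <;> simp [hω0 s hs]) hd₁ hl₁ hDw₁
  have est₂ : ∀ H₁ H₂, 0 ≤ H₁ → 0 ≤ H₂ →
      (∀ τ ≥ T + 1, ‖h₂ τ‖ ≤ H₁ * τ ^ (-1 - N) + H₂ * τ ^ (-1 - M)) →
      ∀ τ ≥ T + 1, ‖w₂ τ‖ ≤ (D + H₁ / N) * τ ^ (-N) + H₂ / M * τ ^ (-M) := by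
    rcases hνre with rfl | rfl
    · intro H₁ H₂ hH₁ hH₂ hh τ hτ
      obtain ⟨θ, hθ⟩ := exists_primitive_of_continuousOn hω
      have h1 := norm_le_of_hasDerivAt_neg hT1 hM hN hH₁ hH₂ (fun s hs => hθ s (hlt s hs))
        (fun s hs => by linarith [hωN s (hlt s hs)]) (fun s hs => hωN s (hlt s hs))
        (fun s hs => by simpa using hd₂ s (hlt s hs)) hh hτ
      have e1 : (‖w₂ (T + 1)‖ * (T + 1) ^ N + H₁ / N) * τ ^ (-N) ≤ (D + H₁ / N) * τ ^ (-N) := by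
        have := Real.rpow_nonneg (hT1.trans_le hτ).le (-N)
        gcongr
      linarith
    · exact back (fun τ => -Complex.I * (ω τ : ℂ)) h₂ w₂ (continuousOn_const.mul hωC)
        (fun s hs => by simp) hd₂ hl₂ hDw₂
  have hmax : ∀ τ B, ‖w₁ τ‖ ≤ B → ‖w₂ τ‖ ≤ B → ‖(P τ, Q τ)‖ ≤ B := by
    intro τ B hB₁ hB₂
    have e1 : ‖(2 : ℂ) * (P τ : ℂ)‖ ≤ 2 * B := by
      have : (2 : ℂ) * (P τ : ℂ) = w₁ τ + w₂ τ := by simp only [hw₁, hw₂]; ring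
      rw [this]
      linarith [norm_add_le (w₁ τ) (w₂ τ)]
    have e2 : ‖(2 : ℂ) * (ν * (Q τ : ℂ))‖ ≤ 2 * B := by
      have : (2 : ℂ) * (ν * (Q τ : ℂ)) = w₁ τ - w₂ τ := by simp only [hw₁, hw₂]; ring
      rw [this]
      linarith [norm_sub_le (w₁ τ) (w₂ τ)]
    rw [norm_mul, Complex.norm_two, Complex.norm_real] at e1
    rw [norm_mul, norm_mul, hν1, Complex.norm_two, Complex.norm_real] at e2
    rw [norm_prod_le_iff]
    exact ⟨by linarith, by linarith⟩
  -- Chosen as a fixed point: `2K/N ≤ 1/2` gives `D + 2(K C₁ + C)/N ≤ C₁`.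
  set C₁ : ℝ := 2 * (D + 2 * C / N) with hC₁
  have hC₁0 : 0 ≤ C₁ := by positivity
  -- Feeding the bound back into the equation keeps the `τ^(-N)` part and halves the slowly decaying
  -- `τ^(-M)` part, which disappears as `n → ∞`.
  have key : ∀ n : ℕ, ∀ τ ≥ T + 1,
      ‖(P τ, Q τ)‖ ≤ C₁ * τ ^ (-N) + (1 / 2) ^ n * C₀ * τ ^ (-M) := by
    intro n
    induction n with
    | zero =>
      intro τ hτ
      have := Real.rpow_nonneg (hT1.trans_le hτ).le (-N)
      have h1 := h0 τ (hlt τ hτ)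
      have : 0 ≤ C₁ * τ ^ (-N) := by positivity
      simp only [pow_zero, one_mul]
      linarith
    | succ n ih =>
      set η : ℝ := (1 / 2) ^ n * C₀ with hη
      have hη0 : 0 ≤ η := by positivity
      have hfgn : ∀ τ ≥ T + 1, 2 * ‖(f τ, g τ)‖ ≤
          (2 * (K * C₁ + C)) * τ ^ (-1 - N) + (2 * K * η) * τ ^ (-1 - M) := by
        intro τ hτ
        have hτ0 : 0 < τ := hT1.trans_le hτ
        have e1 := hfg τ (hlt τ hτ)
        have e2 : K / τ * ‖(P τ, Q τ)‖ ≤ K / τ * (C₁ * τ ^ (-N) + η * τ ^ (-M)) :=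
          mul_le_mul_of_nonneg_left (ih τ hτ) (by positivity)
        have e3 : ∀ x : ℝ, τ ^ (-1 - x) = τ ^ (-x) / τ := fun x => by
          rw [show -1 - x = -x - 1 by ring, Real.rpow_sub_one hτ0.ne']
        have e4 : K / τ * (C₁ * τ ^ (-N) + η * τ ^ (-M)) =
            K * C₁ * τ ^ (-1 - N) + K * η * τ ^ (-1 - M) := by
          rw [e3, e3]
          ring
        linarith
      intro τ hτ
      have hτ0 : 0 < τ := hT1.trans_le hτ
      have hpN := Real.rpow_nonneg hτ0.le (-N)
      have hpM := Real.rpow_nonneg hτ0.le (-M)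
      have a1 := est₁ _ _ (by positivity) (by positivity) (fun s hs =>
        (norm_add_mul_le_two hν1 (f s, g s)).trans (hfgn s hs)) τ hτ
      have a2 := est₂ _ _ (by positivity) (by positivity) (fun s hs =>
        (norm_add_mul_le_two hν1' (f s, g s)).trans (hfgn s hs)) τ hτ
      refine (hmax τ _ a1 a2).trans ?_
      have b1 : D + 2 * (K * C₁ + C) / N ≤ C₁ := by
        have : 2 * (K * C₁ + C) / N = 2 * K / N * C₁ + 2 * C / N := by ring
        have hKN : 2 * K / N ≤ 1 / 2 := by
          rw [div_le_div_iff₀ hN two_pos]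
          linarith
        have := mul_le_mul_of_nonneg_right hKN hC₁0
        linarith
      have b2 : 2 * K * η / M ≤ (1 / 2) ^ (n + 1) * C₀ := by
        have : 2 * K * η / M = 2 * K / M * η := by ring
        have hKN : 2 * K / M ≤ 1 / 2 := by
          rw [div_le_div_iff₀ hM two_pos]
          linarith
        have := mul_le_mul_of_nonneg_right hKN hη0
        rw [pow_succ]
        linarith
      gcongr
  refine ⟨C₁, fun τ hτ => ?_⟩
  have hlim : Tendsto (fun n : ℕ => C₁ * τ ^ (-N) + (1 / 2) ^ n * C₀ * τ ^ (-M)) atTop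
      (𝓝 (C₁ * τ ^ (-N) + 0 * C₀ * τ ^ (-M))) :=
    (((tendsto_pow_atTop_nhds_zero_of_lt_one (by norm_num) (by norm_num)).mul_const C₀).mul_const
      _).const_add _
  have := ge_of_tendsto' hlim fun n => key n τ (le_of_lt hτ)
  simpa using this

end

/-! ### The nonlinearity near the origin -/

section

open Set

/-- The partial derivative of `resonanceNonlin` with respect to `S`. -/
noncomputable def nonlinS (z : ℝ × ℝ) : ℝ :=
  √(1 + z.1 - z.2 ^ 2) + z.1 / (2 * √(1 + z.1 - z.2 ^ 2))

/-- The partial derivative of `resonanceNonlin` with respect to `v`. -/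
noncomputable def nonlinV (z : ℝ × ℝ) : ℝ := -(z.1 * z.2) / √(1 + z.1 - z.2 ^ 2)

lemma half_lt_of_norm_lt {z : ℝ × ℝ} (hz : ‖z‖ < 1 / 4) : 1 / 2 < 1 + z.1 - z.2 ^ 2 := by
  have h1 := (norm_fst_le z).trans_lt hz
  have h2 := (norm_snd_le z).trans_lt hz
  rw [Real.norm_eq_abs, abs_lt] at h1 h2
  nlinarith

lemma hasFDerivAt_resonanceNonlin {z : ℝ × ℝ} (hz : ‖z‖ < 1 / 4) :
    HasFDerivAt resonanceNonlin
      (nonlinS z • ContinuousLinearMap.fst ℝ ℝ ℝ + nonlinV z • ContinuousLinearMap.snd ℝ ℝ ℝ) z := by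
  have hpos := half_lt_of_norm_lt hz
  have hpos' : 0 < 1 + z.1 - z.2 ^ 2 := by linarith
  have h1 : HasFDerivAt (fun z : ℝ × ℝ => z.1) (ContinuousLinearMap.fst ℝ ℝ ℝ) z := hasFDerivAt_fst
  have h2 : HasFDerivAt (fun z : ℝ × ℝ => z.2) (ContinuousLinearMap.snd ℝ ℝ ℝ) z := hasFDerivAt_snd
  have h3 := h1.mul (((h1.const_add 1).sub (h2.pow 2)).sqrt hpos'.ne')
  refine h3.congr_fderiv ?_
  have hs : 0 < √(1 + z.1 - z.2 ^ 2) := Real.sqrt_pos.2 (by linarith)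
  ext <;> simp [nonlinS, nonlinV] <;> field_simp
  ring

lemma contDiffAt_resonanceNonlin : ContDiffAt ℝ 2 resonanceNonlin 0 := by
  unfold resonanceNonlin
  refine contDiffAt_fst.mul (ContDiffAt.sqrt ?_ (by simp))
  exact (contDiffAt_const.add contDiffAt_fst).sub (contDiffAt_snd.pow 2)

lemma contDiffAt_nonlinS {z : ℝ × ℝ} (hz : ‖z‖ < 1 / 4) : ContDiffAt ℝ 1 nonlinS z := by
  have hpos := half_lt_of_norm_lt hz
  have hs : 0 < √(1 + z.1 - z.2 ^ 2) := Real.sqrt_pos.2 (by linarith)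
  have h : ContDiffAt ℝ 1 (fun z : ℝ × ℝ => √(1 + z.1 - z.2 ^ 2)) z :=
    ((contDiffAt_const.add contDiffAt_fst).sub (contDiffAt_snd.pow 2)).sqrt
      (by linarith)
  exact h.add (contDiffAt_fst.div (contDiffAt_const.mul h) (by positivity))

lemma continuous_resonanceNonlin : Continuous resonanceNonlin := by
  unfold resonanceNonlin
  fun_prop

/-- Quantitative strict differentiability of `resonanceNonlin` near `0`. -/
lemma exists_resonanceNonlin_estimate : ∃ r K : ℝ, 0 < r ∧ r ≤ 1 / 4 ∧ 0 < K ∧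
    ∀ a b b' : ℝ × ℝ, ∀ R : ℝ, ‖a‖ < r → ‖b‖ < r → ‖b'‖ < r → ‖b - a‖ ≤ R → ‖b' - a‖ ≤ R →
      |resonanceNonlin b - resonanceNonlin b' -
        (nonlinS a * (b.1 - b'.1) + nonlinV a * (b.2 - b'.2))| ≤ K * R * ‖b - b'‖ := by
  have h1 : ContDiffAt ℝ 1 (fderiv ℝ resonanceNonlin) 0 :=
    contDiffAt_resonanceNonlin.fderiv_right (by norm_num)
  obtain ⟨K, t, ht, hK⟩ := h1.exists_lipschitzOnWith
  obtain ⟨r', hr', hr't⟩ := Metric.mem_nhds_iff.1 ht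
  -- `K + 1` because the Lipschitz constant `K` of the derivative may be zero; the radius `1/4`
  -- keeps the radicand above `1/2`.
  refine ⟨min r' (1 / 4), K + 1, by positivity, min_le_right _ _, by positivity, ?_⟩
  intro a b b' R ha hb hb' hba hba'
  have hsub : ∀ z : ℝ × ℝ, ‖z‖ < min r' (1 / 4) → z ∈ t ∧ ‖z‖ < 1 / 4 := fun z hz =>
    ⟨hr't (mem_ball_zero_iff.2 (hz.trans_le (min_le_left _ _))), hz.trans_le (min_le_right _ _)⟩
  -- On this convex set the derivative differs from its value at `a` by at most `(K + 1) R`, so the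
  -- mean value inequality applies to the function minus its linear part at `a`.
  set s : Set (ℝ × ℝ) := Metric.ball 0 (min r' (1 / 4)) ∩ Metric.closedBall a R with hs
  have hconv : Convex ℝ s := (convex_ball _ _).inter (convex_closedBall _ _)
  have hmain := hconv.norm_image_sub_le_of_norm_hasFDerivWithin_le' (𝕜 := ℝ)
    (f := resonanceNonlin) (f' := fderiv ℝ resonanceNonlin) (C := (K + 1) * R)
    (φ := nonlinS a • ContinuousLinearMap.fst ℝ ℝ ℝ + nonlinV a • ContinuousLinearMap.snd ℝ ℝ ℝ)
    (x := b') (y := b) (fun z hz => ?_) (fun z hz => ?_)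
    ⟨mem_ball_zero_iff.2 hb', mem_closedBall_iff_norm.2 hba'⟩
    ⟨mem_ball_zero_iff.2 hb, mem_closedBall_iff_norm.2 hba⟩
  · simpa using hmain
  · have hz' := (hsub z (mem_ball_zero_iff.1 hz.1)).2
    exact (hasFDerivAt_resonanceNonlin hz').differentiableAt.hasFDerivAt.hasFDerivWithinAt
  · rw [← (hasFDerivAt_resonanceNonlin (hsub a ha).2).fderiv, ← dist_eq_norm]
    refine (hK.dist_le_mul z (hsub z (mem_ball_zero_iff.1 hz.1)).1 a (hsub a ha).1).trans ?_
    have hR : dist z a ≤ R := hz.2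
    have hR0 : 0 ≤ R := dist_nonneg.trans hR
    nlinarith [K.2, NNReal.coe_nonneg K]

lemma contDiffOn_powerEval (A : ℝ) (p : MvPolynomial (Fin 2) ℝ) :
    ContDiffOn ℝ 1 (powerEval A p) (Ioi 0) := by
  have hp : ∀ c : ℝ, ContDiffOn ℝ 1 (fun τ : ℝ => τ ^ c) (Ioi 0) := fun c τ hτ =>
    (Real.contDiffAt_rpow_const_of_ne (ne_of_gt hτ)).contDiffWithinAt
  induction p using MvPolynomial.induction_on with
  | C a => exact contDiffOn_const.congr fun τ _ => powerEval_C A a τ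
  | add p q hp hq => exact (hp.add hq).congr fun τ _ => powerEval_add A p q τ
  | mul_X p i h =>
    fin_cases i
    · exact (h.mul (hp (-(1 - A)))).congr fun τ _ => by simp
    · exact (h.mul (hp (-A))).congr fun τ _ => by simp

end

/-! ### The coefficients of the linearization and the balancing weight -/

section

open Set

variable {A G : ℝ}

/-- The approximate solution in the `(S, v)` plane. -/
noncomputable def approxZ (A G : ℝ) (k : ℕ) (τ : ℝ) : ℝ × ℝ := (approxS A G k τ, approxV A G k τ)

lemma approxZ_tendsto (hA0 : 0 < A) (hA1 : A < 1) (k : ℕ) :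
    Tendsto (approxZ A G k) atTop (𝓝 0) :=
  (approxS_tendsto G hA0 hA1 k).prodMk_nhds (approxV_tendsto G hA0 hA1 k)

lemma contDiffOn_approxZ (k : ℕ) : ContDiffOn ℝ 1 (approxZ A G k) (Ioi 0) :=
  (contDiffOn_powerEval A _).prodMk (contDiffOn_powerEval A _)

lemma tendsto_mul_deriv_approxZ (hA0 : 0 < A) (hA1 : A < 1) (k : ℕ) :
    Tendsto (fun τ => τ * ‖deriv (approxZ A G k) τ‖) atTop (𝓝 0) := by
  have hd : 0 < min A (1 - A) := lt_min hA0 (by linarith)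
  have key : ∀ f : ℝ → ℝ, deriv f =O[atTop] (fun τ : ℝ => τ ^ (-min A (1 - A)) / τ) →
      Tendsto (fun τ => τ * ‖deriv f τ‖) atTop (𝓝 0) := by
    intro f hf
    refine (((isBigO_refl (fun τ : ℝ => τ) atTop).mul hf.norm_left).trans_eventuallyEq
      (g₂ := fun τ : ℝ => τ ^ (-min A (1 - A))) ?_).trans_tendsto (tendsto_rpow_neg_atTop hd)
    filter_upwards [eventually_gt_atTop (0 : ℝ)] with τ hτ
    field_simp
  have h1 := (key _ (deriv_approxS_isBigO G hA0 hA1 k)).max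
    (key _ (deriv_approxV_isBigO G hA0 hA1 k))
  rw [max_self] at h1
  refine h1.congr' ?_
  filter_upwards [eventually_gt_atTop (0 : ℝ)] with τ hτ
  have h2 : deriv (approxZ A G k) τ = (deriv (approxS A G k) τ, deriv (approxV A G k) τ) :=
    ((differentiableAt_approxS G k hτ).hasDerivAt.prodMk
      (differentiableAt_approxV G k hτ).hasDerivAt).deriv
  rw [h2, Prod.norm_mk, mul_max_of_nonneg _ _ hτ.le]

lemma nonlinS_zero : nonlinS 0 = 1 := by simp [nonlinS]

lemma tendsto_nonlinS_approxZ (hA0 : 0 < A) (hA1 : A < 1) (k : ℕ) :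
    Tendsto (fun τ => nonlinS (approxZ A G k τ)) atTop (𝓝 1) := by
  have := (contDiffAt_nonlinS (z := 0) (by simp)).continuousAt.tendsto.comp
    (approxZ_tendsto (G := G) hA0 hA1 k)
  rwa [nonlinS_zero] at this

lemma tendsto_mul_deriv_nonlinS (hA0 : 0 < A) (hA1 : A < 1) (k : ℕ) :
    Tendsto (fun τ => τ * |deriv (fun s => nonlinS (approxZ A G k s)) τ|) atTop (𝓝 0) := by
  have hc : ContDiffAt ℝ 0 (fderiv ℝ nonlinS) 0 :=
    (contDiffAt_nonlinS (z := 0) (by simp)).fderiv_right (by norm_num)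
  have hb : ∀ᶠ τ in atTop, ‖fderiv ℝ nonlinS (approxZ A G k τ)‖ < ‖fderiv ℝ nonlinS 0‖ + 1 :=
    ((hc.continuousAt.tendsto.comp (approxZ_tendsto (G := G) hA0 hA1 k)).norm).eventually
      (gt_mem_nhds (lt_add_one _))
  have h0 := (tendsto_mul_deriv_approxZ (G := G) hA0 hA1 k).const_mul (‖fderiv ℝ nonlinS 0‖ + 1)
  rw [mul_zero] at h0
  refine squeeze_zero' ?_ ?_ h0
  · filter_upwards [eventually_gt_atTop (0 : ℝ)] with τ hτ
    positivity
  · have hz : ∀ᶠ τ in atTop, ‖approxZ A G k τ‖ < 1 / 4 := by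
      have := (approxZ_tendsto (G := G) hA0 hA1 k).norm
      rw [norm_zero] at this
      exact this.eventually (gt_mem_nhds (by norm_num))
    filter_upwards [eventually_gt_atTop (0 : ℝ), hb, hz] with τ hτ hbτ hzτ
    have hd := ((contDiffAt_nonlinS hzτ).differentiableAt (by norm_num)).hasFDerivAt.comp_hasDerivAt
      τ (((contDiffOn_approxZ (A := A) (G := G) k).contDiffAt
        (Ioi_mem_nhds hτ)).differentiableAt (by norm_num)).hasDerivAt
    have hd' : deriv (fun s => nonlinS (approxZ A G k s)) τ = _ := hd.deriv
    rw [hd', ← Real.norm_eq_abs]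
    have := (fderiv ℝ nonlinS (approxZ A G k τ)).le_opNorm (deriv (approxZ A G k) τ)
    have h2 : ‖fderiv ℝ nonlinS (approxZ A G k τ)‖ * ‖deriv (approxZ A G k) τ‖ ≤
      (‖fderiv ℝ nonlinS 0‖ + 1) * ‖deriv (approxZ A G k) τ‖ := by gcongr
    calc τ * _ ≤ τ * ((‖fderiv ℝ nonlinS 0‖ + 1) * ‖deriv (approxZ A G k) τ‖) := by
          gcongr
          exact this.trans h2
      _ = _ := by ring

lemma tendsto_powerEval_of_sub_mem (hA0 : 0 < A) (hA1 : A < 1) {p : MvPolynomial (Fin 2) ℝ} {c : ℝ}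
    (hp : p - MvPolynomial.C c ∈ varIdeal ^ 1) : Tendsto (powerEval A p) atTop (𝓝 c) := by
  have h1 := powerEval_isBigO hA0 hA1 hp
  have h2 := (h1.trans_tendsto (tendsto_rpow_neg_atTop
    (by rw [Nat.cast_one, one_mul]; exact lt_min hA0 (by linarith)))).add_const c
  simpa using h2

/-- The derivative in `v` is `-S v / √…`, and `S v = XY j b` behaves like `G · (-1/(4G)) / τ =
-1/(4τ)`. This coefficient is thus of size `1/τ` for every `A` and can be treated as a perturbation.
-/
lemma eventually_nonlinV_le (hA0 : 0 < A) (hA1 : A < 1) (hG : G ≠ 0) {k : ℕ} (hk : 1 ≤ k) :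
    ∀ᶠ τ in atTop, |nonlinV (approxZ A G k τ)| ≤ 1 / τ := by
  have hj : Tendsto (powerEval A (formalS A G k)) atTop (𝓝 G) :=
    tendsto_powerEval_of_sub_mem hA0 hA1 (by
      rw [← formalS_one A G]
      exact sub_mem_varIdeal_pow (fun k => (formalIterate_sub_mem A G k).1) hk)
  have hb : Tendsto (powerEval A (formalV A G k)) atTop (𝓝 (-(1 / (4 * G)))) :=
    tendsto_powerEval_of_sub_mem hA0 hA1 (by
      rw [← formalV_one A G]
      exact sub_mem_varIdeal_pow (fun k => (formalIterate_sub_mem A G k).2.1) hk)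
  have hjb := (hj.mul hb).abs
  have hlim : |G * -(1 / (4 * G))| = 1 / 4 := by
    have : G * -(1 / (4 * G)) = -(1 / 4) := by field_simp
    rw [this, abs_neg, abs_of_pos (by norm_num)]
  rw [hlim] at hjb
  have hz : ∀ᶠ τ in atTop, ‖approxZ A G k τ‖ < 1 / 4 := by
    have := (approxZ_tendsto (G := G) hA0 hA1 k).norm
    rw [norm_zero] at this
    exact this.eventually (gt_mem_nhds (by norm_num))
  filter_upwards [eventually_gt_atTop (0 : ℝ), hz,
    hjb.eventually (gt_mem_nhds (by norm_num : (1 / 4 : ℝ) < 1 / 2))] with τ hτ hzτ hjbτ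
  have hpos := half_lt_of_norm_lt hzτ
  have hsq : 1 / 2 ≤ √(1 + (approxZ A G k τ).1 - (approxZ A G k τ).2 ^ 2) :=
    Real.le_sqrt_of_sq_le (by linarith)
  have hprod : (approxZ A G k τ).1 * (approxZ A G k τ).2 =
      powerEval A (formalS A G k) τ * powerEval A (formalV A G k) τ * (1 / τ) := by
    rw [← rpow_neg_mul_rpow_neg (A := A) hτ]
    simp only [approxZ, approxS, approxV, powerEval_mul, powerEval_X_one, powerEval_X_zero]
    ring
  rw [nonlinV, abs_div, abs_neg, hprod, abs_mul, abs_of_nonneg (Real.sqrt_nonneg _),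
    abs_of_pos (one_div_pos.2 hτ), div_le_iff₀ (by linarith)]
  have := one_div_pos.2 hτ
  nlinarith

/-- The weight which balances the two equations of the linearized system. -/
lemma exists_weight (hA0 : 0 < A) (hA1 : A < 1) (hG : G ≠ 0) (k : ℕ) :
    ∃ ς : ℝ → ℝ, ∃ T > 0, ContDiffOn ℝ 1 ς (Ioi T) ∧
      (∀ τ > T, 1 ≤ ς τ ∧ ς τ ≤ τ ∧ |deriv ς τ| ≤ ς τ / τ ∧
        2 * |G| * τ ^ (-A) * ς τ ^ 2 = nonlinS (approxZ A G k τ)) ∧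
      Tendsto (fun τ => τ * (2 * |G| * τ ^ (-A) * ς τ)) atTop atTop := by
  have hG' : 0 < |G| := abs_pos.2 hG
  set κ : ℝ → ℝ := fun τ => nonlinS (approxZ A G k τ) with hκ
  -- `q` is the square of the weight, forced by equating the two off-diagonal coefficients `2|G|
  -- τ^(-A) ς` and `κ / ς`.
  set q : ℝ → ℝ := fun τ => κ τ * τ ^ A / (2 * |G|) with hq
  have hz : ∀ᶠ τ in atTop, ‖approxZ A G k τ‖ < 1 / 4 := by
    have := (approxZ_tendsto (G := G) hA0 hA1 k).norm
    rw [norm_zero] at this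
    exact this.eventually (gt_mem_nhds (by norm_num))
  have hκ1 := tendsto_nonlinS_approxZ (G := G) hA0 hA1 k
  have hκ' := tendsto_mul_deriv_nonlinS (G := G) hA0 hA1 k
  have hpA : Tendsto (fun τ : ℝ => τ ^ A) atTop atTop := tendsto_rpow_atTop hA0
  have hpA' : Tendsto (fun τ : ℝ => τ ^ (2 - A)) atTop atTop := tendsto_rpow_atTop (by linarith)
  -- With `1/2 < κ < 2`, the last two thresholds give `1 ≤ q ≤ τ²`; the bound on `τ |κ'|` together
  -- with `A < 1` gives `|q'| ≤ 2q/τ`.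
  have hev : ∀ᶠ τ in atTop, 1 < τ ∧ ‖approxZ A G k τ‖ < 1 / 4 ∧ 1 / 2 < κ τ ∧ κ τ < 2 ∧
      τ * |deriv κ τ| < 1 / 2 ∧ 4 * |G| < τ ^ A ∧ 1 / |G| < τ ^ (2 - A) := by
    filter_upwards [eventually_gt_atTop (1 : ℝ), hz, hκ1.eventually (lt_mem_nhds one_half_lt_one),
      hκ1.eventually (gt_mem_nhds one_lt_two), hκ'.eventually (gt_mem_nhds one_half_pos),
      hpA.eventually_gt_atTop (4 * |G|), hpA'.eventually_gt_atTop (1 / |G|)] with τ h1 h2 h3 h4 h5 h6 h7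
    exact ⟨h1, h2, h3, h4, h5, h6, h7⟩
  obtain ⟨T, hT⟩ := eventually_atTop.1 hev
  have hT' : ∀ τ > max T 1, 1 < τ ∧ ‖approxZ A G k τ‖ < 1 / 4 ∧ 1 / 2 < κ τ ∧ κ τ < 2 ∧
      τ * |deriv κ τ| < 1 / 2 ∧ 4 * |G| < τ ^ A ∧ 1 / |G| < τ ^ (2 - A) :=
    fun τ hτ => hT τ ((le_max_left _ _).trans (le_of_lt hτ))
  have hκc : ∀ τ > max T 1, ContDiffAt ℝ 1 κ τ := fun τ hτ =>
    (contDiffAt_nonlinS (hT' τ hτ).2.1).comp τ ((contDiffOn_approxZ (A := A) (G := G) k).contDiffAt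
      (Ioi_mem_nhds (by linarith [(hT' τ hτ).1])))
  have hqpos : ∀ τ > max T 1, 1 ≤ q τ := fun τ hτ => by
    obtain ⟨h1, h2, h3, h4, h5, h6, h7⟩ := hT' τ hτ
    rw [hq]
    simp only
    rw [le_div_iff₀ (by positivity)]
    nlinarith
  have hqc : ∀ τ > max T 1, ContDiffAt ℝ 1 q τ := fun τ hτ =>
    ((hκc τ hτ).mul (Real.contDiffAt_rpow_const_of_ne (by linarith [(hT' τ hτ).1]))).div_const _
  refine ⟨fun τ => √(q τ), max T 1, by positivity, fun τ hτ => ?_, fun τ hτ => ?_, ?_⟩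
  · exact ((hqc τ hτ).sqrt (by linarith [hqpos τ hτ])).contDiffWithinAt
  · obtain ⟨h1, h2, h3, h4, h5, h6, h7⟩ := hT' τ hτ
    have hτ0 : 0 < τ := by linarith
    have hpp : τ ^ (2 - A) * τ ^ A = τ ^ 2 := by
      rw [← Real.rpow_add hτ0, sub_add_cancel]
      norm_cast
    have hpA0 : 0 < τ ^ A := Real.rpow_pos_of_pos hτ0 A
    refine ⟨Real.one_le_sqrt.2 (hqpos τ hτ), ?_, ?_, ?_⟩
    · refine Real.sqrt_le_iff.2 ⟨hτ0.le, ?_⟩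
      simp only [hq]
      rw [div_le_iff₀ (by positivity), ← hpp]
      rw [div_lt_iff₀ hG'] at h7
      nlinarith
    · have hdκ : HasDerivAt κ (deriv κ τ) τ := ((hκc τ hτ).differentiableAt (by norm_num)).hasDerivAt
      have hdp := Real.hasDerivAt_rpow_const (x := τ) (p := A) (Or.inl hτ0.ne')
      have hdq : HasDerivAt q ((deriv κ τ * τ ^ A + κ τ * (A * τ ^ (A - 1))) / (2 * |G|)) τ :=
        (hdκ.mul hdp).div_const (2 * |G|)
      have hd := hdq.sqrt (by linarith [hqpos τ hτ])
      have hd' : deriv (fun τ => √(q τ)) τ = _ := hd.deriv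
      have hq0 : 0 < q τ := by linarith [hqpos τ hτ]
      have hsq := Real.sq_sqrt hq0.le
      have hs0 : 0 < √(q τ) := Real.sqrt_pos.2 hq0
      rw [hd', abs_div, abs_of_pos (mul_pos two_pos hs0), div_le_iff₀ (mul_pos two_pos hs0)]
      have e1 : √(q τ) / τ * (2 * √(q τ)) = 2 * q τ / τ := by
        nth_rw 3 [← hsq]
        ring
      rw [e1]
      simp only [hq]
      rw [abs_div, abs_of_pos (by positivity : 0 < 2 * |G|), Real.rpow_sub_one hτ0.ne']
      have e2 : 2 * (κ τ * τ ^ A / (2 * |G|)) / τ = (2 * κ τ * τ ^ A / τ) / (2 * |G|) := by ring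
      rw [e2]
      gcongr
      have e3 : |deriv κ τ| * τ ^ A ≤ (1 / 2) / τ * τ ^ A := by
        gcongr
        rw [le_div_iff₀ hτ0]
        linarith
      have e4 : |κ τ * (A * (τ ^ A / τ))| ≤ κ τ * (τ ^ A / τ) := by
        rw [abs_of_pos (by positivity)]
        gcongr
        exact mul_le_of_le_one_left (by positivity) hA1.le
      have e5 : (1 / 2) / τ * τ ^ A ≤ κ τ * (τ ^ A / τ) := by
        have : (1 / 2) / τ * τ ^ A = 1 / 2 * (τ ^ A / τ) := by ring
        rw [this]
        gcongr
      calc |deriv κ τ * τ ^ A + κ τ * (A * (τ ^ A / τ))|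
          ≤ |deriv κ τ * τ ^ A| + |κ τ * (A * (τ ^ A / τ))| := abs_add_le _ _
        _ = |deriv κ τ| * τ ^ A + |κ τ * (A * (τ ^ A / τ))| := by
            rw [abs_mul, abs_of_pos hpA0]
        _ ≤ κ τ * (τ ^ A / τ) + κ τ * (τ ^ A / τ) := by linarith
        _ = 2 * κ τ * τ ^ A / τ := by ring
    · rw [Real.sq_sqrt (by linarith [hqpos τ hτ])]
      simp only [hq]
      rw [Real.rpow_neg hτ0.le]
      field_simp
      rfl
  · refine tendsto_atTop_mono' (f₁ := fun τ : ℝ => 2 * |G| * τ ^ (1 - A)) atTop ?_ ?_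
    · filter_upwards [eventually_gt_atTop (max T 1)] with τ hτ
      have hτ0 : 0 < τ := by linarith [(hT' τ hτ).1]
      have : 1 ≤ √(q τ) := Real.one_le_sqrt.2 (hqpos τ hτ)
      have e : τ * (2 * |G| * τ ^ (-A) * √(q τ)) = 2 * |G| * τ ^ (1 - A) * √(q τ) := by
        rw [show (1 : ℝ) - A = 1 + -A by ring, Real.rpow_add hτ0, Real.rpow_one]
        ring
      rw [e]
      exact le_mul_of_one_le_right (by positivity) this
    · exact (tendsto_rpow_atTop (by linarith)).const_mul_atTop (by positivity)

end

/-! ### Linearization along an approximation and existence -/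

section

open Set

variable {A G : ℝ}

/-- The data used to linearize the resonance equation along the `k`-th approximation. -/
structure LinearFrame (A G : ℝ) (k : ℕ) (ς : ℝ → ℝ) (T : ℝ) : Prop where
  one_le_T : 1 ≤ T
  contDiffOn : ContDiffOn ℝ 1 ς (Ioi T)
  one_le : ∀ τ > T, 1 ≤ ς τ
  le_self : ∀ τ > T, ς τ ≤ τ
  deriv_le : ∀ τ > T, |deriv ς τ| ≤ ς τ / τ
  balance : ∀ τ > T, 2 * |G| * τ ^ (-A) * ς τ ^ 2 = nonlinS (approxZ A G k τ)
  tendsto : Tendsto (fun τ => τ * (2 * |G| * τ ^ (-A) * ς τ)) atTop atTop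
  estimate : ∀ τ > T, ∀ b b' : ℝ × ℝ, ‖b - approxZ A G k τ‖ ≤ τ ^ (-3 : ℝ) →
    ‖b' - approxZ A G k τ‖ ≤ τ ^ (-3 : ℝ) →
    |resonanceNonlin b - resonanceNonlin b' - nonlinS (approxZ A G k τ) * (b.1 - b'.1)| ≤
      2 / τ * ‖(b.1 - b'.1, (b.2 - b'.2) / ς τ)‖ * ς τ

lemma exists_linearFrame (hA0 : 0 < A) (hA1 : A < 1) (hG : G ≠ 0) {k : ℕ} (hk : 1 ≤ k) :
    ∃ ς T, LinearFrame A G k ς T := by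
  obtain ⟨ς, T₁, hT₁, hς, hςT, hςlim⟩ := exists_weight hA0 hA1 hG k
  obtain ⟨r, K, hr, -, hK, hest⟩ := exists_resonanceNonlin_estimate
  have hz := (approxZ_tendsto (G := G) hA0 hA1 k).norm
  rw [norm_zero] at hz
  have hev : ∀ᶠ τ in atTop, 1 ≤ τ ∧ T₁ ≤ τ ∧ ‖approxZ A G k τ‖ < r / 2 ∧ τ ^ (-3 : ℝ) < r / 2 ∧
      K * τ ^ (-2 : ℝ) < 1 / 8 ∧ |nonlinV (approxZ A G k τ)| ≤ 1 / τ := by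
    have h3 : Tendsto (fun τ : ℝ => τ ^ (-3 : ℝ)) atTop (𝓝 0) :=
      tendsto_rpow_neg_atTop (by norm_num)
    have h2 : Tendsto (fun τ : ℝ => K * τ ^ (-2 : ℝ)) atTop (𝓝 0) := by
      simpa using (tendsto_rpow_neg_atTop (y := 2) (by norm_num)).const_mul K
    filter_upwards [eventually_ge_atTop (1 : ℝ), eventually_ge_atTop T₁,
      hz.eventually (gt_mem_nhds (half_pos hr)), h3.eventually (gt_mem_nhds (half_pos hr)),
      h2.eventually (gt_mem_nhds (by norm_num : (0 : ℝ) < 1 / 8)), eventually_nonlinV_le hA0 hA1 hG hk]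
      with τ a b c d e f
    exact ⟨a, b, c, d, e, f⟩
  obtain ⟨T, hT⟩ := eventually_atTop.1 hev
  have hTT := hT T le_rfl
  refine ⟨ς, T, hTT.1, hς.mono (Ioi_subset_Ioi hTT.2.1), fun τ hτ => ?_, fun τ hτ => ?_,
    fun τ hτ => ?_, fun τ hτ => ?_, hςlim, fun τ hτ b b' hb hb' => ?_⟩
  · exact (hςT τ (hTT.2.1.trans_lt hτ)).1
  · exact (hςT τ (hTT.2.1.trans_lt hτ)).2.1
  · exact (hςT τ (hTT.2.1.trans_lt hτ)).2.2.1
  · exact (hςT τ (hTT.2.1.trans_lt hτ)).2.2.2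
  · obtain ⟨h1, -, h3, h4, h5, h6⟩ := hT τ (le_of_lt hτ)
    have hς1 := (hςT τ (hTT.2.1.trans_lt hτ)).1
    have hτ0 : 0 < τ := by linarith
    have hς0 : 0 < ς τ := by linarith
    have hnear : ∀ c : ℝ × ℝ, ‖c - approxZ A G k τ‖ ≤ τ ^ (-3 : ℝ) → ‖c‖ < r := fun c hc => by
      have := norm_add_le (c - approxZ A G k τ) (approxZ A G k τ)
      rw [sub_add_cancel] at this
      linarith
    have hmain := hest (approxZ A G k τ) b b' _ (by linarith) (hnear b hb) (hnear b' hb') hb hb'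
    set n := ‖(b.1 - b'.1, (b.2 - b'.2) / ς τ)‖ with hn
    have hn0 : 0 ≤ n := norm_nonneg _
    have hp : |b.1 - b'.1| ≤ n := norm_fst_le (b.1 - b'.1, (b.2 - b'.2) / ς τ)
    have hq : |b.2 - b'.2| ≤ ς τ * n := by
      have := norm_snd_le (b.1 - b'.1, (b.2 - b'.2) / ς τ)
      rw [Real.norm_eq_abs, abs_div, abs_of_pos hς0, div_le_iff₀ hς0] at this
      linarith
    have hbb : ‖b - b'‖ ≤ ς τ * n := by
      rw [norm_prod_le_iff]
      refine ⟨?_, hq⟩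
      simp only [Prod.fst_sub, Real.norm_eq_abs]
      nlinarith
    -- Within distance `τ^(-3)` of the approximation the quadratic error is at most `1/(8τ)` per
    -- unit; with the `1/τ` from `nonlinV` this stays below `2/τ`.
    have e1 : K * τ ^ (-3 : ℝ) ≤ 1 / 8 / τ := by
      rw [show (-3 : ℝ) = -2 - 1 by norm_num, Real.rpow_sub_one hτ0.ne', ← mul_div_assoc]
      gcongr
    have e2 : K * τ ^ (-3 : ℝ) * ‖b - b'‖ ≤ 1 / 8 / τ * (ς τ * n) := by gcongr
    have e3 : |nonlinV (approxZ A G k τ) * (b.2 - b'.2)| ≤ 1 / τ * (ς τ * n) := by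
      rw [abs_mul]
      gcongr
    have e4 : 0 ≤ 1 / τ * (ς τ * n) := by positivity
    have e5 : 1 / 8 / τ * (ς τ * n) = 1 / 8 * (1 / τ * (ς τ * n)) := by ring
    have e6 : 2 / τ * n * ς τ = 2 * (1 / τ * (ς τ * n)) := by ring
    have e7 : resonanceNonlin b - resonanceNonlin b' - nonlinS (approxZ A G k τ) * (b.1 - b'.1) =
        (resonanceNonlin b - resonanceNonlin b' - (nonlinS (approxZ A G k τ) * (b.1 - b'.1) +
          nonlinV (approxZ A G k τ) * (b.2 - b'.2))) +
        nonlinV (approxZ A G k τ) * (b.2 - b'.2) := by ring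
    rw [e7, e6]
    refine (abs_add_le _ _).trans ?_
    linarith

/-- Damping, variation of the weight and nonlinear remainder add up to `1/4 + 1 + 2 = 13/4`, below
the value 4 that the exponent 16 tolerates. -/
lemma abs_perturbation_le {τ q d h n : ℝ} (hτ : 0 < τ) (hq : |q| ≤ n) (hd : |d| ≤ 1 / τ)
    (hh : |h| ≤ 2 / τ * n) : |-(q / (4 * τ)) - d * q + h| ≤ 13 / 4 / τ * n := by
  have hn : 0 ≤ n := (abs_nonneg q).trans hq
  have e1 : |q / (4 * τ)| ≤ 1 / 4 / τ * n := by
    rw [abs_div, abs_of_pos (by positivity : 0 < 4 * τ), div_le_iff₀ (by positivity)]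
    have : 1 / 4 / τ * n * (4 * τ) = n := by field_simp
    rwa [this]
  have e2 : |d * q| ≤ 1 / τ * n := by
    rw [abs_mul]
    gcongr
  have e3 : |-(q / (4 * τ)) - d * q + h| ≤ |q / (4 * τ)| + |d * q| + |h| := by
    refine (abs_add_le _ _).trans (add_le_add_left ?_ _)
    refine (abs_sub _ _).trans ?_
    rw [abs_neg]
  refine e3.trans ((add_le_add (add_le_add e1 e2) hh).trans (le_of_eq ?_))
  ring

/-- `(S, v)` solves the resonance equation in the form of a planar system on `τ > T`. -/
def SolvesPlanar (A G : ℝ) (S v : ℝ → ℝ) (T : ℝ) : Prop :=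
  ∀ τ > T, HasDerivAt S (-((1 + S τ) / (2 * τ)) - 2 * G * τ ^ (-A) * v τ) τ ∧
    HasDerivAt v (-(v τ / (4 * τ)) - G * τ ^ (-A) + resonanceNonlin (S τ, v τ)) τ

/-- The sign of the forcing decides the type of the linearized system: hyperbolic for `ε = 1`,
rotating for `ε = -1`. -/
lemma exists_sign (G : ℝ) : ∃ ε : ℝ, (ε = 1 ∨ ε = -1) ∧ ε * |G| = -G := by
  rcases le_total 0 G with h | h
  · exact ⟨-1, Or.inr rfl, by rw [abs_of_nonneg h]; ring⟩
  · exact ⟨1, Or.inl rfl, by rw [abs_of_nonpos h]; ring⟩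

lemma continuousOn_residualS (k : ℕ) : ContinuousOn (residualS A G k) (Ioi 0) := by
  have h1 : ContDiffOn ℝ 1 (approxS A G k) (Ioi 0) := contDiffOn_powerEval A _
  have h2 : ContDiffOn ℝ 1 (approxV A G k) (Ioi 0) := contDiffOn_powerEval A _
  have hp : ContinuousOn (fun τ : ℝ => τ ^ (-A)) (Ioi 0) := fun τ hτ =>
    (Real.continuousAt_rpow_const τ (-A) (Or.inl (ne_of_gt hτ))).continuousWithinAt
  refine ((h1.continuousOn_deriv_of_isOpen isOpen_Ioi le_rfl).add ?_).add ?_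
  · exact (continuousOn_const.add h1.continuousOn).div (continuousOn_const.mul continuousOn_id)
      fun τ hτ => (mul_pos two_pos hτ).ne'
  · exact (continuousOn_const.mul hp).mul h2.continuousOn

lemma continuousOn_residualV (k : ℕ) : ContinuousOn (residualV A G k) (Ioi 0) := by
  have h1 : ContDiffOn ℝ 1 (approxS A G k) (Ioi 0) := contDiffOn_powerEval A _
  have h2 : ContDiffOn ℝ 1 (approxV A G k) (Ioi 0) := contDiffOn_powerEval A _
  have hp : ContinuousOn (fun τ : ℝ => τ ^ (-A)) (Ioi 0) := fun τ hτ =>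
    (Real.continuousAt_rpow_const τ (-A) (Or.inl (ne_of_gt hτ))).continuousWithinAt
  refine (((h2.continuousOn_deriv_of_isOpen isOpen_Ioi le_rfl).add ?_).add ?_).sub ?_
  · exact h2.continuousOn.div (continuousOn_const.mul continuousOn_id)
      fun τ hτ => (mul_pos (by norm_num : (0 : ℝ) < 4) hτ).ne'
  · exact continuousOn_const.mul hp
  · exact continuous_resonanceNonlin.comp_continuousOn (h1.continuousOn.prodMk h2.continuousOn)

lemma eventually_le_rpow {f : ℝ → ℝ} {a b : ℝ} (hf : f =O[atTop] fun τ : ℝ => τ ^ a) (hab : a < b) :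
    ∀ᶠ τ in atTop, |f τ| ≤ τ ^ b := by
  have := (hf.trans_isLittleO (rpow_isLittleO_rpow hab)).bound one_pos
  filter_upwards [this, eventually_gt_atTop (0 : ℝ)] with τ h hτ
  rwa [one_mul, Real.norm_eq_abs, Real.norm_of_nonneg (Real.rpow_nonneg hτ.le _)] at h

lemma norm_scaled_le {s p q B : ℝ} (hs : 1 ≤ s) (h : ‖(p, q)‖ ≤ B) : ‖(p, s * q)‖ ≤ s * B := by
  have hp : |p| ≤ B := (norm_fst_le (p, q)).trans h
  have hq : |q| ≤ B := (norm_snd_le (p, q)).trans h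
  have hB : 0 ≤ B := (abs_nonneg p).trans hp
  rw [norm_prod_le_iff]
  constructor
  · simp only [Real.norm_eq_abs]
    nlinarith
  · simp only [Real.norm_eq_abs]
    rw [abs_mul, abs_of_pos (by linarith)]
    gcongr

lemma mul_rpow_le {τ s : ℝ} (hτ : 1 ≤ τ) (hs : s ≤ τ) : s * τ ^ (-16 : ℝ) ≤ τ ^ (-3 : ℝ) := by
  have hτ0 : 0 < τ := by linarith
  have h1 : τ * τ ^ (-16 : ℝ) = τ ^ (-15 : ℝ) := by
    rw [← Real.rpow_one_add' hτ0.le (by norm_num)]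
    norm_num
  have h2 : τ ^ (-15 : ℝ) ≤ τ ^ (-3 : ℝ) := Real.rpow_le_rpow_of_exponent_le hτ (by norm_num)
  have h3 : s * τ ^ (-16 : ℝ) ≤ τ * τ ^ (-16 : ℝ) := by gcongr
  linarith

/-- Existence of a solution close to a good approximation. -/
lemma LinearFrame.exists_solution (hA0 : 0 < A) (hA1 : A < 1) (hG : G ≠ 0) {k : ℕ}
    (hk : 18 ≤ k * min A (1 - A)) {ς : ℝ → ℝ} {T₀ : ℝ} (hf : LinearFrame A G k ς T₀) :
    ∃ S v : ℝ → ℝ, ∃ T ≥ T₀, SolvesPlanar A G S v T ∧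
      ∀ τ > T, ‖(S τ - approxS A G k τ, (v τ - approxV A G k τ) / ς τ)‖ ≤ τ ^ (-16 : ℝ) := by
  obtain ⟨ε, hε, hεG⟩ := exists_sign G
  set ω : ℝ → ℝ := fun τ => 2 * |G| * τ ^ (-A) * ς τ with hω
  -- Residuals of order `τ^(-18)` are eventually below `τ^(-17) = τ^(-1-M)` with `M = 16`, with
  -- constant 1; the last condition is `2M ≤ τ ω`.
  have hev : ∀ᶠ τ in atTop, T₀ < τ ∧ |residualS A G k τ| ≤ τ ^ (-17 : ℝ) ∧
      |residualV A G k τ| ≤ τ ^ (-17 : ℝ) ∧ 2 * 16 ≤ τ * ω τ := by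
    filter_upwards [eventually_gt_atTop T₀,
      eventually_le_rpow (b := -17) (residualS_isBigO hA0 hA1 hG k) (by linarith),
      eventually_le_rpow (b := -17) (residualV_isBigO (G := G) hA0 hA1 k) (by linarith),
      hf.tendsto.eventually_ge_atTop (2 * 16)] with τ a b c d
    exact ⟨a, b, c, d⟩
  obtain ⟨T, hT⟩ := eventually_atTop.1 hev
  have hT₀ : T₀ < T := (hT T le_rfl).1
  have hlt : ∀ τ ≥ T, T₀ < τ := fun τ hτ => hT₀.trans_le hτ
  have hpos : ∀ τ ≥ T, 0 < τ := fun τ hτ => by linarith [hf.one_le_T, hlt τ hτ]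
  have hsub0 : Ici T ⊆ Ioi 0 := hpos
  have hsubT : Ici T ⊆ Ioi T₀ := hlt
  set κ : ℝ → ℝ := fun τ => nonlinS (approxZ A G k τ) with hκ
  -- The equations for `S = S_k + w₁`, `v = V_k + ς w₂` minus the balanced linear part. The term
  -- `deriv ς / ς` comes from differentiating the weight.
  set F : ℝ → ℝ × ℝ → ℝ × ℝ := fun τ w =>
    (-(w.1 / (2 * τ)) - residualS A G k τ,
      -(w.2 / (4 * τ)) - deriv ς τ / ς τ * w.2 +
        (resonanceNonlin (approxS A G k τ + w.1, approxV A G k τ + ς τ * w.2) -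
          resonanceNonlin (approxS A G k τ, approxV A G k τ) -
          ς τ * ω τ * w.1) / ς τ - residualV A G k τ / ς τ) with hF
  have hbal : ∀ τ ≥ T, ς τ * ω τ = κ τ := fun τ hτ => by
    simp only [hκ]
    rw [← hf.balance τ (hlt τ hτ)]
    simp only [hω]
    ring
  have hς0 : ∀ τ ≥ T, 0 < ς τ := fun τ hτ => by linarith [hf.one_le τ (hlt τ hτ)]
  have hpc : ContinuousOn (fun τ : ℝ => τ ^ (-A)) (Ici T) := fun τ hτ =>
    (Real.continuousAt_rpow_const τ (-A) (Or.inl (ne_of_gt (hpos τ hτ)))).continuousWithinAt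
  have hςc : ContinuousOn ς (Ici T) := hf.contDiffOn.continuousOn.mono hsubT
  have hςd : ContinuousOn (deriv ς) (Ici T) :=
    (hf.contDiffOn.continuousOn_deriv_of_isOpen isOpen_Ioi le_rfl).mono hsubT
  have hωc : ContinuousOn ω (Ici T) := (continuousOn_const.mul hpc).mul hςc
  have hSc : ContinuousOn (approxS A G k) (Ici T) :=
    (contDiffOn_powerEval A _).continuousOn.mono hsub0
  have hVc : ContinuousOn (approxV A G k) (Ici T) :=
    (contDiffOn_powerEval A _).continuousOn.mono hsub0
  have hr1 : ContinuousOn (residualS A G k) (Ici T) := (continuousOn_residualS k).mono hsub0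
  have hr2 : ContinuousOn (residualV A G k) (Ici T) := (continuousOn_residualV k).mono hsub0
  have hFc : ContinuousOn (fun p : ℝ × (ℝ × ℝ) => F p.1 p.2) (Ici T ×ˢ univ) := by
    have lift : ∀ {u : ℝ → ℝ}, ContinuousOn u (Ici T) →
        ContinuousOn (fun p : ℝ × (ℝ × ℝ) => u p.1) (Ici T ×ˢ univ) := fun hu =>
      hu.comp continuousOn_fst fun p hp => hp.1
    have w1 : ContinuousOn (fun p : ℝ × (ℝ × ℝ) => p.2.1) (Ici T ×ˢ univ) := by fun_prop
    have w2 : ContinuousOn (fun p : ℝ × (ℝ × ℝ) => p.2.2) (Ici T ×ˢ univ) := by fun_prop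
    have t1 : ContinuousOn (fun p : ℝ × (ℝ × ℝ) => p.1) (Ici T ×ˢ univ) := continuousOn_fst
    have hne : ∀ p ∈ Ici T ×ˢ (univ : Set (ℝ × ℝ)), ς p.1 ≠ 0 := fun p hp => (hς0 _ hp.1).ne'
    refine ContinuousOn.prodMk ?_ ?_
    · exact ((w1.div (continuousOn_const.mul t1)
        fun p hp => (mul_pos two_pos (hpos _ hp.1)).ne').neg).sub (lift hr1)
    · refine ((((w2.div (continuousOn_const.mul t1)
        fun p hp => (mul_pos (by norm_num : (0 : ℝ) < 4) (hpos _ hp.1)).ne').neg).sub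
        (((lift hςd).div (lift hςc) hne).mul w2)).add (ContinuousOn.div ?_ (lift hςc) hne)).sub
        ((lift hr2).div (lift hςc) hne)
      refine (ContinuousOn.sub ?_ ?_).sub (((lift hςc).mul (lift hωc)).mul w1)
      · exact continuous_resonanceNonlin.comp_continuousOn
          (((lift hSc).add w1).prodMk ((lift hVc).add ((lift hςc).mul w2)))
      · exact continuous_resonanceNonlin.comp_continuousOn ((lift hSc).prodMk (lift hVc))
  have hF0 : ∀ τ ≥ T, ‖F τ 0‖ ≤ τ ^ (-1 - 16 : ℝ) := by
    intro τ hτ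
    obtain ⟨-, h1, h2, -⟩ := hT τ hτ
    rw [show (-1 - 16 : ℝ) = -17 by norm_num, norm_prod_le_iff]
    constructor
    · simpa [hF] using h1
    · simp only [hF, Prod.snd_zero, Prod.fst_zero, zero_div, mul_zero, add_zero, sub_self,
        neg_zero, zero_sub, Real.norm_eq_abs, abs_neg]
      rw [abs_div, abs_of_pos (hς0 τ hτ)]
      exact (div_le_self (abs_nonneg _) (hf.one_le τ (hlt τ hτ))).trans h2
  have hFL : ∀ τ ≥ T, ∀ w w', ‖w‖ ≤ τ ^ (-16 : ℝ) → ‖w'‖ ≤ τ ^ (-16 : ℝ) →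
      ‖F τ w - F τ w'‖ ≤ 4 / τ * ‖w - w'‖ := by
    intro τ hτ w w' hw hw'
    have hτ0 := hpos τ hτ
    have hn := norm_nonneg (w - w')
    have near : ∀ u : ℝ × ℝ, ‖u‖ ≤ τ ^ (-16 : ℝ) →
        ‖(approxS A G k τ + u.1, approxV A G k τ + ς τ * u.2) - approxZ A G k τ‖ ≤
          τ ^ (-3 : ℝ) := fun u hu => by
      have h1 := norm_scaled_le (p := u.1) (q := u.2) (hf.one_le τ (hlt τ hτ)) hu
      have h2 := mul_rpow_le (by linarith [hf.one_le_T, hlt τ hτ]) (hf.le_self τ (hlt τ hτ))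
      simpa [approxZ] using h1.trans h2
    have hest := hf.estimate τ (hlt τ hτ) _ _ (near w hw) (near w' hw')
    have hς := hς0 τ hτ
    simp only [add_sub_add_left_eq_sub, ← mul_sub, mul_div_cancel_left₀ _ hς.ne'] at hest
    have hp1 : ‖w.1 - w'.1‖ ≤ ‖w - w'‖ := norm_fst_le (w - w')
    have hp2 : |w.2 - w'.2| ≤ ‖w - w'‖ := norm_snd_le (w - w')
    rw [norm_prod_le_iff]
    constructor
    · have : (F τ w - F τ w').1 = -((w.1 - w'.1) / (2 * τ)) := by
        simp only [hF, Prod.fst_sub]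
        ring
      rw [this, norm_neg, norm_div, Real.norm_of_nonneg (by positivity : 0 ≤ 2 * τ),
        div_le_iff₀ (by positivity)]
      have : 4 / τ * ‖w - w'‖ * (2 * τ) = 8 * ‖w - w'‖ := by field_simp; ring
      rw [this]
      linarith
    · have : (F τ w - F τ w').2 = -((w.2 - w'.2) / (4 * τ)) - deriv ς τ / ς τ * (w.2 - w'.2) +
          (resonanceNonlin (approxS A G k τ + w.1, approxV A G k τ + ς τ * w.2) -
            resonanceNonlin (approxS A G k τ + w'.1, approxV A G k τ + ς τ * w'.2) -
            κ τ * (w.1 - w'.1)) / ς τ := by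
        rw [← hbal τ hτ]
        simp only [hF, Prod.snd_sub]
        ring
      rw [this, Real.norm_eq_abs]
      refine (abs_perturbation_le hτ0 hp2 ?_ ?_).trans ?_
      · rw [abs_div, abs_of_pos hς, div_le_iff₀ hς, one_div_mul_eq_div]
        exact hf.deriv_le τ (hlt τ hτ)
      · rw [abs_div, abs_of_pos hς, div_le_iff₀ hς]
        exact hest
      · gcongr
        norm_num
  obtain ⟨P, Q, hPQ⟩ := exists_decaying_solution (hpos T le_rfl) (M := 16) (ℓ := 4) (by norm_num)
    (by norm_num) (by norm_num) hωc (fun τ hτ => by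
      have := hς0 τ hτ
      have := hpos τ hτ
      positivity) (fun τ hτ => (hT τ hτ).2.2.2) hε hFc hF0 hFL
  refine ⟨fun τ => approxS A G k τ + P τ, fun τ => approxV A G k τ + ς τ * Q τ, T, hT₀.le,
    fun τ hτ => ?_, fun τ hτ => ?_⟩
  · have hτ0 := hpos τ (le_of_lt hτ)
    have hς := hς0 τ (le_of_lt hτ)
    obtain ⟨hP, hQ, -⟩ := hPQ τ hτ
    have hςd' : HasDerivAt ς (deriv ς τ) τ := ((hf.contDiffOn.contDiffAt
      (Ioi_mem_nhds (hlt τ (le_of_lt hτ)))).differentiableAt (by norm_num)).hasDerivAt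
    constructor
    · refine ((differentiableAt_approxS G k hτ0).hasDerivAt.add hP).congr_deriv ?_
      have : ε * ω τ = -(2 * G * τ ^ (-A) * ς τ) := by
        simp only [hω]
        linear_combination 2 * τ ^ (-A) * ς τ * hεG
      rw [this]
      simp only [hF, residualS]
      ring
    · refine ((differentiableAt_approxV G k hτ0).hasDerivAt.add (hςd'.mul hQ)).congr_deriv ?_
      simp only [hF, residualV]
      field_simp
      ring
  · have hς := hς0 τ (le_of_lt hτ)
    simpa [mul_div_cancel_left₀ _ hς.ne'] using (hPQ τ hτ).2.2

end

/-! ### Comparison with all later approximations -/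

section

open Set

variable {A G : ℝ}

/-- A solution close to one approximation is close to all later approximations, to any order. -/
lemma LinearFrame.isBigO_sub_approx (hA0 : 0 < A) (hA1 : A < 1) (hG : G ≠ 0) {k : ℕ}
    (hk : 18 ≤ k * min A (1 - A)) {ς : ℝ → ℝ} {T₀ : ℝ} (hf : LinearFrame A G k ς T₀)
    {S v : ℝ → ℝ} {T : ℝ} (hT : T₀ ≤ T) (hSv : SolvesPlanar A G S v T)
    (hclose : ∀ τ > T, ‖(S τ - approxS A G k τ, (v τ - approxV A G k τ) / ς τ)‖ ≤ τ ^ (-16 : ℝ))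
    {N : ℝ} (hN : 16 ≤ N) {l : ℕ} (hkl : k ≤ l) (hl : N + 2 ≤ l * min A (1 - A)) :
    (fun τ => S τ - approxS A G l τ) =O[atTop] (fun τ : ℝ => τ ^ (-N)) ∧
      (fun τ => v τ - approxV A G l τ) =O[atTop] fun τ : ℝ => τ ^ (1 - N) := by
  obtain ⟨ε, hε, hεG⟩ := exists_sign G
  set ω : ℝ → ℝ := fun τ => 2 * |G| * τ ^ (-A) * ς τ with hω
  have hev : ∀ᶠ τ in atTop, T ≤ τ ∧ |residualS A G l τ| ≤ τ ^ (-1 - N) ∧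
      |residualV A G l τ| ≤ τ ^ (-1 - N) ∧ 2 * N ≤ τ * ω τ ∧
      |approxS A G l τ - approxS A G k τ| ≤ τ ^ (-16 : ℝ) ∧
      |approxV A G l τ - approxV A G k τ| ≤ τ ^ (-16 : ℝ) := by
    filter_upwards [eventually_ge_atTop T,
      eventually_le_rpow (b := -1 - N) (residualS_isBigO hA0 hA1 hG l) (by linarith),
      eventually_le_rpow (b := -1 - N) (residualV_isBigO (G := G) hA0 hA1 l) (by linarith),
      hf.tendsto.eventually_ge_atTop (2 * N),
      eventually_le_rpow (b := -16) (approxS_sub_isBigO G hA0 hA1 hkl) (by linarith),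
      eventually_le_rpow (b := -16) (approxV_sub_isBigO G hA0 hA1 hkl) (by linarith)]
      with τ a b c d e f
    exact ⟨a, b, c, d, e, f⟩
  obtain ⟨T₁, hT₁⟩ := eventually_atTop.1 hev
  have hTT₁ : T ≤ T₁ := (hT₁ T₁ le_rfl).1
  have hltT : ∀ τ > T₁, T < τ := fun τ hτ => hTT₁.trans_lt hτ
  have hlt : ∀ τ > T₁, T₀ < τ := fun τ hτ => hT.trans_lt (hltT τ hτ)
  have hone : ∀ τ > T₁, 1 ≤ τ := fun τ hτ => by linarith [hf.one_le_T, hlt τ hτ]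
  have hpos : ∀ τ > T₁, 0 < τ := fun τ hτ => by linarith [hone τ hτ]
  have hς1 : ∀ τ > T₁, 1 ≤ ς τ := fun τ hτ => hf.one_le τ (hlt τ hτ)
  have hς0 : ∀ τ > T₁, 0 < ς τ := fun τ hτ => by linarith [hς1 τ hτ]
  have hbal : ∀ τ > T₁, ς τ * ω τ = nonlinS (approxZ A G k τ) := fun τ hτ => by
    rw [← hf.balance τ (hlt τ hτ)]
    simp only [hω]
    ring
  have hωc : ContinuousOn ω (Ioi T₁) := by
    refine ContinuousOn.mul (continuousOn_const.mul fun τ hτ =>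
      (Real.continuousAt_rpow_const τ (-A) (Or.inl (ne_of_gt (hpos τ hτ)))).continuousWithinAt) ?_
    exact hf.contDiffOn.continuousOn.mono hlt
  set P : ℝ → ℝ := fun τ => S τ - approxS A G l τ with hP
  set Q : ℝ → ℝ := fun τ => (v τ - approxV A G l τ) / ς τ with hQ
  set f : ℝ → ℝ := fun τ => -(P τ / (2 * τ)) - residualS A G l τ with hfdef
  -- The difference is taken from the `l`-th approximation, but the linear coefficient stays at the
  -- `k`-th. The same `ς`, `ω` and remainder constant then serve all `N`.
  set h : ℝ → ℝ := fun τ => (resonanceNonlin (S τ, v τ) - resonanceNonlin (approxZ A G l τ) -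
    nonlinS (approxZ A G k τ) * (S τ - approxS A G l τ)) / ς τ with hh
  set g : ℝ → ℝ := fun τ => -(Q τ / (4 * τ)) - deriv ς τ / ς τ * Q τ + h τ -
    residualV A G l τ / ς τ with hgdef
  have hPd : ∀ τ > T₁, HasDerivAt P (ε * ω τ * Q τ + f τ) τ := fun τ hτ => by
    refine ((hSv τ (hltT τ hτ)).1.sub
      (differentiableAt_approxS G l (hpos τ hτ)).hasDerivAt).congr_deriv ?_
    have : ε * ω τ = -(2 * G * τ ^ (-A) * ς τ) := by
      simp only [hω]
      linear_combination 2 * τ ^ (-A) * ς τ * hεG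
    rw [this]
    have := hς0 τ hτ
    simp only [hfdef, hP, hQ, residualS]
    field_simp
    ring
  have hQd : ∀ τ > T₁, HasDerivAt Q (ω τ * P τ + g τ) τ := fun τ hτ => by
    have hςd : HasDerivAt ς (deriv ς τ) τ := ((hf.contDiffOn.contDiffAt
      (Ioi_mem_nhds (hlt τ hτ))).differentiableAt (by norm_num)).hasDerivAt
    have hς := hς0 τ hτ
    refine (((hSv τ (hltT τ hτ)).2.sub
      (differentiableAt_approxV G l (hpos τ hτ)).hasDerivAt).div hςd hς.ne').congr_deriv ?_
    have hτ0 := hpos τ hτ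
    simp only [hgdef, hP, hQ, hh, residualV, Pi.sub_apply]
    rw [← hbal τ hτ]
    simp only [approxZ]
    field_simp
    ring
  have hnear : ∀ τ > T₁, ‖(S τ, v τ) - approxZ A G k τ‖ ≤ τ ^ (-3 : ℝ) ∧
      ‖approxZ A G l τ - approxZ A G k τ‖ ≤ τ ^ (-3 : ℝ) := fun τ hτ => by
    constructor
    · have h1 := norm_scaled_le (hς1 τ hτ) (hclose τ (hltT τ hτ))
      rw [mul_div_cancel₀ _ (hς0 τ hτ).ne'] at h1
      exact h1.trans (mul_rpow_le (hone τ hτ) (hf.le_self τ (hlt τ hτ)))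
    · obtain ⟨-, -, -, -, h5, h6⟩ := hT₁ τ (le_of_lt hτ)
      have h7 := mul_rpow_le (hone τ hτ) (hone τ hτ)
      rw [one_mul] at h7
      rw [norm_prod_le_iff]
      exact ⟨h5.trans h7, h6.trans h7⟩
  have hfg : ∀ τ > T₁, ‖(f τ, g τ)‖ ≤ 4 / τ * ‖(P τ, Q τ)‖ + 1 * τ ^ (-1 - N) := by
    intro τ hτ
    obtain ⟨-, h1, h2, -, -, -⟩ := hT₁ τ (le_of_lt hτ)
    have hτ0 := hpos τ hτ
    have hς := hς0 τ hτ
    have hn := norm_nonneg (P τ, Q τ)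
    have hp1 : |P τ| ≤ ‖(P τ, Q τ)‖ := norm_fst_le (P τ, Q τ)
    have hp2 : |Q τ| ≤ ‖(P τ, Q τ)‖ := norm_snd_le (P τ, Q τ)
    have hest := hf.estimate τ (hlt τ hτ) _ _ (hnear τ hτ).1 (hnear τ hτ).2
    rw [one_mul, norm_prod_le_iff]
    constructor
    · refine (norm_sub_le _ _).trans (add_le_add ?_ h1)
      rw [norm_neg, norm_div, Real.norm_of_nonneg (by positivity : 0 ≤ 2 * τ),
        div_le_iff₀ (by positivity)]
      have : 4 / τ * ‖(P τ, Q τ)‖ * (2 * τ) = 8 * ‖(P τ, Q τ)‖ := by field_simp; ring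
      rw [this, Real.norm_eq_abs]
      linarith
    · refine (norm_sub_le _ _).trans (add_le_add ?_ ?_)
      · refine (abs_perturbation_le hτ0 hp2 ?_ ?_).trans ?_
        · rw [abs_div, abs_of_pos hς, div_le_iff₀ hς, one_div_mul_eq_div]
          exact hf.deriv_le τ (hlt τ hτ)
        · simp only [hh]
          rw [abs_div, abs_of_pos hς, div_le_iff₀ hς]
          exact hest
        · gcongr
          norm_num
      · rw [Real.norm_eq_abs, abs_div, abs_of_pos hς]
        exact (div_le_self (abs_nonneg _) (hς1 τ hτ)).trans h2
  have h0 : ∀ τ > T₁, ‖(P τ, Q τ)‖ ≤ 2 * τ ^ (-16 : ℝ) := by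
    intro τ hτ
    obtain ⟨-, -, -, -, h5, h6⟩ := hT₁ τ (le_of_lt hτ)
    have e1 : (P τ, Q τ) = (S τ - approxS A G k τ, (v τ - approxV A G k τ) / ς τ) -
        (approxS A G l τ - approxS A G k τ, (approxV A G l τ - approxV A G k τ) / ς τ) := by
      simp only [hP, hQ, Prod.mk_sub_mk]
      congr 1 <;> ring
    rw [e1, two_mul]
    refine (norm_sub_le _ _).trans (add_le_add (hclose τ (hltT τ hτ)) ?_)
    rw [norm_prod_le_iff]
    refine ⟨h5, ?_⟩
    simp only [Real.norm_eq_abs]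
    rw [abs_div, abs_of_pos (hς0 τ hτ)]
    exact (div_le_self (abs_nonneg _) (hς1 τ hτ)).trans h6
  have hT₁0 : 0 < T₁ := by linarith [hf.one_le_T]
  obtain ⟨C, hC⟩ := decay_of_decaying_solution hT₁0 (M := 16) (N := N) (K := 4) (C := 1)
    (by norm_num) hN (by norm_num) (by norm_num) zero_le_one hωc (fun τ hτ => by
      have := hς0 τ hτ
      have := hpos τ hτ
      positivity) (fun τ hτ => (hT₁ τ (le_of_lt hτ)).2.2.2.1) hε hPd hQd hfg h0
  constructor
  · refine IsBigO.of_bound C ?_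
    filter_upwards [eventually_gt_atTop (T₁ + 1)] with τ hτ
    have hτ1 : T₁ < τ := by linarith
    rw [Real.norm_of_nonneg (Real.rpow_nonneg (hpos τ hτ1).le _)]
    exact (norm_fst_le (P τ, Q τ)).trans (hC τ hτ)
  · refine IsBigO.of_bound C ?_
    filter_upwards [eventually_gt_atTop (T₁ + 1)] with τ hτ
    have hτ1 : T₁ < τ := by linarith
    have hτ0 := hpos τ hτ1
    have hς := hς0 τ hτ1
    rw [Real.norm_of_nonneg (Real.rpow_nonneg hτ0.le _)]
    have h1 : ‖Q τ‖ ≤ C * τ ^ (-N) := (norm_snd_le (P τ, Q τ)).trans (hC τ hτ)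
    have h2 : v τ - approxV A G l τ = ς τ * Q τ := by
      simp only [hQ]
      rw [mul_div_cancel₀ _ hς.ne']
    have h3 : τ ^ (1 - N) = τ * τ ^ (-N) := by
      rw [sub_eq_add_neg, Real.rpow_add hτ0, Real.rpow_one]
    rw [h2, h3, norm_mul, Real.norm_of_nonneg hς.le]
    calc ς τ * ‖Q τ‖ ≤ τ * (C * τ ^ (-N)) := by
          refine mul_le_mul (hf.le_self τ (hlt τ hτ1)) h1 (norm_nonneg _) hτ0.le
      _ = C * (τ * τ ^ (-N)) := by ring

/-- There is a solution of the planar system which is asymptotic to the formal solution. -/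
theorem exists_planar_solution (hA0 : 0 < A) (hA1 : A < 1) (hG : G ≠ 0) :
    ∃ S v : ℝ → ℝ, ∃ T > 0, SolvesPlanar A G S v T ∧
      IsFormalExpansion A (formalS A G) (fun τ => S τ * τ ^ A) ∧
      IsFormalExpansion A (formalV A G) (fun τ => v τ * τ ^ (1 - A)) := by
  have hd : 0 < min A (1 - A) := lt_min hA0 (by linarith)
  obtain ⟨k, hk⟩ := exists_nat_ge (18 / min A (1 - A))
  rw [div_le_iff₀ hd] at hk
  have hk1 : 1 ≤ k := by
    rcases Nat.eq_zero_or_pos k with rfl | h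
    · norm_num at hk
    · exact h
  obtain ⟨ς, T₀, hf⟩ := exists_linearFrame hA0 hA1 hG hk1
  obtain ⟨S, v, T, hT, hSv, hclose⟩ := hf.exists_solution hA0 hA1 hG hk
  have key : ∀ m : ℕ, ∃ l ≥ m,
      (fun τ => S τ - approxS A G l τ) =O[atTop] (fun τ : ℝ => τ ^ (-(m : ℝ) - 1)) ∧
      (fun τ => v τ - approxV A G l τ) =O[atTop] fun τ : ℝ => τ ^ (-(m : ℝ) - 1) := by
    intro m
    -- Taking `N = m + 18` leaves room for the factor `τ` lost in `v` through the weight and for the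
    -- later multiplication by `τ^A` or `τ^(1-A)`.
    obtain ⟨l, hl⟩ := exists_nat_ge (((m : ℝ) + 18 + 2) / min A (1 - A))
    rw [div_le_iff₀ hd] at hl
    have hl' : (m : ℝ) + 18 + 2 ≤ (max l (max k m) : ℕ) * min A (1 - A) :=
      hl.trans (by gcongr; exact le_max_left _ _)
    have hN : (16 : ℝ) ≤ m + 18 := by
      have := Nat.cast_nonneg (α := ℝ) m
      linarith
    have := hf.isBigO_sub_approx hA0 hA1 hG hk hT hSv hclose hN
      ((le_max_left k m).trans (le_max_right l _)) hl'
    exact ⟨_, (le_max_right k m).trans (le_max_right l _),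
      this.1.trans (rpow_isBigO_rpow (by linarith)), this.2.trans (rpow_isBigO_rpow (by linarith))⟩
  have hdm : ∀ m : ℕ, (m : ℝ) * min A (1 - A) ≤ m := fun m =>
    mul_le_of_le_one_right (Nat.cast_nonneg m) ((min_le_left _ _).trans hA1.le)
  refine ⟨S, v, T, by linarith [hf.one_le_T], hSv, ?_, ?_⟩
  · refine IsFormalExpansion.of_frequently hA0 hA1 (fun k => (formalIterate_sub_mem A G k).1)
      fun m => ?_
    obtain ⟨l, hlm, h1, -⟩ := key m
    refine ⟨l, hlm, ?_⟩
    have h2 := (h1.mul (isBigO_refl (fun τ : ℝ => τ ^ A) atTop)).trans_eventuallyEq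
      (g₂ := fun τ : ℝ => τ ^ (-(m : ℝ) - 1 + A)) (by
        filter_upwards [eventually_gt_atTop (0 : ℝ)] with τ hτ
        rw [← Real.rpow_add hτ])
    refine (h2.congr' ?_ EventuallyEq.rfl).trans (rpow_isBigO_rpow (by linarith [hdm m]))
    filter_upwards [eventually_gt_atTop (0 : ℝ)] with τ hτ
    have : τ ^ (-A) * τ ^ A = 1 := by rw [← Real.rpow_add hτ]; simp
    simp only [approxS, powerEval_mul, powerEval_X_one]
    linear_combination -(powerEval A (formalS A G l) τ) * this
  · refine IsFormalExpansion.of_frequently hA0 hA1 (fun k => (formalIterate_sub_mem A G k).2.1)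
      fun m => ?_
    obtain ⟨l, hlm, -, h1⟩ := key m
    refine ⟨l, hlm, ?_⟩
    have h2 := (h1.mul (isBigO_refl (fun τ : ℝ => τ ^ (1 - A)) atTop)).trans_eventuallyEq
      (g₂ := fun τ : ℝ => τ ^ (-(m : ℝ) - 1 + (1 - A))) (by
        filter_upwards [eventually_gt_atTop (0 : ℝ)] with τ hτ
        rw [← Real.rpow_add hτ])
    refine (h2.congr' ?_ EventuallyEq.rfl).trans (rpow_isBigO_rpow (by linarith [hdm m]))
    filter_upwards [eventually_gt_atTop (0 : ℝ)] with τ hτ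
    have : τ ^ (-(1 - A)) * τ ^ (1 - A) = 1 := by rw [← Real.rpow_add hτ]; simp
    simp only [approxV, powerEval_mul, powerEval_X_zero]
    linear_combination -(powerEval A (formalV A G l) τ) * this

end

/-! ### Back to amplitude and phase -/

section

open Set

variable {A : ℝ}

lemma IsFormalExpansion.of_mul_rpow (hA0 : 0 < A) (hA1 : A < 1) {p : ℕ → MvPolynomial (Fin 2) ℝ}
    {g : ℝ → ℝ} {i : Fin 2} {s : ℝ}
    (hi : ∀ τ > 0, powerEval A (MvPolynomial.X i) τ * τ ^ s = 1)
    (hg : IsFormalExpansion A p (fun τ => g τ * τ ^ s)) :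
    IsFormalExpansion A (fun k => MvPolynomial.X i * p k) g := by
  refine ((isFormalExpansion_powerEval (MvPolynomial.X i)).mul hA0 hA1 hg).congr ?_
  filter_upwards [eventually_gt_atTop (0 : ℝ)] with τ hτ
  linear_combination g τ * hi τ hτ

/-- Composition with a smooth function which vanishes at `0` preserves expansions with a
prefactor. -/
lemma IsFormalExpansion.exists_comp_mul_rpow (hA0 : 0 < A) (hA1 : A < 1)
    {p : ℕ → MvPolynomial (Fin 2) ℝ} {g : ℝ → ℝ} {i : Fin 2} {s : ℝ}
    (hi : ∀ τ > 0, powerEval A (MvPolynomial.X i) τ * τ ^ s = 1)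
    (hg : IsFormalExpansion A p (fun τ => g τ * τ ^ s))
    {f : ℝ → ℝ} {r : ℝ} (hr : 0 < r) (hf : ContDiffOn ℝ (⊤ : ℕ∞) f (Ioo (-r) r)) (hf0 : f 0 = 0) :
    ∃ q : ℕ → MvPolynomial (Fin 2) ℝ, IsFormalExpansion A q (fun τ => f (g τ) * τ ^ s) ∧
      (q 1).coeff 0 = (p 1).coeff 0 * deriv f 0 := by
  obtain ⟨c, hc0, hc1, hc⟩ := exists_taylor_coeff hr hf
  -- Factoring `f (g τ) = g τ * q (g τ)` leaves the prefactor on `g`, whose rescaled expansion is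
  -- known, while `q` is composed with the small quantity `g`.
  obtain ⟨q, hq, hqc⟩ := exists_slope_taylor (hc0.trans hf0) hf0 hc
  have h1 := (hg.of_mul_rpow hA0 hA1 hi).comp_smooth hA0 hA1
    (fun k => Ideal.mul_mem_right _ _ (X_mem_varIdeal i)) hqc
  refine ⟨_, (hg.mul hA0 hA1 h1).congr (Eventually.of_forall fun τ => ?_), ?_⟩
  · beta_reduce
    rw [hq]
    ring
  · simp [hc1, mul_comm (p 1), mul_comm (MvPolynomial.coeff 0 (p 1)), MvPolynomial.coeff_C_mul]

/-- Multiplication by a smooth function of a decaying expansion. -/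
lemma IsFormalExpansion.exists_mul_comp (hA0 : 0 < A) (hA1 : A < 1)
    {p p' : ℕ → MvPolynomial (Fin 2) ℝ} {g h : ℝ → ℝ} (hh : IsFormalExpansion A p' h)
    (hp : ∀ k, p k ∈ varIdeal) (hg : IsFormalExpansion A p g)
    {f : ℝ → ℝ} {r : ℝ} (hr : 0 < r) (hf : ContDiffOn ℝ (⊤ : ℕ∞) f (Ioo (-r) r)) :
    ∃ q : ℕ → MvPolynomial (Fin 2) ℝ, IsFormalExpansion A q (fun τ => h τ * f (g τ)) ∧
      (q 1).coeff 0 = (p' 1).coeff 0 * f 0 := by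
  obtain ⟨c, hc0, -, hc⟩ := exists_taylor_coeff hr hf
  exact ⟨_, hh.mul hA0 hA1 (hg.comp_smooth hA0 hA1 hp hc),
    by simp [hc0, mul_comm (p' 1), mul_comm (MvPolynomial.coeff 0 (p' 1)), MvPolynomial.coeff_C_mul]⟩

lemma contDiffOn_sqrt_one_add : ContDiffOn ℝ (⊤ : ℕ∞) (fun s : ℝ => √(1 + s)) (Ioo (-1) 1) :=
  (contDiffOn_const.add contDiffOn_id).sqrt fun s hs => by
    have : 0 < 1 + s := by linarith [hs.1]
    exact this.ne'

variable {G : ℝ}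

lemma powerEval_X_zero_mul_rpow {τ : ℝ} (hτ : 0 < τ) :
    powerEval A (MvPolynomial.X 0) τ * τ ^ (1 - A) = 1 := by
  rw [powerEval_X_zero, ← Real.rpow_add hτ]
  simp

lemma powerEval_X_one_mul_rpow {τ : ℝ} (hτ : 0 < τ) :
    powerEval A (MvPolynomial.X 1) τ * τ ^ A = 1 := by
  rw [powerEval_X_one, ← Real.rpow_add hτ]
  simp

lemma IsFormalExpansion.tendsto_zero_of_mul_rpow (hA0 : 0 < A) (hA1 : A < 1)
    {p : ℕ → MvPolynomial (Fin 2) ℝ} {g : ℝ → ℝ} {i : Fin 2} {s : ℝ}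
    (hi : ∀ τ > 0, powerEval A (MvPolynomial.X i) τ * τ ^ s = 1)
    (hg : IsFormalExpansion A p (fun τ => g τ * τ ^ s)) : Tendsto g atTop (𝓝 0) := by
  have := (hg.of_mul_rpow hA0 hA1 hi).tendsto hA0 hA1
  have h0 : MvPolynomial.coeff 0 (MvPolynomial.X i * p 1) = 0 := by
    rw [MvPolynomial.coeff_X_mul', if_neg (by simp)]
  rwa [h0] at this

/-- The equations for the amplitude `R = √(1 + S)` and the phase `β = arcsin (v / R)`. -/
lemma SolvesPlanar.polar {S v : ℝ → ℝ} {T τ : ℝ} (hT : 0 ≤ T) (h : SolvesPlanar A G S v T)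
    (hτ : T < τ) (hz : ‖(S τ, v τ)‖ < 1 / 4) :
    HasDerivAt (fun τ => √(1 + S τ)) (-(√(1 + S τ) / (4 * τ)) -
      G * τ ^ (-A) * Real.sin (Real.arcsin (v τ / √(1 + S τ)))) τ ∧
    HasDerivAt (fun τ => Real.arcsin (v τ / √(1 + S τ))) (√(1 + S τ) ^ 2 - 1 -
      G * τ ^ (-A) * Real.cos (Real.arcsin (v τ / √(1 + S τ))) / √(1 + S τ)) τ := by
  have hτ0 : 0 < τ := hT.trans_lt hτ
  obtain ⟨hS, hv⟩ := h τ hτ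
  have hpos : 1 / 2 < 1 + S τ - v τ ^ 2 := half_lt_of_norm_lt hz
  have hpos1 : 0 < 1 + S τ := by nlinarith [sq_nonneg (v τ)]
  set R := √(1 + S τ) with hR
  have hR0 : 0 < R := Real.sqrt_pos.2 hpos1
  have hR2 : R ^ 2 = 1 + S τ := Real.sq_sqrt hpos1.le
  set C := √(1 + S τ - v τ ^ 2) with hC
  have hC0 : 0 < C := Real.sqrt_pos.2 (by linarith)
  have hC2 : C ^ 2 = 1 + S τ - v τ ^ 2 := Real.sq_sqrt (by linarith)
  have hq : (v τ / R) ^ 2 < 1 := by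
    rw [div_pow, hR2, div_lt_one hpos1]
    linarith
  have hq' : -1 < v τ / R ∧ v τ / R < 1 := abs_lt.1 ((sq_lt_one_iff_abs_lt_one _).1 hq)
  have hcos : √(1 - (v τ / R) ^ 2) = C / R := by
    rw [hC, hR, ← Real.sqrt_div' _ hpos1.le, ← hR, div_pow, hR2]
    congr 1
    field_simp
  have hsin : Real.sin (Real.arcsin (v τ / R)) = v τ / R :=
    Real.sin_arcsin hq'.1.le hq'.2.le
  rw [hsin, Real.cos_arcsin, hcos]
  have hRd : HasDerivAt (fun τ => √(1 + S τ)) (-(R / (4 * τ)) - G * τ ^ (-A) * (v τ / R)) τ := by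
    refine ((hS.const_add 1).sqrt hpos1.ne').congr_deriv ?_
    rw [← hR, ← hR2]
    field_simp
    ring
  refine ⟨hRd, ?_⟩
  have hd := (Real.hasDerivAt_arcsin hq'.1.ne' hq'.2.ne).comp τ (hv.div hRd hR0.ne')
  refine hd.congr_deriv ?_
  rw [hcos, resonanceNonlin]
  simp only
  rw [← hC, ← hR]
  have hS2 : S τ = R ^ 2 - 1 := by linarith
  have hv2 : v τ ^ 2 = R ^ 2 - C ^ 2 := by linarith
  rw [hS2]
  field_simp
  linear_combination 4 * τ * G * τ ^ (-A) * hv2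

/-- The expansion of the amplitude. -/
lemma exists_expansion_amplitude (hA0 : 0 < A) (hA1 : A < 1) {S : ℝ → ℝ}
    (hS : IsFormalExpansion A (formalS A G) (fun τ => S τ * τ ^ A)) :
    ∃ r : ℕ × ℕ → ℝ, r (0, 0) = G / 2 ∧
      HasPowerExpansion (fun τ => √(1 + S τ) - 1) (-A) (resonanceExponent A) r := by
  have hd : HasDerivAt (fun s : ℝ => √(1 + s) - 1) (1 / 2) 0 := by
    have := (((hasDerivAt_id (0 : ℝ)).const_add 1).sqrt (by simp)).sub_const 1
    simpa using this
  obtain ⟨q, hq, hq1⟩ := hS.exists_comp_mul_rpow hA0 hA1 (fun τ hτ => powerEval_X_one_mul_rpow hτ)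
    (f := fun s : ℝ => √(1 + s) - 1) one_pos (contDiffOn_sqrt_one_add.sub contDiffOn_const)
    (by simp)
  refine ⟨limitCoeff q, ?_, (hq.hasPowerExpansion hA0 hA1).mul_rpow ?_⟩
  · rw [limitCoeff_zero, hq1, formalS_one, hd.deriv, MvPolynomial.coeff_C, if_pos rfl]
    ring
  · filter_upwards [eventually_gt_atTop (0 : ℝ)] with τ hτ
    have := powerEval_X_one_mul_rpow (A := A) hτ
    rw [powerEval_X_one] at this
    linear_combination -(√(1 + S τ) - 1) * this

/-- The expansion of the phase. -/
lemma exists_expansion_phase (hA0 : 0 < A) (hA1 : A < 1) {S v : ℝ → ℝ}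
    (hS : IsFormalExpansion A (formalS A G) (fun τ => S τ * τ ^ A))
    (hv : IsFormalExpansion A (formalV A G) (fun τ => v τ * τ ^ (1 - A))) :
    ∃ a : ℕ × ℕ → ℝ, a (0, 0) = -(1 / (4 * G)) ∧
      HasPowerExpansion (fun τ => Real.arcsin (v τ / √(1 + S τ))) (A - 1)
        (resonanceExponent A) a := by
  have hinv : ContDiffOn ℝ (⊤ : ℕ∞) (fun s : ℝ => (√(1 + s))⁻¹) (Ioo (-1) 1) :=
    contDiffOn_sqrt_one_add.inv fun s hs => (Real.sqrt_pos.2 (by linarith [hs.1])).ne'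
  obtain ⟨p, hp, hp1⟩ := hv.exists_mul_comp hA0 hA1
    (fun k => Ideal.mul_mem_right _ _ (X_mem_varIdeal 1))
    (hS.of_mul_rpow hA0 hA1 fun τ hτ => powerEval_X_one_mul_rpow hτ) one_pos hinv
  have hp' : IsFormalExpansion A p (fun τ => v τ / √(1 + S τ) * τ ^ (1 - A)) :=
    hp.congr (Eventually.of_forall fun τ => by ring)
  obtain ⟨q, hq, hq1⟩ := hp'.exists_comp_mul_rpow hA0 hA1
    (fun τ hτ => powerEval_X_zero_mul_rpow hτ) (f := Real.arcsin) one_pos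
    (fun s hs => (Real.contDiffAt_arcsin hs.1.ne' hs.2.ne).contDiffWithinAt) Real.arcsin_zero
  refine ⟨limitCoeff q, ?_, (hq.hasPowerExpansion hA0 hA1).mul_rpow ?_⟩
  · rw [limitCoeff_zero, hq1, hp1, formalV_one, MvPolynomial.coeff_C, if_pos rfl, Real.deriv_arcsin]
    simp
  · filter_upwards [eventually_gt_atTop (0 : ℝ)] with τ hτ
    have := powerEval_X_zero_mul_rpow (A := A) hτ
    rw [powerEval_X_zero, neg_sub] at this
    linear_combination -(Real.arcsin (v τ / √(1 + S τ))) * this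

end

/-! ### The primary resonance equation -/

/-- The rotation by `τ` in the phase cancels the prefactor `e^(-i t²/2)`, leaving only the slow
phase `α`. -/
lemma resonanceAnsatz_eq (ρ α : ℝ → ℝ) (t : ℝ) : resonanceAnsatz ρ α t =
    (√t : ℂ) * (((1 + ρ (t ^ 2 / 2) : ℝ) : ℂ) * Complex.exp (Complex.I * (α (t ^ 2 / 2) : ℂ))) := by
  have h : Complex.exp (Complex.I * (α (t ^ 2 / 2) : ℂ)) =
      Complex.exp (-Complex.I * ((t ^ 2 / 2 : ℝ) : ℂ)) *
        Complex.exp (Complex.I * ((t ^ 2 / 2 + α (t ^ 2 / 2) : ℝ) : ℂ)) := by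
    rw [← Complex.exp_add]
    congr 1
    push_cast
    ring
  rw [resonanceAnsatz, h]
  ring

lemma norm_resonanceAnsatz {ρ α : ℝ → ℝ} {t : ℝ} (h : 0 ≤ 1 + ρ (t ^ 2 / 2)) :
    ‖resonanceAnsatz ρ α t‖ = √t * (1 + ρ (t ^ 2 / 2)) := by
  rw [resonanceAnsatz_eq, norm_mul, norm_mul, Complex.norm_real, Complex.norm_real,
    mul_comm Complex.I, Complex.norm_exp_ofReal_mul_I, mul_one, Real.norm_of_nonneg h,
    Real.norm_of_nonneg (Real.sqrt_nonneg _)]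

/-- The amplitude and phase equations imply the primary resonance equation. -/
lemma resonanceAnsatz_solves {ρ α : ℝ → ℝ} {t g : ℝ} (ht : 0 < t) (hR : 0 < 1 + ρ (t ^ 2 / 2))
    (hρ : HasDerivAt ρ (-((1 + ρ (t ^ 2 / 2)) / (4 * (t ^ 2 / 2))) -
      g * Real.sin (α (t ^ 2 / 2))) (t ^ 2 / 2))
    (hα : HasDerivAt α ((1 + ρ (t ^ 2 / 2)) ^ 2 - 1 -
      g * Real.cos (α (t ^ 2 / 2)) / (1 + ρ (t ^ 2 / 2))) (t ^ 2 / 2)) :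
    DifferentiableAt ℝ (resonanceAnsatz ρ α) t ∧
      Complex.I * deriv (resonanceAnsatz ρ α) t +
        ((‖resonanceAnsatz ρ α t‖ ^ 2 - t : ℝ) : ℂ) * resonanceAnsatz ρ α t =
          ((t * √t * g : ℝ) : ℂ) := by
  have hτ : HasDerivAt (fun t : ℝ => t ^ 2 / 2) t t := by
    refine ((hasDerivAt_pow 2 t).div_const 2).congr_deriv ?_
    norm_num
  have h1 := ((hρ.comp t hτ).const_add 1).ofReal_comp
  have h2 := ((hα.comp t hτ).ofReal_comp.const_mul Complex.I).cexp
  have h3 := (Real.hasDerivAt_sqrt ht.ne').ofReal_comp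
  have h4 := h3.mul (h1.mul h2)
  have h5 := h4.congr_of_eventuallyEq (Eventually.of_forall (resonanceAnsatz_eq ρ α))
  refine ⟨h5.differentiableAt, ?_⟩
  rw [h5.deriv, norm_resonanceAnsatz hR.le, resonanceAnsatz_eq]
  simp only [Function.comp_apply, Pi.mul_apply]
  set R : ℝ := 1 + ρ (t ^ 2 / 2) with hRdef
  set β : ℝ := α (t ^ 2 / 2) with hβ
  have hs0 : 0 < √t := Real.sqrt_pos.2 ht
  have hs2 : √t ^ 2 = t := Real.sq_sqrt ht.le
  set s : ℝ := √t with hs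
  -- `e^(-iβ) e^(iβ) = 1` puts the real forcing in the rotating frame, where its cosine and sine
  -- parts match the phase and amplitude equations.
  have hexp : (Complex.cos (β : ℂ) - Complex.I * Complex.sin (β : ℂ)) *
      Complex.exp (Complex.I * (β : ℂ)) = 1 := by
    rw [mul_comm Complex.I (β : ℂ), Complex.exp_mul_I]
    linear_combination Complex.cos_sq_add_sin_sq (β : ℂ) - Complex.sin (β : ℂ) ^ 2 * Complex.I_sq
  have hsC : (s : ℂ) ≠ 0 := by exact_mod_cast hs0.ne'
  have hRC : (R : ℂ) ≠ 0 := by exact_mod_cast hR.ne'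
  rw [← hs2]
  push_cast
  generalize Complex.exp (Complex.I * (β : ℂ)) = E at hexp ⊢
  generalize Complex.cos (β : ℂ) = c at hexp ⊢
  generalize Complex.sin (β : ℂ) = d at hexp ⊢
  field_simp
  linear_combination 8 * (s : ℂ) ^ 4 * g * hexp +
    8 * (s : ℂ) ^ 4 * E * ((R : ℂ) ^ 3 - R - g * c) * Complex.I_sq

/-- The factor `t √t` comes from `dτ = t dt` and the amplitude scale `√t`. The choice of `A` and `𝓕`
is the one for which `3/2 - 2A = 2λ` and the powers of 2 cancel. -/
lemma mul_rpow_neg_sq_half (lam f₁ : ℝ) {t : ℝ} (ht : 0 < t) :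
    t * √t * ((2 : ℝ) ^ (-(3 / 4 - lam)) * f₁ * (t ^ 2 / 2) ^ (-(3 / 4 - lam))) =
      f₁ * t ^ (2 * lam) := by
  have h1 : (2 : ℝ) ^ (-(3 / 4 - lam)) * (t ^ 2 / 2) ^ (-(3 / 4 - lam)) =
      t ^ (2 * (-(3 / 4 - lam))) := by
    rw [← Real.mul_rpow zero_le_two (by positivity), Real.rpow_mul ht.le, Real.rpow_two]
    congr 1
    ring
  have h2 : t ^ (2 * lam) = t * √t * t ^ (2 * (-(3 / 4 - lam))) := by
    conv_rhs => rw [Real.sqrt_eq_rpow, ← Real.rpow_one_add' ht.le (by norm_num),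
      ← Real.rpow_add ht]
    congr 1
    ring
  rw [h2, ← h1]
  ring

/-- Autoresonant solutions of the primary resonance equation with phase near `π n`. -/
lemma exists_autoresonant_solution (lam f₁ : ℝ) (hlam : -(1 / 4 : ℝ) < lam) (hlam' : lam < 3 / 4)
    (hf₁ : f₁ ≠ 0) (n : ℕ) :
    ∃ (t₀ : ℝ) (Ψ : ℝ → ℂ) (ρ α : ℝ → ℝ) (a r : ℕ × ℕ → ℝ),
      0 < t₀ ∧
      SolvesPrimaryResonance (fun t => f₁ * t ^ (2 * lam)) t₀ Ψ ∧
      (∀ t : ℝ, t₀ < t → Ψ t = resonanceAnsatz ρ α t) ∧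
      DifferentiableOn ℝ ρ (Set.Ioi (t₀ ^ 2 / 2)) ∧
      DifferentiableOn ℝ α (Set.Ioi (t₀ ^ 2 / 2)) ∧
      HasPowerExpansion (fun τ => α τ - Real.pi * (n : ℝ)) ((3 / 4 - lam) - 1)
        (resonanceExponent (3 / 4 - lam)) a ∧
      HasPowerExpansion ρ (-(3 / 4 - lam)) (resonanceExponent (3 / 4 - lam)) r ∧
      a (0, 0) = -((-1) ^ n / (4 * ((2 : ℝ) ^ (-(3 / 4 - lam)) * f₁))) ∧
      r (0, 0) = (-1) ^ n * ((2 : ℝ) ^ (-(3 / 4 - lam)) * f₁) / 2 ∧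
      (fun t : ℝ => ‖Ψ t‖) ~[atTop] (fun t : ℝ => √t) := by
  have hforce := fun {t : ℝ} (ht : 0 < t) => mul_rpow_neg_sq_half lam f₁ ht
  obtain ⟨A, hA⟩ : ∃ A, A = 3 / 4 - lam := ⟨_, rfl⟩
  rw [← hA] at hforce ⊢
  have hA0 : 0 < A := by linarith
  have hA1 : A < 1 := by linarith
  obtain ⟨F, hF⟩ : ∃ F, F = (2 : ℝ) ^ (-A) * f₁ := ⟨_, rfl⟩
  rw [← hF] at hforce ⊢
  have hF0 : F ≠ 0 := by rw [hF]; positivity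
  -- Shifting the phase by `π n` multiplies sine and cosine by `σ`, so the planar problem is solved
  -- with `G = σ F`.
  obtain ⟨σ, hσ⟩ : ∃ σ : ℝ, σ = (-1) ^ n := ⟨_, rfl⟩
  have hσ2 : σ * σ = 1 := by rw [hσ, ← mul_pow]; simp
  have hσ0 : σ ≠ 0 := by rintro rfl; simp at hσ2
  have hsin (x : ℝ) : Real.sin (Real.pi * n + x) = σ * Real.sin x := by
    rw [hσ, add_comm, mul_comm Real.pi, Real.sin_add_nat_mul_pi]
  have hcos (x : ℝ) : Real.cos (Real.pi * n + x) = σ * Real.cos x := by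
    rw [hσ, add_comm, mul_comm Real.pi, Real.cos_add_nat_mul_pi]
  rw [← hσ]
  obtain ⟨S, v, T₁, hT₁, hsol, hS, hv⟩ := exists_planar_solution hA0 hA1 (mul_ne_zero hσ0 hF0)
  have hS0 := hS.tendsto_zero_of_mul_rpow hA0 hA1 fun τ hτ => powerEval_X_one_mul_rpow hτ
  have hv0 := hv.tendsto_zero_of_mul_rpow hA0 hA1 fun τ hτ => powerEval_X_zero_mul_rpow hτ
  obtain ⟨T₂, hT₂⟩ : ∃ T₂, ∀ τ ≥ T₂, ‖(S τ, v τ)‖ < 1 / 4 := by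
    have h := (hS0.prodMk_nhds hv0).norm
    rw [Prod.mk_zero_zero, norm_zero] at h
    exact eventually_atTop.1 (h.eventually_lt_const (by norm_num))
  obtain ⟨r, hr0, hr⟩ := exists_expansion_amplitude hA0 hA1 hS
  obtain ⟨a, ha0, ha⟩ := exists_expansion_phase hA0 hA1 hS hv
  set T := max T₁ T₂ with hT
  have hT0 : 0 < T := hT₁.trans_le (le_max_left _ _)
  have hpolar (τ : ℝ) (hτ : T < τ) := hsol.polar hT₁.le ((le_max_left _ _).trans_lt hτ)
    (hT₂ τ ((le_max_right _ _).trans hτ.le))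
  have hpos (τ : ℝ) (hτ : T < τ) : 0 < √(1 + S τ) := by
    have := (norm_fst_le _).trans_lt (hT₂ τ ((le_max_right _ _).trans hτ.le))
    rw [Real.norm_eq_abs, abs_lt] at this
    exact Real.sqrt_pos.2 (by linarith [this.1])
  -- The start time `t₀ = √(2T)` corresponds to `τ = T`.
  have ht0 : √(2 * T) ^ 2 / 2 = T := by rw [Real.sq_sqrt (by positivity)]; ring
  have hρd (τ : ℝ) (hτ : T < τ) : HasDerivAt (fun τ => √(1 + S τ) - 1) _ τ :=
    (hpolar τ hτ).1.sub_const 1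
  have hαd (τ : ℝ) (hτ : T < τ) :
      HasDerivAt (fun τ => Real.pi * n + Real.arcsin (v τ / √(1 + S τ))) _ τ :=
    (hpolar τ hτ).2.const_add (Real.pi * n)
  refine ⟨√(2 * T), _, fun τ => √(1 + S τ) - 1,
    fun τ => Real.pi * n + Real.arcsin (v τ / √(1 + S τ)), a, r, Real.sqrt_pos.2 (by positivity),
    ?_, fun t _ => rfl, ?_, ?_, ?_, hr, ?_, hr0, ?_⟩
  · intro t ht
    have ht' : 0 < t := (Real.sqrt_nonneg _).trans_lt ht
    have hτ : T < t ^ 2 / 2 := by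
      rw [← ht0]
      gcongr
    have h := resonanceAnsatz_solves (ρ := fun τ => √(1 + S τ) - 1)
      (α := fun τ => Real.pi * n + Real.arcsin (v τ / √(1 + S τ))) (g := F * (t ^ 2 / 2) ^ (-A))
      ht' (by simpa using hpos _ hτ) ((hρd _ hτ).congr_deriv ?_) ((hαd _ hτ).congr_deriv ?_)
    · rwa [hforce ht'] at h
    · rw [hsin]
      ring
    · rw [hcos, add_sub_cancel]
      ring
  · rw [ht0]
    exact fun τ hτ => (hρd τ hτ).differentiableAt.differentiableWithinAt
  · rw [ht0]
    exact fun τ hτ => (hαd τ hτ).differentiableAt.differentiableWithinAt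
  · simpa only [add_sub_cancel_left] using ha
  -- `1/(σF) = σ/F` because `σ² = 1`.
  · rw [ha0]
    field_simp
    linear_combination hσ2
  · have h1 : Tendsto (fun τ => √(1 + S τ)) atTop (𝓝 1) := by
      simpa using (hS0.const_add 1).sqrt
    have h2 : Tendsto (fun t : ℝ => t ^ 2 / 2) atTop atTop :=
      (tendsto_pow_atTop two_ne_zero).atTop_div_const two_pos
    refine (isEquivalent_iff_exists_eq_mul).2
      ⟨fun t => √(1 + S (t ^ 2 / 2)), h1.comp h2, Eventually.of_forall fun t => ?_⟩
    beta_reduce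
    rw [norm_resonanceAnsatz (by simp)]
    simp [mul_comm]

theorem mainTheorem2 (lam f₁ : ℝ) (hlam : -(1 / 4 : ℝ) < lam) (hlam' : lam < 3 / 4)
    (hf₁ : f₁ ≠ 0) :
    (∀ n : Fin 2,
      ∃ (t₀ : ℝ) (Ψ : ℝ → ℂ) (ρ α : ℝ → ℝ) (a r : ℕ × ℕ → ℝ),
        0 < t₀ ∧
        SolvesPrimaryResonance (fun t => f₁ * t ^ (2 * lam)) t₀ Ψ ∧
        (∀ t : ℝ, t₀ < t → Ψ t = resonanceAnsatz ρ α t) ∧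
        DifferentiableOn ℝ ρ (Set.Ioi (t₀ ^ 2 / 2)) ∧
        DifferentiableOn ℝ α (Set.Ioi (t₀ ^ 2 / 2)) ∧
        HasPowerExpansion (fun τ => α τ - Real.pi * ((n : ℕ) : ℝ)) ((3 / 4 - lam) - 1)
          (resonanceExponent (3 / 4 - lam)) a ∧
        HasPowerExpansion ρ (-(3 / 4 - lam)) (resonanceExponent (3 / 4 - lam)) r ∧
        a (0, 0) = -((-1) ^ (n : ℕ) / (4 * ((2 : ℝ) ^ (-(3 / 4 - lam)) * f₁))) ∧
        r (0, 0) = (-1) ^ (n : ℕ) * ((2 : ℝ) ^ (-(3 / 4 - lam)) * f₁) / 2 ∧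
        (fun t : ℝ => ‖Ψ t‖) ~[atTop] (fun t : ℝ => √t)) ∧
    (lam < 0 → Tendsto (fun t : ℝ => f₁ * t ^ (2 * lam)) atTop (𝓝 0)) := by
  refine ⟨fun n => exists_autoresonant_solution lam f₁ hlam hlam' hf₁ n, fun h => ?_⟩
  have := (tendsto_rpow_neg_atTop (y := -(2 * lam)) (by linarith)).const_mul f₁
  simpa using this
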